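/- **Setting.** Manifolds are real, finite dimensional, smooth, without boundary. Let $\tau:M\to\mathbb R$ and $\nu:U\to M$ be smooth fibre bundles, $\rho:U\to J^1\tau$ a smooth bundle morphism over $\mathrm{id}_M$, and $L:U\to\mathbb R$ a smooth function. Write $V\tau=\ker T\tau$, and $\mathbf T:J^1\tau\to TM$, $\mathbf T(j^1_tc)=\dot c(t)$. A curve on a closed interval is smooth if it is the restriction of a smooth curve on a larger open interval. A map $f:[a,b]\to B$ is *induced by* curves $f_i:[a_{i-1},a_i]\to B$, for a subdivision $a=a_0<\dots<a_\ell=b$ with $\ell\ge 1$, if $f=f_i$ on $]a_{i-1},a_i]$ for every $i$ and $f(a)=f_1(a)$. It is *piecewise* (of some class) if it is induced by finitely many smooth curves (of that class). A *smooth control* is a smooth section $u$ of $\tau\circ\nu$ with $\rho\circ u=j^1(\nu\circ u)$. A *control* $u:[a,b]\to U$ is a map induced by finitely many smooth controls such that $c=\nu\circ u$ is continuous. *Jets and transport.* Identify $j^1_m\sigma\in J^1\nu$ with the pair $(\sigma(m),T_m\sigma)$. A smooth curve $\psi$ in $J^1\nu$, with $\psi(t)=j^1_{c(t)}\sigma_t$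 and projection $u$ on $U$, is *admissible* if $\dot u(t)=T_{c(t)}\sigma_t\big(\mathbf T(\rho(u(t)))\big)$. Let $\psi$ be a piecewise admissible curve in $J^1\nu$ projecting onto a control $u$. The transport $\psi^b_{t_0}:V_{c(t_0)}\tau\to V_{c(b)}\tau$ sends $X(t_0)$ to $X(b)$, where $X$ is a continuous piecewise section of $V\tau$ along $c$ with $\dot X(t)=\mathfrak s\big(T(\mathbf T\circ\rho)(T_{c(t)}\sigma_t(X(t)))\big)$, $\mathfrak s$ being the canonical involution of $TTM$ (at break points $\dot X$ is the left derivative). Let $\mathcal D$ be the set of the vector fields $\mathbf T\circ\rho\circ\sigma$ with $\sigma$ a local smooth section of $\nu$. The *vertical variational cone* is $$V_{c(b)}R_{c(a)}(\psi)=\Big\{\sum_{i=1}^s\delta^i\,\psi^b_{t_i}\big(Y_i(c(t_i))-\dot c(t_i)\big)\ \Big|\ s\in\mathbb N,\ \delta^i\ge 0,\ t_i\in\,]a,b],\ Y_i\in\mathcal D\text{ defined at }c(t_i)\Big\}\subset V_{c(b)}\tau ,$$ where $\dot c(t)=\mathbf T(\rho(u(t)))$. The dual of a cone $C$ in a vector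 space $\mathcal V$ is $C^*=\{\alpha\in\mathcal V^*\mid\langle\alpha,v\rangle\le 0\ \ \forall v\in C\}$. *Extended structure.* Put $\bar M=M\times\mathbb R$, $\bar U=U\times\mathbb R$, $\bar\tau(m,J)=\tau(m)$, $\bar\nu(u,J)=(\nu(u),J)$, and let $\bar\rho$ be given by $\mathbf T(\bar\rho(u,J))=(\mathbf T(\rho(u)),L(u))$. The notions above apply to $(\bar\tau,\bar\nu,\bar\rho)$. Identify $V_{(m,J)}\bar\tau=V_m\tau\times\mathbb R$ and $V^*_{(m,J)}\bar\tau=V^*_m\tau\times\mathbb R$. *Multipliers.* For $\lambda\in\mathbb R$ let $H_\lambda:U\times_MV^*\tau\to U\times_MT^*M$, $H_\lambda(u,\eta)=(u,\alpha)$, where $\alpha\in T^*_{\nu(u)}M$ is the unique covector that restricts to $\eta$ on $V_{\nu(u)}\tau$ and satisfies $\langle\alpha,\mathbf T(\rho(u))\rangle+\lambda L(u)=0$. Let $\omega_\lambda$ be the pull-back by $H_\lambda$ of the two-form induced on $U\times_MT^*M$ by the canonical symplectic form of $T^*M$. A *multiplier* of a control $u:[a,b]\to U$ is a pair $(\eta,\lambda)$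 of a continuous piecewise section $\eta$ of $V^*\tau$ along $c=\nu\circ u$ and $\lambda\in\mathbb R$ such that (1) $i_{(\dot u(t),\dot\eta(t))}\omega_\lambda=0$ on every smooth part of $(u,\eta)$; (2) for every $t_0\in[a,b]$, with $H_\lambda(u(t_0),\eta(t_0))=(u(t_0),\alpha_0)$, the function $u'\mapsto\langle\alpha_0,\mathbf T(\rho(u'))\rangle+\lambda L(u')$ on $\nu^{-1}(c(t_0))$ attains a global maximum at $u'=u(t_0)$; (3) $(\eta(t),\lambda)\ne(0,0)$ for all $t\in[a,b]$. **Theorem 7.2.** Let $u:[a,b]\to U$ be a control with base section $c$, and put $m=c(a)$, $n=c(b)$. For $J_0\in\mathbb R$ put $\bar u(t)=\big(u(t),J_0+\int_a^tL(u(s))\,ds\big)$, $\bar m=(m,J_0)$, $\bar n=\big(n,J_0+\int_a^bL(u(s))\,ds\big)$, and let $\bar\psi$ be a piecewise admissible curve in $J^1\bar\nu$ projecting onto $\bar u$. (i) Let $\bar\eta_0=(\eta_0,\lambda_0)\in V^*_{\bar n}\bar\tau$, $\bar\eta_0\neq 0$. Then $\bar\eta_0\in\big(V_{\bar n}R_{\bar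 m}(\bar\psi)\big)^*$ if and only if there is a section $\eta$ of $V^*\tau$ along $c$ with $\eta(b)=\eta_0$ such that $(\eta,\lambda_0)$ is a multiplier of $u$. (ii) Consequently the dual cone $\big(V_{\bar n}R_{\bar m}(\bar\psi)\big)^*\subset V^*_n\tau\times\mathbb R$ and the closure of $V_{\bar n}R_{\bar m}(\bar\psi)$ in $V_n\tau\times\mathbb R$ depend only on $u$: they are the same for all choices of $J_0$ and $\bar\psi$. -/

import Mathlib

open scoped Manifold ContDiff Topology
open Set

noncomputable section

/-! ### Smooth fibre bundles and piecewise curves -/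

/-- `π : Z → B` is a smooth fibre bundle with typical fibre `F`: it is smooth and every point of `B`
has an open neighbourhood `W` over which there is a diffeomorphism `z ↦ (π z, φ z)` of `π⁻¹ W` onto
`W × F`, with inverse `χ`. -/
structure IsSmoothFibreBundle
    {EB : Type*} [NormedAddCommGroup EB] [NormedSpace ℝ EB] {HB : Type*} [TopologicalSpace HB]
    (IB : ModelWithCorners ℝ EB HB) {B : Type*} [TopologicalSpace B] [ChartedSpace HB B]
    {EF : Type*} [NormedAddCommGroup EF] [NormedSpace ℝ EF] {HF : Type*} [TopologicalSpace HF]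
    (IF : ModelWithCorners ℝ EF HF) (F : Type*) [TopologicalSpace F] [ChartedSpace HF F]
    {EZ : Type*} [NormedAddCommGroup EZ] [NormedSpace ℝ EZ] {HZ : Type*} [TopologicalSpace HZ]
    (IZ : ModelWithCorners ℝ EZ HZ) {Z : Type*} [TopologicalSpace Z] [ChartedSpace HZ Z]
    (π : Z → B) : Prop where
  smooth : ContMDiff IZ IB ∞ π
  locally_trivial : ∀ b : B, ∃ W : Set B, IsOpen W ∧ b ∈ W ∧ ∃ (φ : Z → F) (χ : B × F → Z),
    ContMDiffOn IZ IF ∞ φ (π ⁻¹' W) ∧ ContMDiffOn (IB.prod IF) IZ ∞ χ (W ×ˢ univ) ∧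
    (∀ x ∈ W, ∀ f : F, π (χ (x, f)) = x ∧ φ (χ (x, f)) = f) ∧
    (∀ z ∈ π ⁻¹' W, χ (π z, φ z) = z)

/-- `f` is, on `[a, b]`, induced by finitely many curves of the class `P`: there is a subdivision
`a = s 0 < s 1 < ⋯ < s n = b` and for each `i < n` a curve `g` with `P (s i) (s (i + 1)) g` such
that `f = g` on the half-open interval `]s i, s (i + 1)]`, and also at `a` if `i = 0`. In particular
`f` is left continuous on `]a, b]` and right continuous at `a` if the curves in `P` are
continuous. -/
def IsPiecewise {B : Type*} (P : ℝ → ℝ → (ℝ → B) → Prop) (a b : ℝ) (f : ℝ → B) : Prop :=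
  ∃ (n : ℕ) (s : ℕ → ℝ), 0 < n ∧ s 0 = a ∧ s n = b ∧
    ∀ i < n, s i < s (i + 1) ∧ ∃ g : ℝ → B, P (s i) (s (i + 1)) g ∧
      EqOn f g (Ioc (s i) (s (i + 1))) ∧ (i = 0 → f a = g a)

/-! ### Convex cones -/

/-- All finite linear combinations, with non-negative coefficients, of elements of `S`. -/
def finiteConicCombinations {V : Type*} [AddCommGroup V] [Module ℝ V] (S : Set V) : Set V :=
  {v | ∃ (s : ℕ) (δ : Fin s → ℝ) (w : Fin s → V),
    (∀ i, 0 ≤ δ i) ∧ (∀ i, w i ∈ S) ∧ v = ∑ i, δ i • w i}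

/-- The dual `{α | ⟨α, v⟩ ≤ 0 for all v ∈ C}` of a cone `C`. -/
def dualCone {V : Type*} [AddCommGroup V] [Module ℝ V] [TopologicalSpace V] (C : Set V) :
    Set (V →L[ℝ] ℝ) :=
  {α | ∀ v ∈ C, α v ≤ 0}

section Tangent

variable {E : Type*} [NormedAddCommGroup E] [NormedSpace ℝ E] {H : Type*} [TopologicalSpace H]
  (I : ModelWithCorners ℝ E H) (M : Type*) [TopologicalSpace M] [ChartedSpace H M]
  [IsManifold I ∞ M]

/-! ### The canonical involution on `TTM` and the canonical symplectic form on `T*M` -/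

/-- The canonical involution of `TTM`. In Mathlib a tangent vector of `TM` at `(x, v)` is a pair of
components `(a, b)` in the bundle chart of `TM` induced by the preferred chart of `M` at `x`, and in
such natural coordinates the involution is `(x, v, a, b) ↦ (x, a, v, b)`. -/
def canonicalInvolution (P : TangentBundle I.tangent (TangentBundle I M)) :
    TangentBundle I.tangent (TangentBundle I M) :=
  ⟨⟨P.proj.proj, (P.2 : E × E).1⟩, ((P.proj.2, (P.2 : E × E).2) : E × E)⟩

/-- The cotangent bundle `T*M`. -/
abbrev CotangentBundle : Type _ :=
  Bundle.TotalSpace (E →L[ℝ] ℝ) (fun x : M => TangentSpace I x →L[ℝ] Bundle.Trivial M ℝ x)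

variable {M}

/-- A covector `α` at `x`, as a point of `T*M`. -/
abbrev CotangentBundle.mk (x : M) (α : TangentSpace I x →L[ℝ] ℝ) : CotangentBundle I M := ⟨x, α⟩

variable (M)

/-- The canonical symplectic form `dp ∧ dx` of `T*M`, evaluated on two tangent vectors `P`, `Q` with
the same base point. A tangent vector of `T*M` at `(x, α)` is a pair `(a, β)` of components in the
natural coordinates `(x, p)` induced by the preferred chart of `M` at `x`, and
`(dp ∧ dx) ((a, β), (a', β')) = β a' - β' a`. -/
def canonicalTwoForm
    (P Q : TangentBundle (I.prod 𝓘(ℝ, E →L[ℝ] ℝ)) (CotangentBundle I M)) : ℝ :=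
  (P.2 : E × (E →L[ℝ] ℝ)).2 (Q.2 : E × (E →L[ℝ] ℝ)).1 -
    (Q.2 : E × (E →L[ℝ] ℝ)).2 (P.2 : E × (E →L[ℝ] ℝ)).1

variable {I M}

/-! ### First jets of a bundle over the real line, vertical vectors and covectors -/

/-- The fibre over `m` of the first jet bundle `J¹τ` of `τ : M → ℝ`, where the jet `j¹ₜc` of a
section `c` with `c t = m` is identified with its total time derivative `𝐓 (j¹ₜc) = ċ t`: it is the
affine space of the tangent vectors at `m` that project onto `∂/∂t`. -/
def FirstJet (I : ModelWithCorners ℝ E H) (τ : M → ℝ) (m : M) : Type _ :=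
  {v : TangentSpace I m // (mfderiv I 𝓘(ℝ, ℝ) τ m v : ℝ) = 1}

/-- The total time derivative `𝐓 : J¹τ → TM`. -/
def FirstJet.total {τ : M → ℝ} {m : M} (j : FirstJet I τ m) : TangentSpace I m := j.1

/-- The vertical tangent space `V_mτ = ker T_mτ`. -/
abbrev VerticalSpace (I : ModelWithCorners ℝ E H) (τ : M → ℝ) (m : M) :
    Submodule ℝ (TangentSpace I m) :=
  LinearMap.ker (mfderiv I 𝓘(ℝ, ℝ) τ m).toLinearMap

/-- The fibre `V*_mτ` of the dual bundle of `Vτ`. -/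
abbrev VerticalDual (I : ModelWithCorners ℝ E H) (τ : M → ℝ) (m : M) : Type _ :=
  VerticalSpace I τ m →L[ℝ] ℝ

/-- The projection `T*_mM → V*_mτ`. -/
def restrictVertical (τ : M → ℝ) {m : M} (α : TangentSpace I m →L[ℝ] ℝ) : VerticalDual I τ m :=
  α.comp (VerticalSpace I τ m).subtypeL

/-- A curve `t ↦ (x t, η t)` in `V*τ` is smooth on `s`. As `V*τ` is the quotient of `T*M` by the
annihilator of `Vτ`, this means that it is the projection of a smooth curve in `T*M`. -/
def SmoothVerticalDualOn (I : ModelWithCorners ℝ E H) [IsManifold I ∞ M] (τ : M → ℝ)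
    (x : ℝ → M) (η : ∀ t, VerticalDual I τ (x t)) (s : Set ℝ) : Prop :=
  ∃ α : ∀ t, TangentSpace I (x t) →L[ℝ] ℝ,
    ContMDiffOn 𝓘(ℝ, ℝ) (I.prod 𝓘(ℝ, E →L[ℝ] ℝ)) ∞ (fun t => CotangentBundle.mk I (x t) (α t)) s ∧
    ∀ t ∈ s, restrictVertical τ (α t) = η t

/-- A curve `t ↦ (x t, η t)` in `V*τ` is continuous on `s`. -/
def ContinuousVerticalDualOn (I : ModelWithCorners ℝ E H) [IsManifold I ∞ M] (τ : M → ℝ)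
    (x : ℝ → M) (η : ∀ t, VerticalDual I τ (x t)) (s : Set ℝ) : Prop :=
  ∃ α : ∀ t, TangentSpace I (x t) →L[ℝ] ℝ,
    ContinuousOn (fun t => CotangentBundle.mk I (x t) (α t)) s ∧
    ∀ t ∈ s, restrictVertical τ (α t) = η t

end Tangent

/-! ### Geometric control structures -/

/-- A geometric control structure `(τ, ν, ρ)`: a smooth fibre bundle `τ : M → ℝ` with typical fibre
`Q`, a smooth fibre bundle `ν : U → M` with typical fibre `F`, and a smooth bundle morphism
`ρ : U → J¹τ` over the identity of `M`. Smoothness of `ρ` is smoothness of `𝐓 ∘ ρ : U → TM`, as `𝐓`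
is an embedding. -/
structure GeometricControlStructure
    {E : Type*} [NormedAddCommGroup E] [NormedSpace ℝ E] {H : Type*} [TopologicalSpace H]
    (I : ModelWithCorners ℝ E H) (M : Type*) [TopologicalSpace M] [ChartedSpace H M]
    [IsManifold I ∞ M]
    {EU : Type*} [NormedAddCommGroup EU] [NormedSpace ℝ EU] {HU : Type*} [TopologicalSpace HU]
    (IU : ModelWithCorners ℝ EU HU) (U : Type*) [TopologicalSpace U] [ChartedSpace HU U]
    [IsManifold IU ∞ U]
    {EQ : Type*} [NormedAddCommGroup EQ] [NormedSpace ℝ EQ] {HQ : Type*} [TopologicalSpace HQ]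
    (IQ : ModelWithCorners ℝ EQ HQ) (Q : Type*) [TopologicalSpace Q] [ChartedSpace HQ Q]
    {EF : Type*} [NormedAddCommGroup EF] [NormedSpace ℝ EF] {HF : Type*} [TopologicalSpace HF]
    (IF : ModelWithCorners ℝ EF HF) (F : Type*) [TopologicalSpace F] [ChartedSpace HF F] where
  τ : M → ℝ
  ν : U → M
  ρ : ∀ u : U, FirstJet I τ (ν u)
  bundle_τ : IsSmoothFibreBundle 𝓘(ℝ, ℝ) IQ Q I τ
  bundle_ν : IsSmoothFibreBundle I IF F IU ν
  smooth_ρ : ContMDiff IU I.tangent ∞ (fun u => (⟨ν u, (ρ u).total⟩ : TangentBundle I M))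

/-- A geometric optimal control structure `(τ, ν, ρ, L)`, with cost function `L`. -/
structure GeometricOptimalControlStructure
    {E : Type*} [NormedAddCommGroup E] [NormedSpace ℝ E] {H : Type*} [TopologicalSpace H]
    (I : ModelWithCorners ℝ E H) (M : Type*) [TopologicalSpace M] [ChartedSpace H M]
    [IsManifold I ∞ M]
    {EU : Type*} [NormedAddCommGroup EU] [NormedSpace ℝ EU] {HU : Type*} [TopologicalSpace HU]
    (IU : ModelWithCorners ℝ EU HU) (U : Type*) [TopologicalSpace U] [ChartedSpace HU U]
    [IsManifold IU ∞ U]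
    {EQ : Type*} [NormedAddCommGroup EQ] [NormedSpace ℝ EQ] {HQ : Type*} [TopologicalSpace HQ]
    (IQ : ModelWithCorners ℝ EQ HQ) (Q : Type*) [TopologicalSpace Q] [ChartedSpace HQ Q]
    {EF : Type*} [NormedAddCommGroup EF] [NormedSpace ℝ EF] {HF : Type*} [TopologicalSpace HF]
    (IF : ModelWithCorners ℝ EF HF) (F : Type*) [TopologicalSpace F] [ChartedSpace HF F]
    extends GeometricControlStructure I M IU U IQ Q IF F where
  L : U → ℝ
  smooth_L : ContMDiff IU 𝓘(ℝ, ℝ) ∞ L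

namespace GeometricControlStructure

variable {E : Type*} [NormedAddCommGroup E] [NormedSpace ℝ E] {H : Type*} [TopologicalSpace H]
  {I : ModelWithCorners ℝ E H} {M : Type*} [TopologicalSpace M] [ChartedSpace H M]
  [IsManifold I ∞ M]
  {EU : Type*} [NormedAddCommGroup EU] [NormedSpace ℝ EU] {HU : Type*} [TopologicalSpace HU]
  {IU : ModelWithCorners ℝ EU HU} {U : Type*} [TopologicalSpace U] [ChartedSpace HU U]
  [IsManifold IU ∞ U]
  {EQ : Type*} [NormedAddCommGroup EQ] [NormedSpace ℝ EQ] {HQ : Type*} [TopologicalSpace HQ]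
  {IQ : ModelWithCorners ℝ EQ HQ} {Q : Type*} [TopologicalSpace Q] [ChartedSpace HQ Q]
  {EF : Type*} [NormedAddCommGroup EF] [NormedSpace ℝ EF] {HF : Type*} [TopologicalSpace HF]
  {IF : ModelWithCorners ℝ EF HF} {F : Type*} [TopologicalSpace F] [ChartedSpace HF F]
  (G : GeometricControlStructure I M IU U IQ Q IF F)

/-- The tangent vector `𝐓 (ρ u)` at `ν u`. -/
def vel (u : U) : TangentSpace I (G.ν u) := (G.ρ u).total

/-- The map `𝐓 ∘ ρ : U → TM`. -/
def velocity (u : U) : TangentBundle I M := ⟨G.ν u, G.vel u⟩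

/-- The tangent vector `𝐓 (ρ u)` for `u` in the fibre of `ν` over `m`, as an element of `T_mM`. -/
def velAt {m : M} (u : U) (h : G.ν u = m) : TangentSpace I m := h ▸ G.vel u

/-- The fibre `V_mτ` of the vertical bundle. -/
abbrev Vert (m : M) : Submodule ℝ (TangentSpace I m) := VerticalSpace I G.τ m

/-- The fibre `V*_mτ`. -/
abbrev VertDual (m : M) : Type _ := VerticalDual I G.τ m

/-! #### Controls -/

/-- `g` is a smooth control on `[α, β]`: the restriction of a smooth curve defined on a neighbourhood
of `[α, β]`, which is a section of `τ ∘ ν` with `ρ ∘ g = j¹ (ν ∘ g)`. -/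
def IsSmoothControl (α β : ℝ) (g : ℝ → U) : Prop :=
  (∃ V : Set ℝ, IsOpen V ∧ Icc α β ⊆ V ∧ ContMDiffOn 𝓘(ℝ, ℝ) IU ∞ g V) ∧
  (∀ t ∈ Icc α β, G.τ (G.ν (g t)) = t) ∧
  (∀ t ∈ Icc α β, mfderiv 𝓘(ℝ, ℝ) I (fun r => G.ν (g r)) t (1 : ℝ) = G.vel (g t))

/-- `u` is a control on `[a, b]`: a piecewise section of `τ ∘ ν` induced by finitely many smooth
controls, whose base section `ν ∘ u` is continuous. -/
def IsControl (a b : ℝ) (u : ℝ → U) : Prop :=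
  IsPiecewise G.IsSmoothControl a b u ∧ ContinuousOn (fun t => G.ν (u t)) (Icc a b)

/-! #### The jet bundle of `ν` and admissible curves -/

/-- The fibre over `u` of `ν₁₀ : J¹ν → U`. The jet of a section `σ` of `ν` at `m = ν u` with
`σ m = u` is given by the linear map `T_mσ : T_mM → T_uU`, a right inverse of `T_uν`. -/
def JetFibre (u : U) : Type _ :=
  {A : TangentSpace I (G.ν u) →L[ℝ] TangentSpace IU u //
    (mfderiv IU I G.ν u).comp A = ContinuousLinearMap.id ℝ (TangentSpace I (G.ν u))}

/-- The first jet bundle `J¹ν` of `ν : U → M`. -/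
abbrev Jet : Type _ := Σ u : U, G.JetFibre u

/-- The linear map `T_mσ` of the jet `j¹_mσ`. -/
def Jet.lin {G : GeometricControlStructure I M IU U IQ Q IF F} (j : G.Jet) :
    TangentSpace I (G.ν j.1) →L[ℝ] TangentSpace IU j.1 := j.2.1

/-- A curve in `J¹ν` is smooth on the open set `V`: its projection onto `U` is smooth, and the linear
maps are smooth when they are written in local coordinates of `M` and `U`. -/
def SmoothJetCurveOn (ψ : ℝ → G.Jet) (V : Set ℝ) : Prop :=
  ContMDiffOn 𝓘(ℝ, ℝ) IU ∞ (fun t => (ψ t).1) V ∧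
  ∀ t₀ ∈ V, ContDiffAt ℝ ∞
    (inTangentCoordinates I IU (fun t => G.ν (ψ t).1) (fun t => (ψ t).1)
      (fun t => (ψ t).lin) t₀) t₀

/-- `ψ` is a smooth admissible curve in `J¹ν` on `[α, β]`: with `u` its projection onto `U`,
`u̇ = T_mσ (𝐓 (ρ u))` where `ψ = j¹_mσ`. -/
def IsSmoothAdmissible (α β : ℝ) (ψ : ℝ → G.Jet) : Prop :=
  (∃ V : Set ℝ, IsOpen V ∧ Icc α β ⊆ V ∧ G.SmoothJetCurveOn ψ V) ∧
  ∀ t ∈ Icc α β, mfderiv 𝓘(ℝ, ℝ) IU (fun r => (ψ r).1) t (1 : ℝ) = (ψ t).lin (G.vel (ψ t).1)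

/-- The field of jets `ψ t` at `u t` is a piecewise admissible curve in `J¹ν` on `[a, b]`; by
construction it projects onto `u`. -/
def IsPiecewiseAdmissible (a b : ℝ) (u : ℝ → U) (ψ : ∀ t, G.JetFibre (u t)) : Prop :=
  IsPiecewise G.IsSmoothAdmissible a b (fun t => (⟨u t, ψ t⟩ : G.Jet))

/-! #### The control lift and its transport -/

/-- The `TVτ`-component `𝔰 (T(𝐓 ∘ ρ) (T_mσ v))` of the control lift `hᶜ` at the jet `j¹_mσ` and the
vector `v`, where `𝔰` is the canonical involution. -/
def controlLift (j : G.Jet) (v : TangentSpace I (G.ν j.1)) :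
    TangentBundle I.tangent (TangentBundle I M) :=
  canonicalInvolution I M (tangentMap IU I.tangent G.velocity ⟨j.1, j.lin v⟩)

/-- `w ∈ Vτ` over the time `b` is the `hᶜ`-transport along `ψ` of `v ∈ Vτ` over the time `t₀`: there
is a continuous vertical field `X` along the base section with `X t₀ = v`, `X b = w` and
`Ẋ t = hᶜ (ψ t) (X t)` on `]t₀, b]`. As `ψ` is left continuous, at the break points `Ẋ` is the
derivative from the left. -/
def IsTransport (u : ℝ → U) (ψ : ∀ t, G.JetFibre (u t)) (t₀ b : ℝ)
    (v : G.Vert (G.ν (u t₀))) (w : G.Vert (G.ν (u b))) : Prop :=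
  ∃ X : ∀ t, G.Vert (G.ν (u t)),
    ContinuousOn (fun t => (⟨G.ν (u t), (X t).1⟩ : TangentBundle I M)) (Icc t₀ b) ∧
    X t₀ = v ∧ X b = w ∧
    ∀ t ∈ Ioc t₀ b,
      MDifferentiableWithinAt 𝓘(ℝ, ℝ) I.tangent
        (fun r => (⟨G.ν (u r), (X r).1⟩ : TangentBundle I M)) (Iic t) t ∧
      tangentMapWithin 𝓘(ℝ, ℝ) I.tangent
        (fun r => (⟨G.ν (u r), (X r).1⟩ : TangentBundle I M)) (Iic t) ⟨t, (1 : ℝ)⟩ =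
        G.controlLift ⟨u t, ψ t⟩ (X t).1

/-! #### The vertical variational cone -/

/-- The vector field `Y`, with open domain `W`, belongs to the family `𝒟` of the vector fields
`𝐓 ∘ ρ ∘ σ` with `σ` a (local) smooth section of `ν`. -/
def IsControlField (W : Set M) (Y : ∀ m : M, TangentSpace I m) : Prop :=
  IsOpen W ∧ ∃ σ : M → U, ContMDiffOn I IU ∞ σ W ∧
    ∀ m ∈ W, ∃ h : G.ν (σ m) = m, Y m = G.velAt (σ m) h

/-- The vertical variational cone at the end point of the base section `c` of the control `u` on
`[a, b]`, generated by the transport along `ψ`: all finite sums `∑ δⁱ ψ^b_{tᵢ} (Yᵢ (c tᵢ) - ċ tᵢ)`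
with `δⁱ ≥ 0`, `tᵢ ∈ ]a, b]`, `Yᵢ ∈ 𝒟`. Here `ċ t = 𝐓 (ρ (u t))`. -/
def verticalCone (a b : ℝ) (u : ℝ → U) (ψ : ∀ t, G.JetFibre (u t)) : Set (G.Vert (G.ν (u b))) :=
  finiteConicCombinations
    {w | ∃ t ∈ Ioc a b, ∃ (W : Set M) (Y : ∀ m : M, TangentSpace I m) (v : G.Vert (G.ν (u t))),
      G.IsControlField W Y ∧ G.ν (u t) ∈ W ∧ v.1 = Y (G.ν (u t)) - G.vel (u t) ∧
      G.IsTransport u ψ t b v w}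

end GeometricControlStructure

/-! ### The extended control structure -/

section Extension

variable {EB : Type*} [NormedAddCommGroup EB] [NormedSpace ℝ EB] {HB : Type*} [TopologicalSpace HB]
  {IB : ModelWithCorners ℝ EB HB} {B : Type*} [TopologicalSpace B] [ChartedSpace HB B]
  {EF : Type*} [NormedAddCommGroup EF] [NormedSpace ℝ EF] {HF : Type*} [TopologicalSpace HF]
  {IF : ModelWithCorners ℝ EF HF} {F : Type*} [TopologicalSpace F] [ChartedSpace HF F]
  {EZ : Type*} [NormedAddCommGroup EZ] [NormedSpace ℝ EZ] {HZ : Type*} [TopologicalSpace HZ]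
  {IZ : ModelWithCorners ℝ EZ HZ} {Z : Type*} [TopologicalSpace Z] [ChartedSpace HZ Z]

/-- If `π : Z → B` is a fibre bundle with fibre `F`, then `Z × ℝ → B` is one with fibre `F × ℝ`. -/
theorem IsSmoothFibreBundle.comp_fst {π : Z → B} (h : IsSmoothFibreBundle IB IF F IZ π) :
    IsSmoothFibreBundle IB (IF.prod 𝓘(ℝ, ℝ)) (F × ℝ) (IZ.prod 𝓘(ℝ, ℝ))
      (fun z : Z × ℝ => π z.1) where
  smooth := h.smooth.comp contMDiff_fst
  locally_trivial b := by
    obtain ⟨W, hW, hb, φ, χ, hφ, hχ, h1, h2⟩ := h.locally_trivial b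
    refine ⟨W, hW, hb, fun z => (φ z.1, z.2), fun p => (χ (p.1, p.2.1), p.2.2), ?_, ?_, ?_, ?_⟩
    · exact (hφ.comp contMDiff_fst.contMDiffOn (fun z hz => hz)).prodMk contMDiff_snd.contMDiffOn
    · refine ContMDiffOn.prodMk (hχ.comp (f := fun p : B × F × ℝ => (p.1, p.2.1)) ?_ ?_) ?_
      · exact (contMDiff_fst.prodMk (contMDiff_fst.comp contMDiff_snd)).contMDiffOn
      · exact fun p hp => ⟨hp.1, mem_univ _⟩
      · exact (contMDiff_snd.comp contMDiff_snd).contMDiffOn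
    · rintro x hx ⟨f, r⟩
      exact ⟨(h1 x hx f).1, by simp [(h1 x hx f).2]⟩
    · rintro ⟨z, r⟩ hz
      simp [h2 z hz]

/-- If `π : Z → B` is a fibre bundle with fibre `F`, then so is `π × id : Z × ℝ → B × ℝ`. -/
theorem IsSmoothFibreBundle.prod_id {π : Z → B} (h : IsSmoothFibreBundle IB IF F IZ π) :
    IsSmoothFibreBundle (IB.prod 𝓘(ℝ, ℝ)) IF F (IZ.prod 𝓘(ℝ, ℝ))
      (fun z : Z × ℝ => (π z.1, z.2)) where
  smooth := (h.smooth.comp contMDiff_fst).prodMk contMDiff_snd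
  locally_trivial b := by
    obtain ⟨W, hW, hb, φ, χ, hφ, hχ, h1, h2⟩ := h.locally_trivial b.1
    refine ⟨Prod.fst ⁻¹' W, hW.preimage continuous_fst, hb, fun z => φ z.1,
      fun p => (χ (p.1.1, p.2), p.1.2), ?_, ?_, ?_, ?_⟩
    · exact hφ.comp contMDiff_fst.contMDiffOn (fun z hz => hz)
    · refine ContMDiffOn.prodMk (hχ.comp (f := fun p : (B × ℝ) × F => (p.1.1, p.2)) ?_ ?_) ?_
      · exact ((contMDiff_fst.comp contMDiff_fst).prodMk contMDiff_snd).contMDiffOn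
      · exact fun p hp => ⟨hp.1, mem_univ _⟩
      · exact (contMDiff_snd.comp contMDiff_fst).contMDiffOn
    · rintro ⟨x, r⟩ hx f
      exact ⟨by simp [(h1 x hx f).1], (h1 x hx f).2⟩
    · rintro ⟨z, r⟩ hz
      simp [h2 z hz]

end Extension

namespace GeometricOptimalControlStructure

variable {E : Type*} [NormedAddCommGroup E] [NormedSpace ℝ E] {H : Type*} [TopologicalSpace H]
  {I : ModelWithCorners ℝ E H} {M : Type*} [TopologicalSpace M] [ChartedSpace H M]
  [IsManifold I ∞ M]
  {EU : Type*} [NormedAddCommGroup EU] [NormedSpace ℝ EU] {HU : Type*} [TopologicalSpace HU]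
  {IU : ModelWithCorners ℝ EU HU} {U : Type*} [TopologicalSpace U] [ChartedSpace HU U]
  [IsManifold IU ∞ U]
  {EQ : Type*} [NormedAddCommGroup EQ] [NormedSpace ℝ EQ] {HQ : Type*} [TopologicalSpace HQ]
  {IQ : ModelWithCorners ℝ EQ HQ} {Q : Type*} [TopologicalSpace Q] [ChartedSpace HQ Q]
  {EF : Type*} [NormedAddCommGroup EF] [NormedSpace ℝ EF] {HF : Type*} [TopologicalSpace HF]
  {IF : ModelWithCorners ℝ EF HF} {F : Type*} [TopologicalSpace F] [ChartedSpace HF F]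
  (G : GeometricOptimalControlStructure I M IU U IQ Q IF F)

theorem mfderiv_τ_fst (m : M) (J : ℝ) (v : E × ℝ) :
    (mfderiv (I.prod 𝓘(ℝ, ℝ)) 𝓘(ℝ, ℝ) (fun z : M × ℝ => G.τ z.1) (m, J) v : ℝ) =
      mfderiv I 𝓘(ℝ, ℝ) G.τ m v.1 := by
  have h : MDifferentiableAt I 𝓘(ℝ, ℝ) G.τ m := (G.bundle_τ.smooth m).mdifferentiableAt (by simp)
  have h1 := mfderiv_comp (I := I.prod 𝓘(ℝ, ℝ)) (I' := I) (I'' := 𝓘(ℝ, ℝ)) (f := Prod.fst)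
    (m, J) h mdifferentiableAt_fst
  have h2 := congrArg (fun T => (T v : ℝ)) h1
  rw [mfderiv_fst] at h2
  exact h2

/-- The extended control structure `(τ̄, ν̄, ρ̄)` on `M × ℝ` and `U × ℝ`: `τ̄ (m, J) = τ m`,
`ν̄ (u, J) = (ν u, J)` and `ρ̄ (u, J) = (ρ u, J, L u)`, that is, `𝐓 (ρ̄ (u, J)) = (𝐓 (ρ u), L u)`. -/
def extended : GeometricControlStructure (I.prod 𝓘(ℝ, ℝ)) (M × ℝ) (IU.prod 𝓘(ℝ, ℝ)) (U × ℝ)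
    (IQ.prod 𝓘(ℝ, ℝ)) (Q × ℝ) IF F where
  τ := fun z => G.τ z.1
  ν := fun z => (G.ν z.1, z.2)
  ρ := fun z => ⟨((G.vel z.1, G.L z.1) : E × ℝ), by
    have h : (mfderiv I 𝓘(ℝ, ℝ) G.τ (G.ν z.1) (G.vel z.1) : ℝ) = 1 := (G.ρ z.1).2
    rw [← h]
    exact G.mfderiv_τ_fst (G.ν z.1) z.2 (G.vel z.1, G.L z.1)⟩
  bundle_τ := G.bundle_τ.comp_fst
  bundle_ν := G.bundle_ν.prod_id
  smooth_ρ := by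
    have h1 : ContMDiff (IU.prod 𝓘(ℝ, ℝ)) I.tangent ∞
        (fun z : U × ℝ => (⟨G.ν z.1, G.vel z.1⟩ : TangentBundle I M)) :=
      G.smooth_ρ.comp contMDiff_fst
    have h2 : ContMDiff (IU.prod 𝓘(ℝ, ℝ)) (𝓘(ℝ, ℝ)).tangent ∞
        (fun z : U × ℝ => (⟨z.2, G.L z.1⟩ : TangentBundle 𝓘(ℝ, ℝ) ℝ)) := by
      have h3 : ContMDiff (IU.prod 𝓘(ℝ, ℝ)) (𝓘(ℝ, ℝ).prod 𝓘(ℝ, ℝ)) ∞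
          (fun z : U × ℝ => ((z.2, G.L z.1) : ModelProd ℝ ℝ)) :=
        contMDiff_snd.prodMk (G.smooth_L.comp contMDiff_fst)
      rw [chartedSpaceSelf_prod] at h3
      have h4 := (contMDiff_tangentBundleModelSpaceHomeomorph_symm (I := 𝓘(ℝ, ℝ)) (n := ∞)).comp h3
      rw [tangentBundleModelSpaceHomeomorph_coe_symm] at h4
      exact h4
    exact (contMDiff_equivTangentBundleProd_symm (I := I) (M := M) (I' := 𝓘(ℝ, ℝ))
      (M' := ℝ)).comp (h1.prodMk h2)

/-- The control `t ↦ (u t, J₀ + ∫ₐᵗ L (u s) ds)` of the extended structure. -/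
def extendedControl (u : ℝ → U) (a J₀ : ℝ) (t : ℝ) : U × ℝ := (u t, J₀ + ∫ s in a..t, G.L (u s))

/-- The projection `V_{(m, J)}τ̄ → V_mτ` of the identification `V_{(m, J)}τ̄ = V_mτ × ℝ`. -/
def vertFst (x : M × ℝ) : G.extended.Vert x →L[ℝ] G.Vert x.1 :=
  ((ContinuousLinearMap.fst ℝ E ℝ).comp (G.extended.Vert x).subtypeL).codRestrict (G.Vert x.1)
    (fun v => (G.mfderiv_τ_fst x.1 x.2 v.1).symm.trans v.2)

/-- The projection `V_{(m, J)}τ̄ → ℝ` of the identification `V_{(m, J)}τ̄ = V_mτ × ℝ`. -/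
def vertSnd (x : M × ℝ) : G.extended.Vert x →L[ℝ] ℝ :=
  (ContinuousLinearMap.snd ℝ E ℝ).comp (G.extended.Vert x).subtypeL

/-- The identification `V_{(m, J)}τ̄ = V_mτ × ℝ`. -/
def vertSplit (x : M × ℝ) (v : G.extended.Vert x) : G.Vert x.1 × ℝ := (G.vertFst x v, G.vertSnd x v)

/-- The covector `η̄ = (η, η_J) ∈ V*_{(m, J)}τ̄ = V*_mτ × ℝ`. -/
def extendedCovector (x : M × ℝ) (p : G.VertDual x.1 × ℝ) : G.extended.VertDual x :=
  p.1.comp (G.vertFst x) + p.2 • G.vertSnd x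

/-! ### Multipliers -/

/-- The differential `T_mτ`, as a covector: the pull-back of `dt`. -/
def dτ (m : M) : TangentSpace I m →L[ℝ] ℝ := mfderiv I 𝓘(ℝ, ℝ) G.τ m

theorem dτ_vel (u : U) : G.dτ (G.ν u) (G.vel u) = 1 := (G.ρ u).2

/-- The projection `v ↦ v - ⟨dτ, v⟩ 𝐓 (ρ u)` of `T_mM`, `m = ν u`, onto `V_mτ`. -/
def vertProj (u : U) : TangentSpace I (G.ν u) →L[ℝ] G.Vert (G.ν u) :=
  (ContinuousLinearMap.id ℝ (TangentSpace I (G.ν u)) -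
    (ContinuousLinearMap.toSpanSingleton ℝ (G.vel u)).comp (G.dτ (G.ν u))).codRestrict
      (G.Vert (G.ν u)) (fun v => by
        have h : G.dτ (G.ν u) (v - G.dτ (G.ν u) v • G.vel u) = 0 := by
          rw [map_sub, map_smul, dτ_vel]; simp
        exact h)

/-- The section `H_λ : U ×_M V*τ → U ×_M T*M`: `H_λ (u, η) = (u, α)` where `α` is the covector at
`ν u` that projects onto `η` and satisfies `⟨α, 𝐓 (ρ u)⟩ + λ L u = 0` (see `hamCovector_spec`). -/
def hamCovector (lam : ℝ) (u : U) (η : G.VertDual (G.ν u)) : TangentSpace I (G.ν u) →L[ℝ] ℝ :=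
  η.comp (G.vertProj u) - (lam * G.L u) • G.dτ (G.ν u)

theorem hamCovector_spec (lam : ℝ) (u : U) (η : G.VertDual (G.ν u))
    (α : TangentSpace I (G.ν u) →L[ℝ] ℝ) :
    α = G.hamCovector lam u η ↔ α (G.vel u) + lam * G.L u = 0 ∧ restrictVertical G.τ α = η := by
  have hp : G.vertProj u (G.vel u) = 0 := by
    apply Subtype.ext
    change G.vel u - G.dτ (G.ν u) (G.vel u) • G.vel u = 0
    rw [dτ_vel, one_smul, sub_self]
  have hq : ∀ v : G.Vert (G.ν u), G.vertProj u v.1 = v := fun v => by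
    have h0 : G.dτ (G.ν u) v.1 = 0 := v.2
    apply Subtype.ext
    change v.1 - G.dτ (G.ν u) v.1 • G.vel u = v.1
    rw [h0, zero_smul, sub_zero]
  constructor
  · rintro rfl
    constructor
    · simp [hamCovector, hp, dτ_vel]
    · ext v
      have h0 : G.dτ (G.ν u) v.1 = 0 := v.2
      simp [restrictVertical, hamCovector, hq, h0]
  · rintro ⟨h1, rfl⟩
    ext v
    have h2 : ((G.vertProj u v : G.Vert (G.ν u)) : TangentSpace I (G.ν u)) =
        v - G.dτ (G.ν u) v • G.vel u := rfl
    simp only [restrictVertical, hamCovector, sub_apply,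
      ContinuousLinearMap.comp_apply, smul_apply, Submodule.subtypeL_apply,
      h2, map_sub, map_smul, smul_eq_mul]
    linear_combination (G.dτ (G.ν u) v) * h1

/-- The fibred product `U ×_M V*τ`. -/
abbrev VertDualOverU : Type _ := Σ u : U, G.VertDual (G.ν u)

/-- A curve in `U ×_M V*τ` is smooth on `V`. -/
def SmoothVertDualOverUOn (ζ : ℝ → G.VertDualOverU) (V : Set ℝ) : Prop :=
  ContMDiffOn 𝓘(ℝ, ℝ) IU ∞ (fun t => (ζ t).1) V ∧
  SmoothVerticalDualOn I G.τ (fun t => G.ν (ζ t).1) (fun t => (ζ t).2) V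

/-- The composition of `H_λ` with the projection `U ×_M T*M → T*M`. -/
def hamMap (lam : ℝ) (z : G.VertDualOverU) : CotangentBundle I M :=
  CotangentBundle.mk I (G.ν z.1) (G.hamCovector lam z.1 z.2)

/-- The condition `i_{ζ̇ t} ω_λ = 0`, where `ω_λ` is the pull-back to `U ×_M V*τ`, by `hamMap`, of the
canonical symplectic form of `T*M`: `ω_λ (ζ̇ t, w) = 0` for all tangent vectors `w` of `U ×_M V*τ` at
`ζ t`, where `w = ξ̇ 0` for a smooth curve `ξ` through `ζ t`. -/
def ContractionVanishes (lam : ℝ) (ζ : ℝ → G.VertDualOverU) (t : ℝ) : Prop :=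
  ∀ ξ : ℝ → G.VertDualOverU,
    (∃ V : Set ℝ, IsOpen V ∧ (0 : ℝ) ∈ V ∧ G.SmoothVertDualOverUOn ξ V) → ξ 0 = ζ t →
    canonicalTwoForm I M
      (tangentMap 𝓘(ℝ, ℝ) (I.prod 𝓘(ℝ, E →L[ℝ] ℝ)) (fun r => G.hamMap lam (ζ r)) ⟨t, (1 : ℝ)⟩)
      (tangentMap 𝓘(ℝ, ℝ) (I.prod 𝓘(ℝ, E →L[ℝ] ℝ)) (fun r => G.hamMap lam (ξ r)) ⟨0, (1 : ℝ)⟩) = 0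

/-- `ζ` is, on `[α, β]`, a smooth curve in `U ×_M V*τ` with `i_{ζ̇} ω_λ = 0`. -/
def IsCharacteristicCurve (lam α β : ℝ) (ζ : ℝ → G.VertDualOverU) : Prop :=
  (∃ V : Set ℝ, IsOpen V ∧ Icc α β ⊆ V ∧ G.SmoothVertDualOverUOn ζ V) ∧
  ∀ t ∈ Icc α β, G.ContractionVanishes lam ζ t

/-- The pair `(η, λ)` is a multiplier of the control `u` on `[a, b]`: `η` is a continuous piecewise
section of `V*τ` along `c = ν ∘ u`, `λ` is a real number, and
* `i_{(u̇, η̇)} ω_λ = 0` on the smooth parts of `(u, η)`;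
* for all `t₀ ∈ [a, b]`, with `H_λ (u t₀, η t₀) = (u t₀, α₀)`, the function
  `u' ↦ ⟨α₀, 𝐓 (ρ u')⟩ + λ L u'` on `ν⁻¹ (c t₀)` attains a global maximum at `u' = u t₀`;
* `(η t, λ) ≠ (0, 0)` for all `t ∈ [a, b]`. -/
structure IsMultiplier (a b : ℝ) (u : ℝ → U) (η : ∀ t, G.VertDual (G.ν (u t))) (lam : ℝ) :
    Prop where
  continuous : ContinuousVerticalDualOn I G.τ (fun t => G.ν (u t)) η (Icc a b)
  contraction : IsPiecewise (G.IsCharacteristicCurve lam) a b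
    (fun t => (⟨u t, η t⟩ : G.VertDualOverU))
  maximum : ∀ t₀ ∈ Icc a b, ∀ (u' : U) (h : G.ν u' = G.ν (u t₀)),
    G.hamCovector lam (u t₀) (η t₀) (G.velAt u' h) + lam * G.L u' ≤
      G.hamCovector lam (u t₀) (η t₀) (G.vel (u t₀)) + lam * G.L (u t₀)
  nonzero : ∀ t ∈ Icc a b, (η t, lam) ≠ (0, 0)

/-- The vertical variational cone of the extended control, at its end point. -/
abbrev extendedCone (a b : ℝ) (u : ℝ → U) (J₀ : ℝ)
    (ψ : ∀ t, G.extended.JetFibre (G.extendedControl u a J₀ t)) :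
    Set (G.extended.Vert (G.ν (u b), J₀ + ∫ s in a..b, G.L (u s))) :=
  G.extended.verticalCone a b (G.extendedControl u a J₀) ψ

end GeometricOptimalControlStructure

end

/-! The dual of the cone becomes visible once covectors, rather than vectors, are transported. Along
the base curve of a piecewise admissible curve there is a continuous family of frames `P t` of the
full tangent spaces, parallel on each smooth piece (`IsPiecewiseAdmissible.exists_frame`). Transport
from time t to time b is then `P b` composed with the inverse of `P t`, and a covector α at the end
point, carried back to time t, is γ ∘ (P t)⁻¹ with γ = α ∘ P b constant. Since a local section of
the control bundle passes through every point of a fibre, α is nonpositive on the cone exactly when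
each γ ∘ (P t)⁻¹, evaluated on the velocities of the points of the fibre over c(t), is maximal at
the control itself (`IsFramedPath.max_of_mem_dualCone`).

A priori γ ∘ (P t)⁻¹ depends on the jets. At a maximum the derivative in the fibre directions
vanishes (`velDeriv_eq_zero_of_max`), and linear maps of jets at the same point differ by fibre
directions, so the adjoint equation no longer involves the jet (`coframe_adjoint`). In the extended
structure nothing depends on J, hence the cost component of the covector is a constant λ
(`coframe_cost_eq`), and the component p on TM satisfies ṗ(Tν w) + p(D(𝐓 ∘ ρ) w) + λ dL(w) = 0 in
coordinates, for every w tangent to U (`isAdjointPiece_coframe`). This is the equation i ω_λ = 0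
(`contractionVanishes_iff`), up to replacing p by the covector of H_λ with the same vertical
restriction. The two differ by h dτ with h = ⟨p, 𝐓 ∘ ρ⟩ + λ L; the adjoint equation makes ḣ vanish,
and dτ is parallel because dτ(𝐓 ∘ ρ) = 1, so the replacement is harmless
(`IsAdjointPiece.isCharacteristicCurve`).

Conversely, if (η, λ) is a multiplier, the contraction equation tested on the image under the jet of
a transported vector says that the pairing of (η, λ) with that vector is constant in time
(`IsMultiplier.pairing_eq`). The maximum condition makes the pairing nonpositive on each generator
at its initial time, hence at the end (`IsMultiplier.mem_dualCone`).

The notion of multiplier involves only u, which gives the independence of the dual cone. The closure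
of the cone is recovered from the dual by Hahn–Banach separation
(`mem_closure_finiteConicCombinations_iff`). -/

noncomputable section

/-! ### Coordinates of vectors and covectors in a fixed chart. -/

section ManifoldCalculus

variable {E : Type*} [NormedAddCommGroup E] [NormedSpace ℝ E] {H : Type*} [TopologicalSpace H]
  (I : ModelWithCorners ℝ E H) {M : Type*} [TopologicalSpace M] [ChartedSpace H M]
  {V : Type*} [NormedAddCommGroup V] [NormedSpace ℝ V]

/-- The differential of a vector valued function. -/
def diff (h : M → V) (y : M) : E →L[ℝ] V := mfderiv I 𝓘(ℝ, V) h y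

variable [IsManifold I ∞ M]

/-- The coordinates, in the preferred chart at `m₀`, of tangent vectors at `y`. -/
def chartDiff (m₀ y : M) : E →L[ℝ] E := tangentCoordChange I y m₀ y

/-- The tangent vector at `y` with given coordinates in the preferred chart at `m₀`. -/
def chartDiffInv (m₀ y : M) : E →L[ℝ] E := tangentCoordChange I m₀ y y

variable {I}

theorem chartDiff_chartDiffInv {m₀ y : M} (hy : y ∈ (extChartAt I m₀).source) (v : E) :
    chartDiff I m₀ y (chartDiffInv I m₀ y v) = v := by
  unfold chartDiff chartDiffInv
  rw [tangentCoordChange_comp (I := I) ⟨⟨hy, mem_extChartAt_source y⟩, hy⟩,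
    tangentCoordChange_self hy]

theorem chartDiffInv_chartDiff {m₀ y : M} (hy : y ∈ (extChartAt I m₀).source) (v : E) :
    chartDiffInv I m₀ y (chartDiff I m₀ y v) = v := by
  unfold chartDiff chartDiffInv
  rw [tangentCoordChange_comp (I := I)
    ⟨⟨mem_extChartAt_source y, hy⟩, mem_extChartAt_source y⟩,
    tangentCoordChange_self (mem_extChartAt_source y)]

theorem chartDiff_self (m : M) (v : E) : chartDiff I m m v = v :=
  tangentCoordChange_self (mem_extChartAt_source m)

theorem chartDiffInv_self (m : M) (v : E) : chartDiffInv I m m v = v :=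
  tangentCoordChange_self (mem_extChartAt_source m)

theorem chartDiff_change {m₀ m₁ y : M} (h₀ : y ∈ (extChartAt I m₀).source)
    (h₁ : y ∈ (extChartAt I m₁).source) (v : E) :
    tangentCoordChange I m₀ m₁ y (chartDiff I m₀ y v) = chartDiff I m₁ y v :=
  tangentCoordChange_comp ⟨⟨mem_extChartAt_source y, h₀⟩, h₁⟩

theorem chartDiffInv_change {m₀ m₁ y : M} (h₀ : y ∈ (extChartAt I m₀).source)
    (h₁ : y ∈ (extChartAt I m₁).source) (v : E) :
    chartDiffInv I m₁ y (tangentCoordChange I m₀ m₁ y v) = chartDiffInv I m₀ y v :=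
  tangentCoordChange_comp ⟨⟨h₀, h₁⟩, mem_extChartAt_source y⟩

theorem contMDiffOn_tangentCoordChange (m₀ m₁ : M) :
    ContMDiffOn I 𝓘(ℝ, E →L[ℝ] E) ∞ (tangentCoordChange I m₀ m₁)
      ((extChartAt I m₀).source ∩ (extChartAt I m₁).source) := by
  have : IsManifold I (∞ + 1) M := by simpa
  have h := (tangentBundleCore.isContMDiff (I := I) (M := M) (n := ∞)).contMDiffOn_coordChange
    (achart H m₀) (achart H m₁)
  simpa only [extChartAt_source, tangentBundleCore_baseSet, coe_achart] using h

/-- This identifies the coordinates of a vector with its pairing with the differential of a chart,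
so that facts about ⟨dh, X⟩ for arbitrary smooth h specialise to changes of chart. -/
theorem diff_extChartAt {m₀ y : M} (hy : y ∈ (extChartAt I m₀).source) :
    diff I (extChartAt I m₀) y = chartDiff I m₀ y := by
  rw [extChartAt_source (I := I)] at hy
  have h : MDifferentiableAt I 𝓘(ℝ, E) (extChartAt I m₀) y :=
    (contMDiffAt_extChartAt' (n := ∞) hy).mdifferentiableAt (by simp)
  exact h.mfderiv

theorem extChartAt_tangent_apply (m₀ y : M) (v₀ v : E) :
    extChartAt I.tangent (⟨m₀, v₀⟩ : TangentBundle I M) ⟨y, v⟩ =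
      (extChartAt I m₀ y, chartDiff I m₀ y v) := by
  rw [ModelWithCorners.tangent, FiberBundle.extChartAt]
  rfl

/-- Covectors transform by the inverse of the coordinate change. The formula is needed only over the
domain of the chart, where `chartDiffInv` really inverts `chartDiff`; for this reason the criteria
for curves in `T*M` below pass through statements that hold only near the point. -/
theorem cotangent_inCoordinates {m₀ y : M} (hy : y ∈ (extChartAt I m₀).source) (p : E →L[ℝ] ℝ) :
    trivializationAt (E →L[ℝ] ℝ) (fun x : M => TangentSpace I x →L[ℝ] Bundle.Trivial M ℝ x) m₀
      (CotangentBundle.mk I y p) = (y, p.comp (chartDiffInv I m₀ y)) := by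
  rw [extChartAt_source] at hy
  rw [hom_trivializationAt_apply]
  refine Prod.ext rfl ?_
  simp only [CotangentBundle.mk, ContinuousLinearMap.inCoordinates]
  rw [TangentBundle.symmL_trivializationAt_eq_core hy]
  ext v
  exact DFunLike.congr_fun (Bundle.Trivial.continuousLinearMapAt_trivialization ℝ M ℝ y)
    (p (chartDiffInv I m₀ y v))

theorem extChartAt_cotangent_apply {m₀ y : M} (hy : y ∈ (extChartAt I m₀).source)
    (p₀ p : E →L[ℝ] ℝ) :
    extChartAt (I.prod 𝓘(ℝ, E →L[ℝ] ℝ)) (CotangentBundle.mk I m₀ p₀) (CotangentBundle.mk I y p) =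
      (extChartAt I m₀ y, p.comp (chartDiffInv I m₀ y)) := by
  rw [FiberBundle.extChartAt]
  change (extChartAt I m₀ y, (trivializationAt (E →L[ℝ] ℝ) _ m₀ (CotangentBundle.mk I y p)).2) = _
  rw [cotangent_inCoordinates hy]

variable {EN : Type*} [NormedAddCommGroup EN] [NormedSpace ℝ EN] {HN : Type*} [TopologicalSpace HN]
  {J : ModelWithCorners ℝ EN HN} {N : Type*} [TopologicalSpace N] [ChartedSpace HN N]

theorem contMDiffAt_tangent_iff {c : N → M} {X : N → E} {x : N} :
    ContMDiffAt J I.tangent ∞ (fun z => (⟨c z, X z⟩ : TangentBundle I M)) x ↔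
      ContMDiffAt J I ∞ c x ∧ ContMDiffAt J 𝓘(ℝ, E) ∞ (fun z => chartDiff I (c x) (c z) (X z)) x :=
  Bundle.contMDiffAt_totalSpace

omit [IsManifold I ∞ M] in
theorem eventually_mem_source {c : N → M} {x : N} {s : Set N} {m₀ : M}
    (hc : ContinuousWithinAt c s x) (hx : c x ∈ (extChartAt I m₀).source) :
    ∀ᶠ z in 𝓝[s] x, c z ∈ (extChartAt I m₀).source :=
  hc.eventually ((isOpen_extChartAt_source m₀).mem_nhds hx)

theorem contMDiffAt_cotangent_iff {c : N → M} {p : N → E →L[ℝ] ℝ} {x : N} :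
    ContMDiffAt J (I.prod 𝓘(ℝ, E →L[ℝ] ℝ)) ∞ (fun z => CotangentBundle.mk I (c z) (p z)) x ↔
      ContMDiffAt J I ∞ c x ∧
        ContMDiffAt J 𝓘(ℝ, E →L[ℝ] ℝ) ∞ (fun z => (p z).comp (chartDiffInv I (c x) (c z))) x := by
  rw [Bundle.contMDiffAt_totalSpace]
  refine and_congr_right fun hc => Filter.EventuallyEq.contMDiffAt_iff ?_
  have h := eventually_mem_source (I := I) (m₀ := c x) hc.continuousAt.continuousWithinAt
    (mem_extChartAt_source (c x)) (s := univ)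
  rw [nhdsWithin_univ] at h
  filter_upwards [h] with z hz
  rw [cotangent_inCoordinates hz]

theorem continuousWithinAt_tangent_iff {c : N → M} {X : N → E} {x : N} {s : Set N} :
    ContinuousWithinAt (fun z => (⟨c z, X z⟩ : TangentBundle I M)) s x ↔
      ContinuousWithinAt c s x ∧
        ContinuousWithinAt (fun z => chartDiff I (c x) (c z) (X z)) s x :=
  FiberBundle.continuousWithinAt_totalSpace E _

theorem continuousWithinAt_cotangent_iff {c : N → M} {p : N → E →L[ℝ] ℝ} {x : N} {s : Set N} :
    ContinuousWithinAt (fun z => CotangentBundle.mk I (c z) (p z)) s x ↔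
      ContinuousWithinAt c s x ∧
        ContinuousWithinAt (fun z => (p z).comp (chartDiffInv I (c x) (c z))) s x := by
  rw [FiberBundle.continuousWithinAt_totalSpace]
  refine and_congr_right fun hc => ?_
  have h := eventually_mem_source (I := I) (m₀ := c x) hc (mem_extChartAt_source (c x))
  refine Filter.EventuallyEq.congr_continuousWithinAt ?_ ?_
  · filter_upwards [h] with z hz
    rw [cotangent_inCoordinates hz]
  · rw [cotangent_inCoordinates (mem_extChartAt_source (c x))]

/-- The pairing of continuous curves in `T*M` and `TM` over the same curve is continuous. -/
theorem continuousWithinAt_pairing {c : N → M} {p : N → E →L[ℝ] ℝ} {X : N → E} {x : N} {s : Set N}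
    (hp : ContinuousWithinAt (fun z => CotangentBundle.mk I (c z) (p z)) s x)
    (hX : ContinuousWithinAt (fun z => (⟨c z, X z⟩ : TangentBundle I M)) s x) :
    ContinuousWithinAt (fun z => p z (X z)) s x := by
  rw [continuousWithinAt_cotangent_iff] at hp
  rw [continuousWithinAt_tangent_iff] at hX
  have h := eventually_mem_source (I := I) (m₀ := c x) hp.1 (mem_extChartAt_source (c x))
  refine (hp.2.clm_apply hX.2).congr_of_eventuallyEq ?_ ?_
  · filter_upwards [h] with z hz
    simp [chartDiffInv_chartDiff hz]
  · simp [chartDiffInv_chartDiff (mem_extChartAt_source (I := I) (c x))]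

theorem contMDiffAt_pairing {c : N → M} {p : N → E →L[ℝ] ℝ} {X : N → E} {x : N}
    (hp : ContMDiffAt J (I.prod 𝓘(ℝ, E →L[ℝ] ℝ)) ∞ (fun z => CotangentBundle.mk I (c z) (p z)) x)
    (hX : ContMDiffAt J I.tangent ∞ (fun z => (⟨c z, X z⟩ : TangentBundle I M)) x) :
    ContMDiffAt J 𝓘(ℝ, ℝ) ∞ (fun z => p z (X z)) x := by
  rw [contMDiffAt_cotangent_iff] at hp
  rw [contMDiffAt_tangent_iff] at hX
  have h := eventually_mem_source (I := I) (m₀ := c x) hp.1.continuousAt.continuousWithinAt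
    (mem_extChartAt_source (c x)) (s := univ)
  rw [nhdsWithin_univ] at h
  refine (hp.2.clm_apply hX.2).congr_of_eventuallyEq ?_
  filter_upwards [h] with z hz
  simp [chartDiffInv_chartDiff hz]

section Boundaryless

variable [I.Boundaryless]

theorem contDiffAt_comp_extChartAt_symm {h : M → V} {m₀ m : M} (hm : m ∈ (extChartAt I m₀).source)
    (hh : ContMDiffAt I 𝓘(ℝ, V) ∞ h m) :
    ContDiffAt ℝ ∞ (h ∘ (extChartAt I m₀).symm) (extChartAt I m₀ m) := by
  rw [← contMDiffAt_iff_contDiffAt]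
  have h1 : ContMDiffAt 𝓘(ℝ, E) I ∞ (extChartAt I m₀).symm (extChartAt I m₀ m) :=
    (contMDiffOn_extChartAt_symm m₀).contMDiffAt
      ((isOpen_extChartAt_target m₀).mem_nhds ((extChartAt I m₀).map_source hm))
  refine ContMDiffAt.comp _ ?_ h1
  rwa [(extChartAt I m₀).left_inv hm]

theorem diff_eq_fderiv_comp {h : M → V} {m₀ m : M} (hm : m ∈ (extChartAt I m₀).source)
    (hh : ContMDiffAt I 𝓘(ℝ, V) ∞ h m) :
    diff I h m = (fderiv ℝ (h ∘ (extChartAt I m₀).symm) (extChartAt I m₀ m)).comp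
      (chartDiff I m₀ m) := by
  have h1 := contDiffAt_comp_extChartAt_symm hm hh
  have h2 : MDifferentiableAt I 𝓘(ℝ, E) (extChartAt I m₀) m :=
    (contMDiffAt_extChartAt' (n := ∞) (by rwa [extChartAt_source] at hm)).mdifferentiableAt
      (by simp)
  have h3 : h =ᶠ[𝓝 m] (h ∘ (extChartAt I m₀).symm) ∘ extChartAt I m₀ := by
    filter_upwards [(isOpen_extChartAt_source m₀).mem_nhds hm] with y hy
    rw [Function.comp_apply, Function.comp_apply, (extChartAt I m₀).left_inv hy]
  have h4 := mfderiv_comp (I' := 𝓘(ℝ, E)) (I'' := 𝓘(ℝ, V)) m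
    (h1.differentiableAt (by simp)).mdifferentiableAt h2
  unfold diff
  rw [h3.mfderiv_eq, h4, mfderiv_eq_fderiv]
  congr 1
  exact diff_extChartAt hm

/-- The identity is required on a neighbourhood, not only at the point, because it will be
differentiated once more along curves. -/
theorem eventually_diff_eq_fderiv_comp {h : M → V} {m₀ m : M}
    (hm : m ∈ (extChartAt I m₀).source) {W : Set M} (hW : W ∈ 𝓝 m)
    (hh : ContMDiffOn I 𝓘(ℝ, V) ∞ h W) :
    ∀ᶠ y in 𝓝 m, diff I h y = (fderiv ℝ (h ∘ (extChartAt I m₀).symm) (extChartAt I m₀ y)).comp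
      (chartDiff I m₀ y) := by
  filter_upwards [(isOpen_extChartAt_source m₀).mem_nhds hm, eventually_mem_nhds_iff.2 hW]
    with y hy hy'
  exact diff_eq_fderiv_comp hy (hh.contMDiffAt hy')

end Boundaryless
end ManifoldCalculus

/-! ### Velocities of curves in M, TM and T*M in coordinates. -/

section Curves

variable {E : Type*} [NormedAddCommGroup E] [NormedSpace ℝ E] {H : Type*} [TopologicalSpace H]
  {I : ModelWithCorners ℝ E H} {M : Type*} [TopologicalSpace M] [ChartedSpace H M]
  {V : Type*} [NormedAddCommGroup V] [NormedSpace ℝ V]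

/-- The velocity of a curve in a manifold, in the preferred chart at its base point. -/
theorem mfderivWithin_curve_iff {Γ : ℝ → M} {s : Set ℝ} {t : ℝ} (hs : UniqueDiffWithinAt ℝ s t)
    (v : E) :
    (MDifferentiableWithinAt 𝓘(ℝ, ℝ) I Γ s t ∧
      (mfderivWithin 𝓘(ℝ, ℝ) I Γ s t (1 : ℝ) : E) = v) ↔
    ContinuousWithinAt Γ s t ∧ HasDerivWithinAt (fun r => extChartAt I (Γ t) (Γ r)) v s t := by
  have key : MDifferentiableWithinAt 𝓘(ℝ, ℝ) I Γ s t ↔ ContinuousWithinAt Γ s t ∧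
      DifferentiableWithinAt ℝ (fun r => extChartAt I (Γ t) (Γ r)) s t := by
    rw [mdifferentiableWithinAt_iff]
    simp only [mfld_simps]
    rfl
  have key2 : MDifferentiableWithinAt 𝓘(ℝ, ℝ) I Γ s t →
      (mfderivWithin 𝓘(ℝ, ℝ) I Γ s t (1 : ℝ) : E) =
        derivWithin (fun r => extChartAt I (Γ t) (Γ r)) s t := by
    intro h
    rw [h.mfderivWithin]
    simp only [mfld_simps]
    rfl
  constructor
  · rintro ⟨h1, h2⟩
    refine ⟨h1.continuousWithinAt, ?_⟩
    rw [← h2, key2 h1]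
    exact (key.1 h1).2.hasDerivWithinAt
  · rintro ⟨h1, h2⟩
    have h3 := key.2 ⟨h1, h2.differentiableWithinAt⟩
    exact ⟨h3, by rw [key2 h3, h2.derivWithin hs]⟩

theorem mfderiv_curve_iff {Γ : ℝ → M} {t : ℝ} (v : E) :
    (MDifferentiableAt 𝓘(ℝ, ℝ) I Γ t ∧ (mfderiv 𝓘(ℝ, ℝ) I Γ t (1 : ℝ) : E) = v) ↔
    ContinuousAt Γ t ∧ HasDerivAt (fun r => extChartAt I (Γ t) (Γ r)) v t := by
  have h := mfderivWithin_curve_iff (I := I) (Γ := Γ) (t := t) uniqueDiffWithinAt_univ v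
  rwa [mdifferentiableWithinAt_univ, mfderivWithin_univ, continuousWithinAt_univ,
    hasDerivWithinAt_univ] at h

/-- The derivative of a vector valued function along a curve. -/
theorem hasDerivAt_comp_curve {k : M → V} {γ : ℝ → M} {t : ℝ}
    (hk : MDifferentiableAt I 𝓘(ℝ, V) k (γ t)) (hγ : MDifferentiableAt 𝓘(ℝ, ℝ) I γ t) :
    HasDerivAt (fun r => k (γ r)) (diff I k (γ t) (mfderiv 𝓘(ℝ, ℝ) I γ t (1 : ℝ))) t := by
  have h : HasFDerivAt (fun r => k (γ r))
      ((diff I k (γ t)).comp (mfderiv 𝓘(ℝ, ℝ) I γ t : ℝ →L[ℝ] E)) t :=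
    hasMFDerivAt_iff_hasFDerivAt.1 (hk.hasMFDerivAt.comp t hγ.hasMFDerivAt)
  exact h.hasDerivAt

variable [IsManifold I ∞ M]

/-- A straight line in the chart does it; the chart has open target, so the line stays inside for
small times. This turns statements about differentials of maps into statements about ordinary
derivatives along curves. -/
theorem exists_curve_with_velocity [I.Boundaryless] (x : M) (w : E) :
    ∃ γ : ℝ → M, γ 0 = x ∧ (∃ W : Set ℝ, IsOpen W ∧ (0 : ℝ) ∈ W ∧ ContMDiffOn 𝓘(ℝ, ℝ) I ∞ γ W) ∧
      (mfderiv 𝓘(ℝ, ℝ) I γ 0 (1 : ℝ) : E) = w := by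
  let l : ℝ → E := fun r => extChartAt I x x + r • w
  have hl : ContDiff ℝ ∞ l := by fun_prop
  let W : Set ℝ := l ⁻¹' (extChartAt I x).target
  have hW : IsOpen W := (isOpen_extChartAt_target x).preimage hl.continuous
  have h0 : (0 : ℝ) ∈ W := by
    change l 0 ∈ (extChartAt I x).target
    simp only [l, zero_smul, add_zero]
    exact mem_extChartAt_target x
  have hγ0 : (extChartAt I x).symm (l 0) = x := by simp [l]
  have hsm : ContMDiffOn 𝓘(ℝ, ℝ) I ∞ (fun r => (extChartAt I x).symm (l r)) W :=
    (contMDiffOn_extChartAt_symm x).comp hl.contMDiff.contMDiffOn (fun r hr => hr)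
  refine ⟨fun r => (extChartAt I x).symm (l r), hγ0, ⟨W, hW, h0, hsm⟩, ?_⟩
  refine ((mfderiv_curve_iff w).2 ⟨(hsm.contMDiffAt (hW.mem_nhds h0)).continuousAt, ?_⟩).2
  have hd : HasDerivAt l w 0 := by
    have h : HasDerivAt (fun r : ℝ => r • w) w 0 := by
      simpa using (hasDerivAt_id (0 : ℝ)).smul_const w
    exact h.const_add (extChartAt I x x)
  refine hd.congr_of_eventuallyEq ?_
  filter_upwards [hW.mem_nhds h0] with r hr
  rw [hγ0]
  exact (extChartAt I x).right_inv hr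

theorem mfderivWithin_tangent_iff {c : ℝ → M} {X : ℝ → E} {s : Set ℝ} {t : ℝ}
    (hs : UniqueDiffWithinAt ℝ s t) (v ξ : E) :
    (MDifferentiableWithinAt 𝓘(ℝ, ℝ) I.tangent (fun r => (⟨c r, X r⟩ : TangentBundle I M)) s t ∧
      (mfderivWithin 𝓘(ℝ, ℝ) I.tangent (fun r => (⟨c r, X r⟩ : TangentBundle I M)) s t (1 : ℝ) :
        E × E) = (v, ξ)) ↔
    ContinuousWithinAt c s t ∧ HasDerivWithinAt (fun r => extChartAt I (c t) (c r)) v s t ∧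
      HasDerivWithinAt (fun r => chartDiff I (c t) (c r) (X r)) ξ s t := by
  rw [mfderivWithin_curve_iff (I := I.tangent) hs, continuousWithinAt_tangent_iff]
  simp only [extChartAt_tangent_apply]
  constructor
  · rintro ⟨h1, h2⟩
    refine ⟨h1.1, ?_, ?_⟩
    · exact h2.hasFDerivWithinAt.fst.hasDerivWithinAt.congr_deriv (by simp)
    · exact h2.hasFDerivWithinAt.snd.hasDerivWithinAt.congr_deriv (by simp)
  · rintro ⟨h1, h2, h3⟩
    exact ⟨⟨h1, h3.continuousWithinAt⟩, h2.prodMk h3⟩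

theorem mfderiv_tangent_iff {c : ℝ → M} {X : ℝ → E} {t : ℝ} (v ξ : E) :
    (MDifferentiableAt 𝓘(ℝ, ℝ) I.tangent (fun r => (⟨c r, X r⟩ : TangentBundle I M)) t ∧
      (mfderiv 𝓘(ℝ, ℝ) I.tangent (fun r => (⟨c r, X r⟩ : TangentBundle I M)) t (1 : ℝ) :
        E × E) = (v, ξ)) ↔
    ContinuousAt c t ∧ HasDerivAt (fun r => extChartAt I (c t) (c r)) v t ∧
      HasDerivAt (fun r => chartDiff I (c t) (c r) (X r)) ξ t := by
  have h := mfderivWithin_tangent_iff (I := I) (c := c) (X := X) (t := t)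
    uniqueDiffWithinAt_univ v ξ
  rwa [mdifferentiableWithinAt_univ, mfderivWithin_univ, continuousWithinAt_univ,
    hasDerivWithinAt_univ, hasDerivWithinAt_univ] at h

theorem mfderiv_cotangent_iff {c : ℝ → M} {p : ℝ → E →L[ℝ] ℝ} {t : ℝ} (v : E) (β : E →L[ℝ] ℝ) :
    (MDifferentiableAt 𝓘(ℝ, ℝ) (I.prod 𝓘(ℝ, E →L[ℝ] ℝ))
        (fun r => CotangentBundle.mk I (c r) (p r)) t ∧
      (mfderiv 𝓘(ℝ, ℝ) (I.prod 𝓘(ℝ, E →L[ℝ] ℝ)) (fun r => CotangentBundle.mk I (c r) (p r)) t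
        (1 : ℝ) : E × (E →L[ℝ] ℝ)) = (v, β)) ↔
    ContinuousAt c t ∧ HasDerivAt (fun r => extChartAt I (c t) (c r)) v t ∧
      HasDerivAt (fun r => (p r).comp (chartDiffInv I (c t) (c r))) β t := by
  rw [mfderiv_curve_iff, ← continuousWithinAt_univ, continuousWithinAt_cotangent_iff,
    continuousWithinAt_univ, continuousWithinAt_univ]
  have hev : ContinuousAt c t → (fun r => extChartAt (I.prod 𝓘(ℝ, E →L[ℝ] ℝ))
      (CotangentBundle.mk I (c t) (p t)) (CotangentBundle.mk I (c r) (p r))) =ᶠ[𝓝 t]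
      fun r => (extChartAt I (c t) (c r), (p r).comp (chartDiffInv I (c t) (c r))) := by
    intro hc
    filter_upwards [hc.eventually ((isOpen_extChartAt_source (I := I) (c t)).mem_nhds
      (mem_extChartAt_source (c t)))] with r hr
    exact extChartAt_cotangent_apply hr _ _
  constructor
  · rintro ⟨h1, h2⟩
    have h3 := h2.congr_of_eventuallyEq (hev h1.1).symm
    exact ⟨h1.1, h3.hasFDerivAt.fst.hasDerivAt.congr_deriv (by simp),
      h3.hasFDerivAt.snd.hasDerivAt.congr_deriv (by simp)⟩
  · rintro ⟨h1, h2, h3⟩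
    exact ⟨⟨h1, h3.continuousAt⟩, (h2.prodMk h3).congr_of_eventuallyEq (hev h1)⟩

/-- The derivative along a curve `c` of `⟨dh, X⟩`, in terms of the derivatives of the coordinates of
`c` and of the vector field `X` along `c`. -/
theorem hasDerivWithinAt_diff [I.Boundaryless] {h : M → V} {m₀ : M} {c : ℝ → M} {X : ℝ → E}
    {s : Set ℝ} {t : ℝ} {W : Set M} (hW : W ∈ 𝓝 (c t)) (hh : ContMDiffOn I 𝓘(ℝ, V) ∞ h W)
    (hm : c t ∈ (extChartAt I m₀).source) (hc : ContinuousWithinAt c s t) {v ξ : E}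
    (hv : HasDerivWithinAt (fun r => extChartAt I m₀ (c r)) v s t)
    (hξ : HasDerivWithinAt (fun r => chartDiff I m₀ (c r) (X r)) ξ s t) :
    HasDerivWithinAt (fun r => diff I h (c r) (X r))
      (fderiv ℝ (fderiv ℝ (h ∘ (extChartAt I m₀).symm)) (extChartAt I m₀ (c t)) v
          (chartDiff I m₀ (c t) (X t)) +
        fderiv ℝ (h ∘ (extChartAt I m₀).symm) (extChartAt I m₀ (c t)) ξ) s t := by
  have h1 := contDiffAt_comp_extChartAt_symm hm (hh.contMDiffAt hW)
  have h4 := eventually_diff_eq_fderiv_comp hm hW hh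
  generalize h ∘ (extChartAt I m₀).symm = g at h1 h4 ⊢
  have h2 : HasFDerivAt (fderiv ℝ g) (fderiv ℝ (fderiv ℝ g) (extChartAt I m₀ (c t)))
      (extChartAt I m₀ (c t)) :=
    ((h1.fderiv_right (m := 1) (by rw [one_add_one_eq_two]; exact ENat.LEInfty.out)).differentiableAt
      (by simp)).hasFDerivAt
  have h3 : HasDerivWithinAt (fun r => fderiv ℝ g (extChartAt I m₀ (c r)))
      (fderiv ℝ (fderiv ℝ g) (extChartAt I m₀ (c t)) v) s t := h2.comp_hasDerivWithinAt t hv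
  refine (h3.clm_apply hξ).congr_of_eventuallyEq ?_ ?_
  · filter_upwards [hc.eventually h4] with r hr
    rw [hr, ContinuousLinearMap.comp_apply]
  · rw [h4.self_of_nhds, ContinuousLinearMap.comp_apply]

end Curves

/-! ### The variational equation and its independence of the chart. -/

section Variational

variable {E : Type*} [NormedAddCommGroup E] [NormedSpace ℝ E] {H : Type*} [TopologicalSpace H]
  {I : ModelWithCorners ℝ E H} [I.Boundaryless] {M : Type*} [TopologicalSpace M]
  [ChartedSpace H M] [IsManifold I ∞ M]
  {V : Type*} [NormedAddCommGroup V] [NormedSpace ℝ V]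
  {EN : Type*} [NormedAddCommGroup EN] [NormedSpace ℝ EN] {HN : Type*} [TopologicalSpace HN]
  {J : ModelWithCorners ℝ EN HN} [J.Boundaryless] {N : Type*} [TopologicalSpace N]
  [ChartedSpace HN N] [IsManifold J ∞ N]

omit [J.Boundaryless] [IsManifold J ∞ N] in
/-- Smoothness of `⟨dh, X⟩` for a smooth vector field `X` along a map into `M`. -/
theorem contMDiffAt_diff {h : M → V} {c : N → M} {X : N → E} {x : N} {W : Set M}
    (hW : W ∈ 𝓝 (c x)) (hh : ContMDiffOn I 𝓘(ℝ, V) ∞ h W)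
    (hX : ContMDiffAt J I.tangent ∞ (fun z => (⟨c z, X z⟩ : TangentBundle I M)) x) :
    ContMDiffAt J 𝓘(ℝ, V) ∞ (fun z => diff I h (c z) (X z)) x := by
  rw [contMDiffAt_tangent_iff] at hX
  have hm := mem_extChartAt_source (I := I) (c x)
  have h1 := contDiffAt_comp_extChartAt_symm hm (hh.contMDiffAt hW)
  have h2 : ContDiffAt ℝ ∞ (fderiv ℝ (h ∘ (extChartAt I (c x)).symm)) (extChartAt I (c x) (c x)) :=
    h1.fderiv_right (m := ∞) (by simp)
  have h3 : ContMDiffAt J 𝓘(ℝ, E) ∞ (fun z => extChartAt I (c x) (c z)) x :=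
    (contMDiffAt_extChartAt (I := I)).comp x hX.1
  refine ((h2.contMDiffAt.comp x h3).clm_apply hX.2).congr_of_eventuallyEq ?_
  filter_upwards [hX.1.continuousAt.eventually (eventually_diff_eq_fderiv_comp hm hW hh)] with r hr
  rw [hr]; rfl

omit [J.Boundaryless] [IsManifold J ∞ N] in
theorem contMDiffAt_chartDiff {m₀ : M} {c : N → M} {X : N → E} {x : N}
    (hm : c x ∈ (extChartAt I m₀).source)
    (hX : ContMDiffAt J I.tangent ∞ (fun z => (⟨c z, X z⟩ : TangentBundle I M)) x) :
    ContMDiffAt J 𝓘(ℝ, E) ∞ (fun z => chartDiff I m₀ (c z) (X z)) x := by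
  have h := contMDiffAt_diff ((isOpen_extChartAt_source m₀).mem_nhds hm)
    (by simpa only [extChartAt_source] using contMDiffOn_extChartAt (I := I) (x := m₀)) hX
  have hc : ContinuousAt c x := ((contMDiffAt_tangent_iff.1 hX).1).continuousAt
  refine h.congr_of_eventuallyEq ?_
  filter_upwards [hc.eventually ((isOpen_extChartAt_source m₀).mem_nhds hm)] with z hz
  rw [diff_extChartAt hz]

/-- Let `f` be a smooth vector field along `ν : N → M`, and let `c` be a curve in `M` with velocity
`f x` at `c t = ν x`. If, in one chart, the derivative of the vector field `X` along `c` is the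
derivative of `f` in the direction of `w`, where `T ν w = X t`, then `⟨dh, X⟩` has the derivative
of `⟨dh, f⟩` in the direction of `w`, for each smooth function `h` on `M`. -/
theorem hasDerivWithinAt_diff_of_chart {h : M → V} {m₀ : M} {c : ℝ → M} {X : ℝ → E}
    {s : Set ℝ} {t : ℝ} {ν : N → M} {f : N → E} {x : N} {w : EN} {W : Set M} (hx : ν x = c t)
    (hf : ContMDiffAt J I.tangent ∞ (fun z => (⟨ν z, f z⟩ : TangentBundle I M)) x)
    (hw : (mfderiv J I ν x w : E) = X t)
    (hW : W ∈ 𝓝 (c t)) (hh : ContMDiffOn I 𝓘(ℝ, V) ∞ h W)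
    (hm : c t ∈ (extChartAt I m₀).source) (hc : ContinuousWithinAt c s t)
    (hv : HasDerivWithinAt (fun r => extChartAt I m₀ (c r)) (chartDiff I m₀ (c t) (f x)) s t)
    (hξ : HasDerivWithinAt (fun r => chartDiff I m₀ (c r) (X r))
      (diff J (fun z => chartDiff I m₀ (ν z) (f z)) x w) s t) :
    HasDerivWithinAt (fun r => diff I h (c r) (X r))
      (diff J (fun z => diff I h (ν z) (f z)) x w) s t := by
  -- With w realised as a velocity, `hasDerivWithinAt_diff` applies twice: to the field f along ν ∘
  -- γ, whose base velocity is X, and to X along c, whose base velocity is f.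
  obtain ⟨γ, rfl, ⟨Z, hZ, h0, hγ⟩, rfl⟩ := exists_curve_with_velocity (I := J) x w
  have hγ0 : MDifferentiableAt 𝓘(ℝ, ℝ) J γ 0 :=
    (hγ.contMDiffAt (hZ.mem_nhds h0)).mdifferentiableAt (by simp)
  have hν : MDifferentiableAt J I ν (γ 0) :=
    (contMDiffAt_tangent_iff.1 hf).1.mdifferentiableAt (by simp)
  have hφ : MDifferentiableAt I 𝓘(ℝ, E) (extChartAt I m₀) (c t) :=
    (contMDiffAt_extChartAt' (n := ∞) (by rwa [extChartAt_source] at hm)).mdifferentiableAt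
      (by simp)
  have hm' : ν (γ 0) ∈ (extChartAt I m₀).source := by rwa [hx]
  have d1 : HasDerivAt (fun r => chartDiff I m₀ (ν (γ r)) (f (γ r)))
      (diff J (fun z => chartDiff I m₀ (ν z) (f z)) (γ 0) (mfderiv 𝓘(ℝ, ℝ) J γ 0 (1 : ℝ))) 0 :=
    hasDerivAt_comp_curve (k := fun z => chartDiff I m₀ (ν z) (f z))
      ((contMDiffAt_chartDiff hm' hf).mdifferentiableAt (by simp)) hγ0
  have hνγ : MDifferentiableAt 𝓘(ℝ, ℝ) I (fun r => ν (γ r)) 0 := hν.comp 0 hγ0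
  have d2 : HasDerivAt (fun r => extChartAt I m₀ (ν (γ r))) (chartDiff I m₀ (c t) (X t)) 0 := by
    have := hasDerivAt_comp_curve (γ := fun r => ν (γ r)) (t := 0) (k := extChartAt I m₀)
      (by rwa [hx]) hνγ
    rw [diff_extChartAt hm'] at this
    have e : (mfderiv 𝓘(ℝ, ℝ) I (fun r => ν (γ r)) 0 (1 : ℝ) : E) = X t := by
      rw [← hw]
      exact congrArg (fun A => A (1 : ℝ)) (mfderiv_comp (I' := J) (0 : ℝ) hν hγ0)
    rw [e, hx] at this
    exact this
  have d3 := hasDerivWithinAt_diff (s := univ) (c := fun r => ν (γ r)) (X := fun r => f (γ r))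
    (by rwa [hx]) hh hm' hνγ.continuousAt.continuousWithinAt d2.hasDerivWithinAt
    d1.hasDerivWithinAt
  rw [hasDerivWithinAt_univ] at d3
  have d4 : HasDerivAt (fun r => diff I h (ν (γ r)) (f (γ r)))
      (diff J (fun z => diff I h (ν z) (f z)) (γ 0) (mfderiv 𝓘(ℝ, ℝ) J γ 0 (1 : ℝ))) 0 :=
    hasDerivAt_comp_curve (k := fun z => diff I h (ν z) (f z))
      ((contMDiffAt_diff (by rwa [hx]) hh hf).mdifferentiableAt (by simp)) hγ0
  rw [d4.unique d3]
  have d5 := hasDerivWithinAt_diff hW hh hm hc hv hξ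
  -- The two derivatives contain the second derivative of h evaluated on X and f in opposite orders.
  -- Its symmetry is what the canonical involution of TTM expresses.
  have hsym : IsSymmSndFDerivAt ℝ (h ∘ (extChartAt I m₀).symm) (extChartAt I m₀ (c t)) :=
    (contDiffAt_comp_extChartAt_symm hm (hh.contMDiffAt hW)).isSymmSndFDerivAt
      (by rw [minSmoothness_of_isRCLikeNormedField]; exact ENat.LEInfty.out)
  rw [hsym] at d5
  rw [hx]
  exact d5

/-- Change of chart in the variational equation. -/
theorem hasDerivWithinAt_chartDiff_change {m₀ m₁ : M} {c : ℝ → M} {X : ℝ → E}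
    {s : Set ℝ} {t : ℝ} {ν : N → M} {f : N → E} {x : N} {w : EN} (hx : ν x = c t)
    (hf : ContMDiffAt J I.tangent ∞ (fun z => (⟨ν z, f z⟩ : TangentBundle I M)) x)
    (hw : (mfderiv J I ν x w : E) = X t)
    (hm : c t ∈ (extChartAt I m₀).source) (hm₁ : c t ∈ (extChartAt I m₁).source)
    (hc : ContinuousWithinAt c s t)
    (hv : HasDerivWithinAt (fun r => extChartAt I m₀ (c r)) (chartDiff I m₀ (c t) (f x)) s t)
    (hξ : HasDerivWithinAt (fun r => chartDiff I m₀ (c r) (X r))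
      (diff J (fun z => chartDiff I m₀ (ν z) (f z)) x w) s t) :
    HasDerivWithinAt (fun r => chartDiff I m₁ (c r) (X r))
      (diff J (fun z => chartDiff I m₁ (ν z) (f z)) x w) s t := by
  have hS := (isOpen_extChartAt_source (I := I) m₁).mem_nhds hm₁
  have h := hasDerivWithinAt_diff_of_chart hx hf hw hS
    (by simpa only [extChartAt_source] using contMDiffOn_extChartAt (I := I) (x := m₁)) hm hc hv hξ
  have e : (fun z => diff I (extChartAt I m₁) (ν z) (f z)) =ᶠ[𝓝 x]
      fun z => chartDiff I m₁ (ν z) (f z) := by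
    have hν : ContinuousAt ν x := (contMDiffAt_tangent_iff.1 hf).1.continuousAt
    filter_upwards [hν.eventually (by rw [hx]; exact hS)] with z hz
    rw [diff_extChartAt hz]
  have e' : diff J (fun z => diff I (extChartAt I m₁) (ν z) (f z)) x =
      diff J (fun z => chartDiff I m₁ (ν z) (f z)) x := e.mfderiv_eq
  rw [e'] at h
  refine h.congr_of_eventuallyEq ?_ ?_
  · filter_upwards [hc.eventually hS] with r hr
    rw [diff_extChartAt hr]
  · rw [diff_extChartAt hm₁]

omit [I.Boundaryless] in
/-- The components of the differential of a vector field along a map. -/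
theorem mfderiv_tangent_apply {ν : N → M} {f : N → E} {x : N} (w : EN)
    (hf : ContMDiffAt J I.tangent ∞ (fun z => (⟨ν z, f z⟩ : TangentBundle I M)) x) :
    (mfderiv J I.tangent (fun z => (⟨ν z, f z⟩ : TangentBundle I M)) x w : E × E) =
      ((mfderiv J I ν x w : E), diff J (fun z => chartDiff I (ν x) (ν z) (f z)) x w) := by
  obtain ⟨γ, rfl, ⟨Z, hZ, h0, hγ⟩, rfl⟩ := exists_curve_with_velocity (I := J) x w
  have hγ0 : MDifferentiableAt 𝓘(ℝ, ℝ) J γ 0 :=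
    (hγ.contMDiffAt (hZ.mem_nhds h0)).mdifferentiableAt (by simp)
  have hf' := contMDiffAt_tangent_iff.1 hf
  have hν : MDifferentiableAt J I ν (γ 0) := hf'.1.mdifferentiableAt (by simp)
  have hνγ : MDifferentiableAt 𝓘(ℝ, ℝ) I (fun r => ν (γ r)) 0 := hν.comp 0 hγ0
  have hF := hf.mdifferentiableAt (by simp)
  have e1 := mfderiv_comp (I' := J) (0 : ℝ) hF hγ0
  have e2 := mfderiv_comp (I' := J) (0 : ℝ) hν hγ0
  have d1 := hasDerivAt_comp_curve (k := fun z => chartDiff I (ν (γ 0)) (ν z) (f z))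
      (hf'.2.mdifferentiableAt (by simp)) hγ0
  have d2 := ((mfderiv_curve_iff (I := I) (Γ := fun r => ν (γ r)) (t := 0) _).1 ⟨hνγ, rfl⟩)
  have d3 := ((mfderiv_tangent_iff (I := I) (c := fun r => ν (γ r)) (X := fun r => f (γ r))
    (t := 0) _ _).2 ⟨d2.1, d2.2, d1⟩).2
  have e1' := congrArg (fun A => (A (1 : ℝ) : E × E)) e1
  have e2' := congrArg (fun A => (A (1 : ℝ) : E)) e2
  refine e1'.symm.trans (d3.trans ?_)
  exact Prod.ext e2' rfl

end Variational

/-! ### Linear differential equations in a Banach algebra. -/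

section LinearODE

variable {A : Type*} [NormedRing A] [NormedAlgebra ℝ A] [CompleteSpace A]

theorem hasDerivAt_ringInverse_comp {q : ℝ → A} {q' : A} {t : ℝ} (hq : HasDerivAt q q' t)
    (hu : IsUnit (q t)) :
    HasDerivAt (fun r => Ring.inverse (q r)) (-(Ring.inverse (q t) * q' * Ring.inverse (q t))) t := by
  obtain ⟨x, hx⟩ := hu
  have h := hasFDerivAt_ringInverse (𝕜 := ℝ) x
  rw [hx] at h
  have h2 := h.comp_hasDerivAt t hq
  rw [← hx, Ring.inverse_unit]
  exact h2.congr_deriv (by simp)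

/-- The quotient of two solutions of a linear differential equation has vanishing derivative. -/
theorem hasDerivAt_inverse_mul_zero {q p : ℝ → A} {L : A} {t : ℝ}
    (hq : HasDerivAt q (L * q t) t) (hp : HasDerivAt p (L * p t) t) (hu : IsUnit (q t)) :
    HasDerivAt (fun r => Ring.inverse (q r) * p r) 0 t := by
  refine ((hasDerivAt_ringInverse_comp hq hu).mul hp).congr_deriv ?_
  rw [mul_assoc, mul_assoc, Ring.mul_inverse_cancel _ hu]
  noncomm_ring

/-- Local existence of an invertible smooth solution of a linear differential equation with smooth
coefficients. -/
theorem exists_local_solution_linear {B : ℝ → A} {W : Set ℝ} {t₁ : ℝ} (hW : IsOpen W)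
    (h₁ : t₁ ∈ W) (hB : ContDiffOn ℝ ∞ B W) :
    ∃ ε > 0, Ioo (t₁ - ε) (t₁ + ε) ⊆ W ∧ ∃ Ξ : ℝ → A, ∀ t ∈ Ioo (t₁ - ε) (t₁ + ε),
      HasDerivAt Ξ (B t * Ξ t) t ∧ ContDiffAt ℝ ∞ Ξ t ∧ IsUnit (Ξ t) := by
  -- Time is adjoined as a variable to make the equation autonomous. The initial value 1 in `A`
  -- ensures that the solution starts invertible, and the units form an open set.
  let g : ℝ × A → ℝ × A := fun z => (1, B z.1 * z.2)
  have hg : ContDiffAt ℝ 1 g (t₁, 1) := by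
    have h1 : ContDiffAt ℝ 1 B t₁ := (hB.contDiffAt (hW.mem_nhds h₁)).of_le (by simp)
    have h2 : ContDiffAt ℝ 1 (fun z : ℝ × A => B z.1) (t₁, 1) :=
      h1.comp (t₁, (1 : A)) contDiffAt_fst
    exact contDiffAt_const.prodMk (h2.mul contDiffAt_snd)
  obtain ⟨f, hf0, ε, hε, hf⟩ :=
    hg.exists_forall_mem_closedBall_exists_eq_forall_mem_Ioo_hasDerivAt₀ t₁
  have hfst : ∀ t ∈ Ioo (t₁ - ε) (t₁ + ε), (f t).1 = t := by
    intro t ht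
    have hd : ∀ r ∈ Ioo (t₁ - ε) (t₁ + ε), HasDerivAt (fun r => (f r).1 - r) 0 r := by
      intro r hr
      exact ((hf r hr).hasFDerivAt.fst.hasDerivAt.congr_deriv
        (by simp [g] : _ = (1 : ℝ))).sub (hasDerivAt_id r) |>.congr_deriv (sub_self 1)
    have hmem : t₁ ∈ Ioo (t₁ - ε) (t₁ + ε) := by constructor <;> linarith
    have := isOpen_Ioo.is_const_of_deriv_eq_zero isPreconnected_Ioo
      (fun r hr => (hd r hr).differentiableAt.differentiableWithinAt)
      (fun r hr => (hd r hr).deriv) ht hmem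
    simp only [hf0] at this
    linarith
  have hsnd : ∀ t ∈ Ioo (t₁ - ε) (t₁ + ε), HasDerivAt (fun r => (f r).2) (B t * (f t).2) t := by
    intro t ht
    refine (hf t ht).hasFDerivAt.snd.hasDerivAt.congr_deriv ?_
    simp [g, hfst t ht]
  have hcont : ContinuousAt (fun r => (f r).2) t₁ :=
    (hsnd t₁ (by constructor <;> linarith)).continuousAt
  have hun : ∀ᶠ r in 𝓝 t₁, IsUnit (f r).2 :=
    hcont.eventually (Units.isOpen.mem_nhds (by simp [hf0]))
  obtain ⟨δ, hδ, hδW⟩ := Metric.mem_nhds_iff.1 (Filter.inter_mem (hW.mem_nhds h₁) hun)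
  rw [Real.ball_eq_Ioo] at hδW
  have hsub : ∀ t ∈ Ioo (t₁ - min ε δ) (t₁ + min ε δ),
      t ∈ Ioo (t₁ - ε) (t₁ + ε) ∧ t ∈ W ∧ IsUnit (f t).2 := by
    intro t ht
    have h1 := min_le_left ε δ
    have h2 := min_le_right ε δ
    refine ⟨⟨by linarith [ht.1], by linarith [ht.2]⟩, ?_⟩
    exact hδW (show t ∈ Ioo (t₁ - δ) (t₁ + δ) from ⟨by linarith [ht.1], by linarith [ht.2]⟩)
  -- Bootstrapping: the derivative of the solution is `B` times the solution, so it is as regular as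
  -- the solution itself.
  have hsmooth : ∀ n : ℕ, ContDiffOn ℝ n (fun r => (f r).2)
      (Ioo (t₁ - min ε δ) (t₁ + min ε δ)) := by
    intro n
    induction n with
    | zero =>
      exact contDiffOn_zero.2 fun t ht =>
        (hsnd t (hsub t ht).1).continuousAt.continuousWithinAt
    | succ n ih =>
      rw [Nat.cast_add, Nat.cast_one, contDiffOn_succ_iff_deriv_of_isOpen isOpen_Ioo]
      refine ⟨fun t ht => (hsnd t (hsub t ht).1).differentiableAt.differentiableWithinAt,
        by simp, ?_⟩
      refine (((hB.mono fun t ht => (hsub t ht).2.1).of_le (by exact_mod_cast le_top)).mul ih).congr ?_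
      intro t ht
      exact (hsnd t (hsub t ht).1).deriv
  refine ⟨min ε δ, lt_min hε hδ, fun t ht => (hsub t ht).2.1, fun r => (f r).2, fun t ht =>
    ⟨hsnd t (hsub t ht).1, ?_, (hsub t ht).2.2⟩⟩
  exact (contDiffOn_infty.2 hsmooth).contDiffAt (isOpen_Ioo.mem_nhds ht)

end LinearODE

/-! ### Smooth frames along curves. -/

section FrameCalculus

variable {E : Type*} [NormedAddCommGroup E] [NormedSpace ℝ E] {H : Type*} [TopologicalSpace H]
  {I : ModelWithCorners ℝ E H} [I.Boundaryless] {M : Type*} [TopologicalSpace M]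
  [ChartedSpace H M] [IsManifold I ∞ M]
  {V : Type*} [NormedAddCommGroup V] [NormedSpace ℝ V]

/-- The differential of a smooth function along a smooth curve, in coordinates. -/
theorem contDiffAt_diff_comp_chartDiffInv {k : M → V} {γ : ℝ → M} {t : ℝ} {O : Set M}
    (hO : O ∈ 𝓝 (γ t)) (hk : ContMDiffOn I 𝓘(ℝ, V) ∞ k O)
    (hγ : ContMDiffAt 𝓘(ℝ, ℝ) I ∞ γ t) :
    ContDiffAt ℝ ∞ (fun r => (diff I k (γ r)).comp (chartDiffInv I (γ t) (γ r))) t := by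
  have hm := mem_extChartAt_source (I := I) (γ t)
  have h1 := contDiffAt_comp_extChartAt_symm hm (hk.contMDiffAt hO)
  have h2 : ContDiffAt ℝ ∞ (fderiv ℝ (k ∘ (extChartAt I (γ t)).symm)) (extChartAt I (γ t) (γ t)) :=
    h1.fderiv_right (m := ∞) (by simp)
  have h3 : ContDiffAt ℝ ∞ (fun r => extChartAt I (γ t) (γ r)) t :=
    contMDiffAt_iff_contDiffAt.1 ((contMDiffAt_extChartAt (I := I)).comp t hγ)
  refine (h2.comp t h3).congr_of_eventuallyEq ?_
  filter_upwards [hγ.continuousAt.eventually (eventually_diff_eq_fderiv_comp hm hO hk),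
    hγ.continuousAt.eventually ((isOpen_extChartAt_source (I := I) (γ t)).mem_nhds hm)] with r hr hr'
  rw [hr]
  ext v
  simp [chartDiff_chartDiffInv hr']

omit [I.Boundaryless] in
theorem contDiffAt_tangentCoordChange_comp {c : ℝ → M} {t : ℝ} {m₀ m₁ : M}
    (hc : ContMDiffAt 𝓘(ℝ, ℝ) I ∞ c t) (h₀ : c t ∈ (extChartAt I m₀).source)
    (h₁ : c t ∈ (extChartAt I m₁).source) :
    ContDiffAt ℝ ∞ (fun r => tangentCoordChange I m₀ m₁ (c r)) t := by
  rw [← contMDiffAt_iff_contDiffAt]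
  have h := (contMDiffOn_tangentCoordChange (I := I) m₀ m₁).contMDiffAt (x := c t)
    (((isOpen_extChartAt_source m₀).inter (isOpen_extChartAt_source m₁)).mem_nhds ⟨h₀, h₁⟩)
  exact h.comp t hc

/-- `chartDiff` as an isomorphism. -/
def chartEquiv (m₀ y : M) (hy : y ∈ (extChartAt I m₀).source) : E ≃L[ℝ] E :=
  ContinuousLinearEquiv.equivOfInverse (chartDiff I m₀ y) (chartDiffInv I m₀ y)
    (chartDiffInv_chartDiff hy) (chartDiff_chartDiffInv hy)

/-- A family of frames `P r` of `T_{c r}M` is smooth at `t`. -/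
def FrameSmoothAt (I : ModelWithCorners ℝ E H) [IsManifold I ∞ M] (c : ℝ → M)
    (P : ℝ → E ≃L[ℝ] E) (t : ℝ) : Prop :=
  ContDiffAt ℝ ∞ (fun r => (chartDiff I (c t) (c r)).comp (P r : E →L[ℝ] E)) t

end FrameCalculus

namespace GeometricControlStructure

variable {E : Type*} [NormedAddCommGroup E] [NormedSpace ℝ E] {H : Type*} [TopologicalSpace H]
  {I : ModelWithCorners ℝ E H} {M : Type*} [TopologicalSpace M] [ChartedSpace H M]
  [IsManifold I ∞ M]
  {EU : Type*} [NormedAddCommGroup EU] [NormedSpace ℝ EU] {HU : Type*} [TopologicalSpace HU]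
  {IU : ModelWithCorners ℝ EU HU} {U : Type*} [TopologicalSpace U] [ChartedSpace HU U]
  [IsManifold IU ∞ U]
  {EQ : Type*} [NormedAddCommGroup EQ] [NormedSpace ℝ EQ] {HQ : Type*} [TopologicalSpace HQ]
  {IQ : ModelWithCorners ℝ EQ HQ} {Q : Type*} [TopologicalSpace Q] [ChartedSpace HQ Q]
  {EF : Type*} [NormedAddCommGroup EF] [NormedSpace ℝ EF] {HF : Type*} [TopologicalSpace HF]
  {IF : ModelWithCorners ℝ EF HF} {F : Type*} [TopologicalSpace F] [ChartedSpace HF F]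
  {G : GeometricControlStructure I M IU U IQ Q IF F}

/-! ### Parallel frames along an admissible curve: local existence. -/

section Frames

variable (G)

/-- The components of `𝐓 ∘ ρ` in the preferred chart at `m`. -/
def velCoord (m : M) (z : U) : E := chartDiff I m (G.ν z) (G.vel z)

/-- The differential at `z` of the components of `𝐓 ∘ ρ` in the preferred chart at `ν z`. -/
def velDeriv (z : U) : EU →L[ℝ] E := diff IU (G.velCoord (G.ν z)) z

/-- The differential of `ν`. -/
def projDeriv (z : U) : EU →L[ℝ] E := mfderiv IU I G.ν z

/-- The base curve of a curve in `J¹ν`. -/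
def base (ψ : ℝ → G.Jet) (t : ℝ) : M := G.ν (ψ t).1

/-- The linear map of the jet `ψ t`. -/
def jetLin (ψ : ℝ → G.Jet) (t : ℝ) : E →L[ℝ] EU := (ψ t).lin

theorem contMDiff_ν : ContMDiff IU I ∞ G.ν := G.bundle_ν.smooth

theorem contMDiff_velocity :
    ContMDiff IU I.tangent ∞ (fun z => (⟨G.ν z, G.vel z⟩ : TangentBundle I M)) := G.smooth_ρ

theorem projDeriv_jetLin (ψ : ℝ → G.Jet) (t : ℝ) (v : E) :
    G.projDeriv (ψ t).1 (G.jetLin ψ t v) = v :=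
  congrArg (fun A => (A v : E)) (ψ t).2.2

theorem contMDiffOn_velCoord [I.Boundaryless] (m : M) :
    ContMDiffOn IU 𝓘(ℝ, E) ∞ (G.velCoord m) (G.ν ⁻¹' (extChartAt I m).source) :=
  fun z hz => (contMDiffAt_chartDiff hz (G.contMDiff_velocity z)).contMDiffWithinAt

theorem isOpen_preimage_source (m : M) : IsOpen (G.ν ⁻¹' (extChartAt I m).source) :=
  (isOpen_extChartAt_source m).preimage G.contMDiff_ν.continuous

/-- The frames `P r` along the base curve of `ψ` satisfy the variational equation at `t`. -/
def IsParallelAt (ψ : ℝ → G.Jet) (P : ℝ → E ≃L[ℝ] E) (t : ℝ) : Prop :=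
  HasDerivAt (fun r => (chartDiff I (G.base ψ t) (G.base ψ r)).comp (P r : E →L[ℝ] E))
    ((G.velDeriv (ψ t).1).comp ((G.jetLin ψ t).comp (P t : E →L[ℝ] E))) t

/-- The frames `P r` along the base curve of `ψ` are smooth on a neighbourhood of `[α, T]` and
satisfy the variational equation on `[α, T]`. -/
def IsParallelFrame (ψ : ℝ → G.Jet) (P : ℝ → E ≃L[ℝ] E) (α T : ℝ) : Prop :=
  (∃ W : Set ℝ, IsOpen W ∧ Icc α T ⊆ W ∧
    ContMDiffOn 𝓘(ℝ, ℝ) IU ∞ (fun t => (ψ t).1) W ∧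
    ∀ t ∈ W, FrameSmoothAt I (G.base ψ) P t) ∧
  ∀ t ∈ Icc α T, G.IsParallelAt ψ P t

variable {G}
variable {ψ : ℝ → G.Jet} {V : Set ℝ} {α β : ℝ}

theorem SmoothJetCurveOn.contMDiffOn_base (hψ : G.SmoothJetCurveOn ψ V) :
    ContMDiffOn 𝓘(ℝ, ℝ) I ∞ (G.base ψ) V :=
  G.contMDiff_ν.comp_contMDiffOn hψ.1

theorem SmoothJetCurveOn.contDiffAt_jetLin (hψ : G.SmoothJetCurveOn ψ V) (hV : IsOpen V) {t : ℝ}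
    (ht : t ∈ V) :
    ContDiffAt ℝ ∞ (fun r => (chartDiff IU (ψ t).1 (ψ r).1).comp
      ((G.jetLin ψ r).comp (chartDiffInv I (G.base ψ t) (G.base ψ r)))) t := by
  refine (hψ.2 t ht).congr_of_eventuallyEq ?_
  have h1 := (hψ.contMDiffOn_base.contMDiffAt (hV.mem_nhds ht)).continuousAt.eventually
    ((chartAt H (G.base ψ t)).open_source.mem_nhds (mem_chart_source H _))
  have h2 := (hψ.1.contMDiffAt (hV.mem_nhds ht)).continuousAt.eventually
    ((chartAt HU (ψ t).1).open_source.mem_nhds (mem_chart_source HU _))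
  filter_upwards [h1, h2] with r hr hr'
  exact (inTangentCoordinates_eq (I := I) (I' := IU) (fun t => G.ν (ψ t).1) (fun t => (ψ t).1)
    (G.jetLin ψ) hr hr').symm

/-- The coefficients of the variational equation in a chart. -/
def variationalCoeff (ψ : ℝ → G.Jet) (m : M) (t : ℝ) : E →L[ℝ] E :=
  (diff IU (G.velCoord m) (ψ t).1).comp
    ((G.jetLin ψ t).comp (chartDiffInv I m (G.base ψ t)))

section

variable [I.Boundaryless] [IU.Boundaryless]

theorem SmoothJetCurveOn.contDiffAt_variationalCoeff (hψ : G.SmoothJetCurveOn ψ V) (hV : IsOpen V)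
    {t : ℝ} (ht : t ∈ V) {m : M} (hm : G.base ψ t ∈ (extChartAt I m).source) :
    ContDiffAt ℝ ∞ (variationalCoeff ψ m) t := by
  have hu := hψ.1.contMDiffAt (hV.mem_nhds ht)
  have hc := hψ.contMDiffOn_base.contMDiffAt (hV.mem_nhds ht)
  have h1 := contDiffAt_diff_comp_chartDiffInv ((G.isOpen_preimage_source m).mem_nhds hm)
    (G.contMDiffOn_velCoord m) hu
  have h2 := hψ.contDiffAt_jetLin hV ht
  have h3 := contDiffAt_tangentCoordChange_comp hc hm (mem_extChartAt_source (G.base ψ t))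
  -- The three factors are smooth in charts centred at the point of time t; the coordinate changes
  -- between consecutive factors cancel for nearby r.
  refine (h1.clm_comp (h2.clm_comp h3)).congr_of_eventuallyEq ?_
  filter_upwards [hc.continuousAt.eventually ((isOpen_extChartAt_source (I := I) m).mem_nhds hm),
    hc.continuousAt.eventually ((isOpen_extChartAt_source (I := I) (G.base ψ t)).mem_nhds
      (mem_extChartAt_source (G.base ψ t))),
    hu.continuousAt.eventually ((isOpen_extChartAt_source (I := IU) (ψ t).1).mem_nhds
      (mem_extChartAt_source (ψ t).1))] with r hr1 hr2 hr3
  ext v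
  simp only [variationalCoeff, ContinuousLinearMap.comp_apply, chartDiffInv_chartDiff hr3,
    chartDiffInv_change hr1 hr2]

omit [I.Boundaryless] [IU.Boundaryless] in
/-- The velocity of the base curve of an admissible curve. -/
theorem IsSmoothAdmissible.hasDerivAt_base (hψ : G.IsSmoothAdmissible α β ψ) {t : ℝ}
    (ht : t ∈ Icc α β) {m : M} (hm : G.base ψ t ∈ (extChartAt I m).source) :
    HasDerivAt (fun r => extChartAt I m (G.base ψ r))
      (chartDiff I m (G.base ψ t) (G.vel (ψ t).1)) t := by
  obtain ⟨⟨V, hV, hsub, hs⟩, had⟩ := hψ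
  have hu := (hs.1.contMDiffAt (hV.mem_nhds (hsub ht))).mdifferentiableAt (by simp)
  have hc := (hs.contMDiffOn_base.contMDiffAt (hV.mem_nhds (hsub ht))).mdifferentiableAt (by simp)
  have h := hasDerivAt_comp_curve (k := extChartAt I m)
    ((contMDiffAt_extChartAt' (n := ∞)
      (by rwa [extChartAt_source] at hm)).mdifferentiableAt (by simp)) hc
  rw [diff_extChartAt hm] at h
  have e : (mfderiv 𝓘(ℝ, ℝ) I (G.base ψ) t (1 : ℝ) : E) = G.vel (ψ t).1 := by
    have e1 := congrArg (fun A => (A (1 : ℝ) : E)) (mfderiv_comp (I' := IU) t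
      (G.contMDiff_ν.mdifferentiableAt (by simp) (x := (ψ t).1)) hu)
    refine e1.trans ?_
    have e2 := congrArg (G.projDeriv (ψ t).1) (had t ht)
    exact e2.trans (G.projDeriv_jetLin ψ t (G.vel (ψ t).1))
  rw [e] at h
  exact h

/-- A frame which is parallel in one chart is parallel. -/
theorem IsSmoothAdmissible.isParallelAt_of_chart (hψ : G.IsSmoothAdmissible α β ψ)
    {P : ℝ → E ≃L[ℝ] E} {t : ℝ} (ht : t ∈ Icc α β) {m : M}
    (hm : G.base ψ t ∈ (extChartAt I m).source) (hP : FrameSmoothAt I (G.base ψ) P t)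
    (hd : HasDerivAt (fun r => (chartDiff I m (G.base ψ r)).comp (P r : E →L[ℝ] E))
      ((variationalCoeff ψ m t).comp ((chartDiff I m (G.base ψ t)).comp (P t : E →L[ℝ] E))) t) :
    G.IsParallelAt ψ P t := by
  -- Smoothness of the frame provides some derivative in the centred chart. Its value is then found
  -- by applying the change of chart to each field r ↦ P r v separately.
  have hd' : HasDerivAt (fun r => (chartDiff I (G.base ψ t) (G.base ψ r)).comp (P r : E →L[ℝ] E))
      _ t := (hP.differentiableAt (by simp)).hasDerivAt
  refine hd'.congr_deriv ?_
  ext v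
  have hc : ContinuousAt (G.base ψ) t := by
    obtain ⟨⟨V, hV, hsub, hs⟩, -⟩ := hψ
    exact (hs.contMDiffOn_base.contMDiffAt (hV.mem_nhds (hsub ht))).continuousAt
  have h1 := hasDerivWithinAt_chartDiff_change (J := IU) (s := univ) (c := G.base ψ)
    (X := fun r => P r v) (ν := G.ν) (f := G.vel) (x := (ψ t).1) (w := G.jetLin ψ t (P t v))
    (m₁ := G.base ψ t) rfl (G.contMDiff_velocity _) (G.projDeriv_jetLin ψ t (P t v)) hm
    (mem_extChartAt_source _) hc.continuousWithinAt (hψ.hasDerivAt_base ht hm).hasDerivWithinAt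
    (by
      refine (hd.clm_apply (hasDerivAt_const t v)).hasDerivWithinAt.congr_deriv ?_
      simp only [map_zero, add_zero, variationalCoeff, ContinuousLinearMap.comp_apply,
        chartDiffInv_chartDiff hm]
      rfl)
  rw [hasDerivWithinAt_univ] at h1
  have h2 := hd'.clm_apply (hasDerivAt_const t v)
  rw [map_zero, add_zero] at h2
  exact h2.unique h1

variable [CompleteSpace E]

/-- Local existence of parallel frames. -/
theorem IsSmoothAdmissible.exists_local_frame (hψ : G.IsSmoothAdmissible α β ψ) {t₁ : ℝ}
    (h₁ : t₁ ∈ Icc α β) :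
    ∃ ε > 0, ∃ P : ℝ → E ≃L[ℝ] E,
      ContMDiffOn 𝓘(ℝ, ℝ) IU ∞ (fun t => (ψ t).1) (Ioo (t₁ - ε) (t₁ + ε)) ∧
      ∀ t ∈ Ioo (t₁ - ε) (t₁ + ε), FrameSmoothAt I (G.base ψ) P t ∧
        (t ∈ Icc α β → G.IsParallelAt ψ P t) := by
  classical
  have hψ' := hψ
  obtain ⟨⟨V, hV, hsub, hs⟩, -⟩ := hψ'
  set m := G.base ψ t₁ with hm
  let W : Set ℝ := V ∩ G.base ψ ⁻¹' (extChartAt I m).source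
  have hW : IsOpen W :=
    hs.contMDiffOn_base.continuousOn.isOpen_inter_preimage hV (isOpen_extChartAt_source m)
  have hB : ContDiffOn ℝ ∞ (variationalCoeff ψ m) W := fun t ht =>
    (hs.contDiffAt_variationalCoeff hV ht.1 ht.2).contDiffWithinAt
  obtain ⟨ε, hε, hεW, Ξ, hΞ⟩ := exists_local_solution_linear hW
    (⟨hsub h₁, mem_extChartAt_source m⟩ : t₁ ∈ W) hB
  let P : ℝ → E ≃L[ℝ] E := fun t =>
    if h : G.base ψ t ∈ (extChartAt I m).source ∧ IsUnit (Ξ t) then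
      (ContinuousLinearEquiv.unitsEquiv ℝ E h.2.unit).trans (chartEquiv m (G.base ψ t) h.1).symm
    else ContinuousLinearEquiv.refl ℝ E
  have hP : ∀ t ∈ Ioo (t₁ - ε) (t₁ + ε), (P t : E →L[ℝ] E) =
      (chartDiffInv I m (G.base ψ t)).comp (Ξ t) := by
    intro t ht
    have h : G.base ψ t ∈ (extChartAt I m).source ∧ IsUnit (Ξ t) := ⟨(hεW ht).2, (hΞ t ht).2.2⟩
    simp only [P, dif_pos h]
    rfl
  refine ⟨ε, hε, P, hs.1.mono fun t ht => (hεW ht).1, fun t ht => ?_⟩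
  have hnhds := isOpen_Ioo.mem_nhds ht
  have hsrc := (hεW ht).2
  have hcs := hs.contMDiffOn_base.contMDiffAt (hV.mem_nhds (hεW ht).1)
  have hsm : FrameSmoothAt I (G.base ψ) P t := by
    refine ((contDiffAt_tangentCoordChange_comp hcs hsrc
      (mem_extChartAt_source (G.base ψ t))).clm_comp (hΞ t ht).2.1).congr_of_eventuallyEq ?_
    filter_upwards [hnhds, hcs.continuousAt.eventually ((isOpen_extChartAt_source (I := I)
      (G.base ψ t)).mem_nhds (mem_extChartAt_source (G.base ψ t)))] with r hr hr'
    rw [hP r hr]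
    ext v
    have := chartDiff_change (hεW hr).2 hr' (chartDiffInv I m (G.base ψ r) (Ξ r v))
    rw [chartDiff_chartDiffInv (hεW hr).2] at this
    exact this.symm
  refine ⟨hsm, fun htI => hψ.isParallelAt_of_chart htI hsrc hsm ?_⟩
  have e : ∀ r ∈ Ioo (t₁ - ε) (t₁ + ε),
      (chartDiff I m (G.base ψ r)).comp (P r : E →L[ℝ] E) = Ξ r := by
    intro r hr
    rw [hP r hr]
    ext v
    simp [chartDiff_chartDiffInv (hεW hr).2]
  rw [e t ht]
  refine (hΞ t ht).1.congr_of_eventuallyEq ?_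
  filter_upwards [hnhds] with r hr using e r hr

end

end Frames

/-! ### Uniqueness, gluing and continuation of parallel frames. -/

section ParallelFrames

theorem IsParallelFrame.contMDiffAt_base {ψ : ℝ → G.Jet} {P : ℝ → E ≃L[ℝ] E} {α β : ℝ}
    (h : G.IsParallelFrame ψ P α β) {t : ℝ} (ht : t ∈ Icc α β) :
    ContMDiffAt 𝓘(ℝ, ℝ) I ∞ (G.base ψ) t := by
  obtain ⟨⟨W, hW, hsub, hs, -⟩, -⟩ := h
  exact (G.contMDiff_ν.comp_contMDiffOn hs).contMDiffAt (hW.mem_nhds (hsub ht))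

theorem IsParallelFrame.frameSmoothAt {ψ : ℝ → G.Jet} {P : ℝ → E ≃L[ℝ] E} {α β : ℝ}
    (h : G.IsParallelFrame ψ P α β) {t : ℝ} (ht : t ∈ Icc α β) :
    FrameSmoothAt I (G.base ψ) P t := by
  obtain ⟨⟨W, hW, hsub, hs, hf⟩, -⟩ := h
  exact hf t (hsub ht)

/-- The coefficients act on the left, so a constant isomorphism applied on the right preserves the
equation. This freedom is what allows frames to be matched at a junction. -/
theorem IsParallelAt.compConst {ψ : ℝ → G.Jet} {P : ℝ → E ≃L[ℝ] E} {t : ℝ}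
    (h : G.IsParallelAt ψ P t) (C : E ≃L[ℝ] E) : G.IsParallelAt ψ (fun r => C.trans (P r)) t :=
  h.clm_comp (hasDerivAt_const t (C : E →L[ℝ] E)) |>.congr_deriv (by
    rw [ContinuousLinearMap.comp_zero, add_zero]; rfl)

theorem _root_.FrameSmoothAt.compConst {c : ℝ → M} {P : ℝ → E ≃L[ℝ] E} {t : ℝ}
    (h : FrameSmoothAt I c P t) (C : E ≃L[ℝ] E) : FrameSmoothAt I c (fun r => C.trans (P r)) t :=
  h.clm_comp (contDiffAt_const (c := (C : E →L[ℝ] E)))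

theorem IsParallelAt.congr {ψ : ℝ → G.Jet} {P P' : ℝ → E ≃L[ℝ] E} {t : ℝ}
    (h : G.IsParallelAt ψ P t) (he : P' =ᶠ[𝓝 t] P) : G.IsParallelAt ψ P' t := by
  unfold IsParallelAt at h ⊢
  rw [he.self_of_nhds]
  refine h.congr_of_eventuallyEq ?_
  filter_upwards [he] with r hr
  rw [hr]

theorem _root_.FrameSmoothAt.congr {c : ℝ → M} {P P' : ℝ → E ≃L[ℝ] E} {t : ℝ}
    (h : FrameSmoothAt I c P t) (he : P' =ᶠ[𝓝 t] P) : FrameSmoothAt I c P' t := by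
  refine ContDiffAt.congr_of_eventuallyEq h ?_
  filter_upwards [he] with r hr
  rw [hr]

theorem IsParallelFrame.compConst {ψ : ℝ → G.Jet} {P : ℝ → E ≃L[ℝ] E} {α β : ℝ}
    (h : G.IsParallelFrame ψ P α β) (C : E ≃L[ℝ] E) :
    G.IsParallelFrame ψ (fun r => C.trans (P r)) α β := by
  obtain ⟨⟨W, hW, hsub, hs, hf⟩, hp⟩ := h
  exact ⟨⟨W, hW, hsub, hs, fun t ht => (hf t ht).compConst C⟩, fun t ht => (hp t ht).compConst C⟩

/-- This links inversion in the algebra of endomorphisms, for which derivative and smoothness are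
known, with the inverse frames that transport covectors. -/
theorem ringInverse_chartDiff_comp {m y : M} (hy : y ∈ (extChartAt I m).source) (P : E ≃L[ℝ] E) :
    Ring.inverse ((chartDiff I m y).comp (P : E →L[ℝ] E)) =
      (P.symm : E →L[ℝ] E).comp (chartDiffInv I m y) := by
  have e : (chartDiff I m y).comp (P : E →L[ℝ] E) = (P.trans (chartEquiv m y hy) : E →L[ℝ] E) := rfl
  rw [e, ContinuousLinearMap.ringInverse_equiv, ContinuousLinearMap.inverse_equiv]
  rfl

theorem isUnit_chartDiff_comp {m y : M} (hy : y ∈ (extChartAt I m).source) (P : E ≃L[ℝ] E) :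
    IsUnit ((chartDiff I m y).comp (P : E →L[ℝ] E)) :=
  ⟨(ContinuousLinearEquiv.unitsEquiv ℝ E).symm (P.trans (chartEquiv m y hy)), rfl⟩

section

variable [CompleteSpace E]

theorem IsParallelAt.hasDerivAt_quotient {ψ : ℝ → G.Jet} {P Q : ℝ → E ≃L[ℝ] E} {t : ℝ}
    (hP : G.IsParallelAt ψ P t) (hQ : G.IsParallelAt ψ Q t) (hc : ContinuousAt (G.base ψ) t) :
    HasDerivAt (fun r => ((Q r).symm : E →L[ℝ] E).comp (P r : E →L[ℝ] E)) 0 t := by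
  have hm := mem_extChartAt_source (I := I) (G.base ψ t)
  -- At the centre the chart acts as the identity, so both frames solve an equation with the same
  -- left coefficient at t, and the chart factors cancel in the quotient.
  have hid : (chartDiff I (G.base ψ t) (G.base ψ t)) = ContinuousLinearMap.id ℝ E := by
    ext v; exact chartDiff_self _ v
  have h := hasDerivAt_inverse_mul_zero
    (q := fun r => (chartDiff I (G.base ψ t) (G.base ψ r)).comp (Q r : E →L[ℝ] E))
    (p := fun r => (chartDiff I (G.base ψ t) (G.base ψ r)).comp (P r : E →L[ℝ] E))
    (L := (G.velDeriv (ψ t).1).comp (G.jetLin ψ t)) (t := t)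
    (hQ.congr_deriv (by rw [hid]; rfl)) (hP.congr_deriv (by rw [hid]; rfl))
    (isUnit_chartDiff_comp hm _)
  refine h.congr_of_eventuallyEq ?_
  filter_upwards [hc.eventually ((isOpen_extChartAt_source (I := I) _).mem_nhds hm)] with r hr
  rw [ringInverse_chartDiff_comp hr]
  ext v
  simp [chartDiffInv_chartDiff hr]

/-- Parallel frames differ by a constant isomorphism. -/
theorem IsParallelAt.quotient_eq {ψ : ℝ → G.Jet} {P Q : ℝ → E ≃L[ℝ] E} {x y : ℝ}
    (hP : ∀ t ∈ Icc x y, G.IsParallelAt ψ P t) (hQ : ∀ t ∈ Icc x y, G.IsParallelAt ψ Q t)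
    (hc : ∀ t ∈ Icc x y, ContinuousAt (G.base ψ) t) {t : ℝ} (ht : t ∈ Icc x y) (v : E) :
    (Q t).symm (P t v) = (Q y).symm (P y v) := by
  have hd : ∀ r ∈ Icc x y,
      HasDerivAt (fun r => ((Q r).symm : E →L[ℝ] E).comp (P r : E →L[ℝ] E)) 0 r :=
    fun r hr => (hP r hr).hasDerivAt_quotient (hQ r hr) (hc r hr)
  have h := constant_of_has_deriv_right_zero
    (fun r hr => (hd r hr).continuousAt.continuousWithinAt)
    (fun r hr => (hd r ⟨hr.1, hr.2.le⟩).hasDerivWithinAt)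
  have h1 := h t ht
  have h2 := h y ⟨ht.1.trans ht.2, le_rfl⟩
  exact DFunLike.congr_fun (h1.trans h2.symm) v

/-- A parallel frame on `[α, T]` extends along an interval on which a parallel frame is known. -/
theorem IsParallelFrame.exists_extension {ψ : ℝ → G.Jet} {P Q : ℝ → E ≃L[ℝ] E} {α T T' x y : ℝ}
    (hP : G.IsParallelFrame ψ P α T) (hT' : T ≤ T') (hx : x < T) (hy : T' < y)
    (hs : ContMDiffOn 𝓘(ℝ, ℝ) IU ∞ (fun t => (ψ t).1) (Ioo x y))
    (hQs : ∀ t ∈ Ioo x y, FrameSmoothAt I (G.base ψ) Q t)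
    (hQ : ∀ t ∈ Ioo x y, t ∈ Icc α T' → G.IsParallelAt ψ Q t) :
    ∃ P' : ℝ → E ≃L[ℝ] E, G.IsParallelFrame ψ P' α T' := by
  -- If the interval ]x, y[ contains all of [α, T'], the known frame serves alone and nothing has to
  -- be glued.
  by_cases hxα : x < α
  · have hsub : Icc α T' ⊆ Ioo x y := fun t ht => ⟨hxα.trans_le ht.1, ht.2.trans_lt hy⟩
    exact ⟨Q, ⟨Ioo x y, isOpen_Ioo, hsub, hs, hQs⟩, fun t ht => hQ t (hsub ht) ht⟩
  rw [not_lt] at hxα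
  -- With this constant, the adjusted frame agrees with `P` at T, hence by constancy of the quotient
  -- on all of ]x, T].
  let C : E ≃L[ℝ] E := (P T).trans (Q T).symm
  have hPQ : ∀ t ∈ Ioc x T, P t = C.trans (Q t) := by
    intro t ht
    have hsub : ∀ r ∈ Icc t T, r ∈ Icc α T ∧ r ∈ Ioo x y := fun r hr =>
      ⟨⟨hxα.trans (ht.1.le.trans hr.1), hr.2⟩, ht.1.trans_le hr.1, hr.2.trans_lt (hT'.trans_lt hy)⟩
    ext v
    have h := IsParallelAt.quotient_eq (fun r hr => hP.2 r (hsub r hr).1)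
      (fun r hr => hQ r (hsub r hr).2 ⟨(hsub r hr).1.1, hr.2.trans hT'⟩)
      (fun r hr => (hP.contMDiffAt_base (hsub r hr).1).continuousAt)
      (⟨le_rfl, ht.2⟩ : t ∈ Icc t T) v
    rw [ContinuousLinearEquiv.symm_apply_eq] at h
    exact h
  -- The glued frame is the adjusted `Q` on the whole of ]x, y[, also to the left of T. The switch
  -- at T therefore creates no corner.
  have hQP : ∀ t ∈ Ioo x y, (fun r => if r < T then P r else C.trans (Q r)) =ᶠ[𝓝 t]
      fun r => C.trans (Q r) := by
    intro t ht
    filter_upwards [isOpen_Ioo.mem_nhds ht] with r hr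
    by_cases hrT : r < T
    · rw [if_pos hrT, hPQ r ⟨hr.1, hrT.le⟩]
    · rw [if_neg hrT]
  have hPP : ∀ t < T, (fun r => if r < T then P r else C.trans (Q r)) =ᶠ[𝓝 t] P := by
    intro t ht
    filter_upwards [isOpen_Iio.mem_nhds ht] with r hr
    exact if_pos hr
  obtain ⟨⟨W, hW, hsub, hWs, hf⟩, hp⟩ := hP
  refine ⟨fun r => if r < T then P r else C.trans (Q r),
    ⟨(W ∩ Iio T) ∪ Ioo x y, (hW.inter isOpen_Iio).union isOpen_Ioo, ?_, ?_, ?_⟩, ?_⟩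
  · intro t ht
    by_cases htT : t < T
    · exact Or.inl ⟨hsub ⟨ht.1, htT.le⟩, htT⟩
    · exact Or.inr ⟨hx.trans_le (not_lt.1 htT), ht.2.trans_lt hy⟩
  · exact (hWs.mono inter_subset_left).union_of_isOpen hs (hW.inter isOpen_Iio) isOpen_Ioo
  · rintro t (ht | ht)
    · exact (hf t ht.1).congr (hPP t ht.2)
    · exact ((hQs t ht).compConst C).congr (hQP t ht)
  · intro t ht
    by_cases htT : t < T
    · exact (hp t ⟨ht.1, htT.le⟩).congr (hPP t htT)
    · have ht' : t ∈ Ioo x y := ⟨hx.trans_le (not_lt.1 htT), ht.2.trans_lt hy⟩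
      exact ((hQ t ht' ht).compConst C).congr (hQP t ht')

variable [I.Boundaryless] [IU.Boundaryless]

/-- Existence of parallel frames along smooth admissible curves. -/
theorem IsSmoothAdmissible.exists_parallelFrame {ψ : ℝ → G.Jet} {α β : ℝ}
    (hψ : G.IsSmoothAdmissible α β ψ) (hαβ : α ≤ β) :
    ∃ P : ℝ → E ≃L[ℝ] E, G.IsParallelFrame ψ P α β := by
  have hloc := fun t₁ : Icc α β => hψ.exists_local_frame t₁.2
  choose ε hε Q hQs hQ using hloc
  -- By compactness there is a subdivision each of whose steps lies in one interval of local
  -- existence. It stabilises at β after finitely many steps, so induction along it reaches the end.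
  obtain ⟨s, hs0, hmono, ⟨m, hm⟩, hs⟩ := exists_monotone_Icc_subset_open_cover_Icc hαβ
    (c := fun t₁ : Icc α β => Subtype.val ⁻¹' Ioo ((t₁ : ℝ) - ε t₁) (t₁ + ε t₁))
    (fun t₁ => isOpen_Ioo.preimage continuous_subtype_val)
    (fun t _ => mem_iUnion.2 ⟨t, by constructor <;> linarith [hε t]⟩)
  suffices h : ∀ n, ∃ P : ℝ → E ≃L[ℝ] E, G.IsParallelFrame ψ P α (s n) by
    have := h m
    rwa [hm m le_rfl] at this
  intro n
  induction n with
  | zero =>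
    obtain ⟨i, hi⟩ := hs 0
    have h0 : (s 0 : ℝ) = α := by rw [hs0]
    have h1 : s 0 ∈ Subtype.val ⁻¹' Ioo ((i : ℝ) - ε i) (i + ε i) :=
      hi ⟨le_rfl, hmono (Nat.le_succ 0)⟩
    rw [mem_preimage, h0] at h1
    rw [h0]
    refine ⟨Q i, ⟨⟨_, isOpen_Ioo, ?_, hQs i, fun t ht => (hQ i t ht).1⟩, ?_⟩⟩
    · rw [Icc_self]
      exact singleton_subset_iff.2 h1
    · intro t ht
      rw [Icc_self, mem_singleton_iff] at ht
      subst ht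
      exact (hQ i t h1).2 ⟨le_rfl, hαβ⟩
  | succ n ih =>
    obtain ⟨P, hP⟩ := ih
    obtain ⟨i, hi⟩ := hs n
    have hle : (s n : ℝ) ≤ s (n + 1) := hmono (Nat.le_succ n)
    have hT : (s n : ℝ) ∈ Ioo ((i : ℝ) - ε i) (i + ε i) := hi ⟨le_rfl, hmono (Nat.le_succ n)⟩
    have hT' : (s (n + 1) : ℝ) ∈ Ioo ((i : ℝ) - ε i) (i + ε i) :=
      hi ⟨hmono (Nat.le_succ n), le_rfl⟩
    exact hP.exists_extension hle hT.1 hT'.2 (hQs i) (fun t ht => (hQ i t ht).1)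
      (fun t ht htI => (hQ i t ht).2 ⟨htI.1, htI.2.trans (s (n + 1)).2.2⟩)

end

/-- The data of a piecewise admissible curve with a frame along its base curve, on one of the
pieces. -/
structure IsFramedPiece (u : ℝ → U) (ψ : ∀ t, G.JetFibre (u t)) (P : ℝ → E ≃L[ℝ] E) (α β : ℝ)
    (φ : ℝ → G.Jet) (P' : ℝ → E ≃L[ℝ] E) : Prop where
  lt : α < β
  admissible : G.IsSmoothAdmissible α β φ
  jet_eq : ∀ t ∈ Ioc α β, (⟨u t, ψ t⟩ : G.Jet) = φ t
  base_eq : ∀ t ∈ Icc α β, G.ν (u t) = G.base φ t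
  frame : G.IsParallelFrame φ P' α β
  frame_eq : ∀ t ∈ Icc α β, P t = P' t

theorem subdivision_le {s : ℕ → ℝ} {n i : ℕ} (hs : ∀ i < n, s i < s (i + 1)) (hi : i ≤ n) :
    s i ≤ s n := by
  induction n with
  | zero => rw [Nat.le_zero.1 hi]
  | succ n ih =>
    rcases Nat.lt_or_ge i (n + 1) with h | h
    · exact (ih (fun j hj => hs j (hj.trans n.lt_succ_self)) (Nat.lt_succ_iff.1 h)).trans
        (hs n n.lt_succ_self).le
    · rw [le_antisymm hi h]

variable [T2Space M] [CompleteSpace E] [I.Boundaryless] [IU.Boundaryless]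

/-- A piecewise admissible curve with continuous base curve has a continuous frame along its base
curve which is parallel on each smooth piece. -/
theorem IsPiecewiseAdmissible.exists_frame {a b : ℝ} {u : ℝ → U} {ψ : ∀ t, G.JetFibre (u t)}
    (hψ : G.IsPiecewiseAdmissible a b u ψ) (hc : ContinuousOn (fun t => G.ν (u t)) (Icc a b)) :
    ∃ (P : ℝ → E ≃L[ℝ] E) (n : ℕ) (s : ℕ → ℝ), 0 < n ∧ s 0 = a ∧ s n = b ∧
      ∀ i < n, ∃ (φ : ℝ → G.Jet) (P' : ℝ → E ≃L[ℝ] E),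
        IsFramedPiece u ψ P (s i) (s (i + 1)) φ P' ∧ (i = 0 → (⟨u a, ψ a⟩ : G.Jet) = φ a) := by
  obtain ⟨n, s, hn, h0, hb, hs⟩ := hψ
  have hlt : ∀ i < n, s i < s (i + 1) := fun i hi => (hs i hi).1
  have hIcc : ∀ i < n, Icc (s i) (s (i + 1)) ⊆ Icc a b := by
    intro i hi
    rw [← h0, ← hb]
    exact Icc_subset_Icc
      (subdivision_le (fun j hj => hlt j (hj.trans hi)) (Nat.zero_le i)) (subdivision_le hlt hi)
  suffices h : ∀ k ≤ n, ∃ P : ℝ → E ≃L[ℝ] E, ∀ i < k, ∃ (φ : ℝ → G.Jet) (P' : ℝ → E ≃L[ℝ] E),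
      IsFramedPiece u ψ P (s i) (s (i + 1)) φ P' ∧ (i = 0 → (⟨u a, ψ a⟩ : G.Jet) = φ a) by
    obtain ⟨P, hP⟩ := h n le_rfl
    exact ⟨P, n, s, hn, h0, hb, hP⟩
  intro k
  induction k with
  | zero => exact fun _ => ⟨fun _ => ContinuousLinearEquiv.refl ℝ E, fun i hi => by omega⟩
  | succ k ih =>
    intro hk
    obtain ⟨P, hP⟩ := ih (by omega)
    obtain ⟨hlk, φ, hφ, heq, h0φ⟩ := hs k hk
    obtain ⟨Q, hQ⟩ := hφ.exists_parallelFrame hlk.le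
    have hbase : ∀ t ∈ Ioc (s k) (s (k + 1)), G.ν (u t) = G.base φ t := fun t ht =>
      congrArg (fun j : G.Jet => G.ν j.1) (heq ht)
    -- At the left end of the piece the jets may differ, as φ represents the curve only on the
    -- half-open interval. The base points still agree, by continuity of the base curve.
    have hbase' : ∀ t ∈ Icc (s k) (s (k + 1)), G.ν (u t) = G.base φ t := by
      have hcl : Icc (s k) (s (k + 1)) ⊆ closure (Ioc (s k) (s (k + 1))) := by
        rw [closure_Ioc hlk.ne]
      exact EqOn.of_subset_closure (f := fun t => G.ν (u t)) (g := G.base φ) hbase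
        (hc.mono (hIcc k hk))
        (fun t ht => (hQ.contMDiffAt_base ht).continuousAt.continuousWithinAt) Ioc_subset_Icc_self hcl
    -- This matches the new frame to the old one at the break point, where the equation changes
    -- abruptly but its solution must stay continuous.
    let C : E ≃L[ℝ] E := (P (s k)).trans (Q (s k)).symm
    refine ⟨fun t => if t ≤ s k then P t else C.trans (Q t), fun i hi => ?_⟩
    rcases Nat.lt_succ_iff_lt_or_eq.1 hi with hik | rfl
    · obtain ⟨φ', P', hf, h0'⟩ := hP i hik
      refine ⟨φ', P', ⟨hf.lt, hf.admissible, hf.jet_eq, hf.base_eq, hf.frame, ?_⟩, h0'⟩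
      intro t ht
      have hle : t ≤ s k := ht.2.trans
        (subdivision_le (fun j hj => hlt j (by omega)) hik)
      rw [if_pos hle, hf.frame_eq t ht]
    · refine ⟨φ, fun t => C.trans (Q t), ⟨hlk, hφ, heq, hbase', hQ.compConst C, ?_⟩, ?_⟩
      · intro t ht
        by_cases hle : t ≤ s i
        · have : t = s i := le_antisymm hle ht.1
          rw [if_pos hle, this]
          ext v
          simp [C]
        · rw [if_neg hle]
      · rintro rfl
        exact h0φ rfl

end ParallelFrames

section Components

/-! ### The variational equation in components -/

/-- The linear map of a jet is a right inverse of Tν, so the base component of T(𝐓 ∘ ρ)(Tσ v) is v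
itself. The involution exchanges this component with the fibre point 𝐓(ρ(u)). -/
theorem controlLift_eq (j : G.Jet) (v : TangentSpace I (G.ν j.1)) [IU.Boundaryless] :
    G.controlLift j v =
      ⟨⟨G.ν j.1, v⟩, ((G.vel j.1, G.velDeriv j.1 (j.lin v)) : E × E)⟩ := by
  have h := mfderiv_tangent_apply (J := IU) (j.lin v : EU) (G.contMDiff_velocity j.1)
  have h2 : (mfderiv IU I G.ν j.1 (j.lin v) : E) = v := congrArg (fun A => (A v : E)) j.2.2
  have h1 : ((mfderiv IU I.tangent G.velocity j.1 (j.lin v) : E × E)) =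
      (v, G.velDeriv j.1 (j.lin v)) := h.trans (Prod.ext h2 rfl)
  unfold controlLift canonicalInvolution tangentMap
  have e1 : ((mfderiv IU I.tangent G.velocity j.1 (j.lin v) : E × E)).1 = v := by rw [h1]
  have e2 : ((mfderiv IU I.tangent G.velocity j.1 (j.lin v) : E × E)).2 =
    G.velDeriv j.1 (j.lin v) := by rw [h1]
  have key : ∀ (x : M) (p q f : E) (g g' : E), p = q → g = g' →
      (⟨⟨x, p⟩, ((f, g) : E × E)⟩ : TangentBundle I.tangent (TangentBundle I M)) =
        ⟨⟨x, q⟩, ((f, g') : E × E)⟩ := by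
    rintro x p q f g g' rfl rfl
    rfl
  exact key _ _ _ _ _ _ e1 e2

/-- This separates the equation in TTM into a condition on the velocity of the base curve and a
linear equation for the coordinates of the field, both from the left. -/
theorem transport_iff [IU.Boundaryless] (u : ℝ → U) (ψ : ∀ t, G.JetFibre (u t))
    (X : ∀ t, TangentSpace I (G.ν (u t))) (t : ℝ) :
    (MDifferentiableWithinAt 𝓘(ℝ, ℝ) I.tangent
        (fun r => (⟨G.ν (u r), X r⟩ : TangentBundle I M)) (Iic t) t ∧
      tangentMapWithin 𝓘(ℝ, ℝ) I.tangent
        (fun r => (⟨G.ν (u r), X r⟩ : TangentBundle I M)) (Iic t) ⟨t, (1 : ℝ)⟩ =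
        G.controlLift ⟨u t, ψ t⟩ (X t)) ↔
    ContinuousWithinAt (fun r => G.ν (u r)) (Iic t) t ∧
      HasDerivWithinAt (fun r => extChartAt I (G.ν (u t)) (G.ν (u r))) (G.vel (u t) : E)
        (Iic t) t ∧
      HasDerivWithinAt (fun r => chartDiff I (G.ν (u t)) (G.ν (u r)) (X r))
        (G.velDeriv (u t) ((ψ t).1 (X t))) (Iic t) t := by
  refine Iff.trans ?_ (mfderivWithin_tangent_iff (I := I) (c := fun r => G.ν (u r)) (X := X)
    (uniqueDiffOn_Iic t t self_mem_Iic) _ _)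
  refine and_congr_right fun _ => ?_
  rw [controlLift_eq]
  constructor
  · intro h
    exact eq_of_heq (Bundle.TotalSpace.ext_iff.1 h).2
  · intro h
    exact Bundle.TotalSpace.ext rfl (heq_of_eq h)

/-! ### Local sections and the maximum condition -/

theorem velAt_eq {m : M} (z : U) (h : G.ν z = m) : (G.velAt z h : E) = G.vel z := by
  subst h
  rfl

theorem velCoord_of_eq {m : M} {z : U} (h : G.ν z = m) : G.velCoord m z = (G.vel z : E) := by
  subst h
  exact chartDiff_self _ _

/-- Freeze the fibre coordinate of the point in a local trivialisation. Fields of the family 𝒟 can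
therefore take the velocity of any prescribed point of the fibre as value. -/
theorem exists_localSection (z : U) : ∃ (W : Set M) (σ : M → U), IsOpen W ∧ G.ν z ∈ W ∧
    ContMDiffOn I IU ∞ σ W ∧ (∀ m ∈ W, G.ν (σ m) = m) ∧ σ (G.ν z) = z := by
  obtain ⟨W, hW, hz, f, χ, -, hχ, h1, h2⟩ := G.bundle_ν.locally_trivial (G.ν z)
  refine ⟨W, fun m => χ (m, f z), hW, hz, ?_, fun m hm => (h1 m hm _).1, h2 z hz⟩
  exact hχ.comp (contMDiff_id.prodMk contMDiff_const).contMDiffOn (fun m hm => ⟨hm, mem_univ _⟩)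

/-- At a maximum of `u' ↦ ⟨p, 𝐓 (ρ u')⟩` on a fibre of `ν`, the derivative of this function in the
direction of the fibre vanishes. -/
theorem velDeriv_eq_zero_of_max [I.Boundaryless] [IU.Boundaryless] (z : U) (p : E →L[ℝ] ℝ)
    (hp : ∀ z', G.ν z' = G.ν z → p (G.vel z' : E) ≤ p (G.vel z : E)) (w : EU)
    (hw : G.projDeriv z w = 0) : p (G.velDeriv z w) = 0 := by
  obtain ⟨W, hW, hz, f, χ, hf, hχ, h1, h2⟩ := G.bundle_ν.locally_trivial (G.ν z)
  obtain ⟨γ, rfl, ⟨Z, hZ, h0, hγ⟩, rfl⟩ := exists_curve_with_velocity (I := IU) z w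
  have hγ0 := (hγ.contMDiffAt (hZ.mem_nhds h0)).mdifferentiableAt (by simp)
  have hWU : G.ν ⁻¹' W ∈ 𝓝 (γ 0) := (hW.preimage G.contMDiff_ν.continuous).mem_nhds hz
  have hfγ : MDifferentiableAt IU IF f (γ 0) := (hf.contMDiffAt hWU).mdifferentiableAt (by simp)
  have hχγ : MDifferentiableAt (I.prod IF) IU χ (G.ν (γ 0), f (γ 0)) :=
    (hχ.contMDiffAt ((hW.prod isOpen_univ).mem_nhds ⟨hz, mem_univ _⟩)).mdifferentiableAt (by simp)
  have hν : MDifferentiableAt IU I G.ν (γ 0) := G.contMDiff_ν.mdifferentiableAt (by simp)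
  -- the retraction onto the fibre has the identity as differential on vertical vectors
  let ret : U → U := fun y => χ (G.ν (γ 0), f y)
  have hret0 : ret (γ 0) = γ 0 := h2 _ hz
  have hpair : MDifferentiableAt IU (I.prod IF) (fun y => (G.ν (γ 0), f y)) (γ 0) :=
    mdifferentiableAt_const.prodMk hfγ
  have hpair' : MDifferentiableAt IU (I.prod IF) (fun y => (G.ν y, f y)) (γ 0) := hν.prodMk hfγ
  have hret : MDifferentiableAt IU IU ret (γ 0) :=
    MDifferentiableAt.comp (I' := I.prod IF) (γ 0) hχγ hpair
  have hv : (mfderiv IU IU ret (γ 0) (mfderiv 𝓘(ℝ, ℝ) IU γ 0 (1 : ℝ)) : EU) =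
      mfderiv 𝓘(ℝ, ℝ) IU γ 0 (1 : ℝ) := by
    set w' : EU := mfderiv 𝓘(ℝ, ℝ) IU γ 0 (1 : ℝ) with hw'
    -- The map χ ∘ (ν, f) is the identity near the point. Freezing its first argument does not alter
    -- the differential on w, because Tν w = 0.
    have e1 := mfderiv_comp (I' := I.prod IF) (γ 0) hχγ hpair
    have e2 := mfderiv_comp (I' := I.prod IF) (γ 0) hχγ hpair'
    have e3 : mfderiv IU IU (χ ∘ fun y => (G.ν y, f y)) (γ 0) = mfderiv IU IU id (γ 0) := by
      refine Filter.EventuallyEq.mfderiv_eq ?_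
      filter_upwards [hWU] with y hy using h2 y hy
    rw [e2, mfderiv_id, mfderiv_prodMk hν hfγ] at e3
    rw [mfderiv_prodMk mdifferentiableAt_const hfγ, mfderiv_const] at e1
    have e1' := congrArg (fun A => (A w' : EU)) e1
    have e3' := congrArg (fun A => (A w' : EU)) e3
    refine e1'.trans (Eq.trans ?_ e3')
    have hw0 : (mfderiv IU I G.ν (γ 0) w' : E) = 0 := hw
    change (mfderiv (I.prod IF) IU χ (G.ν (γ 0), f (γ 0))) ((0 : E), mfderiv IU IF f (γ 0) w') =
      (mfderiv (I.prod IF) IU χ (G.ν (γ 0), f (γ 0)))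
        ((mfderiv IU I G.ν (γ 0) w' : E), mfderiv IU IF f (γ 0) w')
    rw [hw0]
    rfl
  have hretγ : MDifferentiableAt 𝓘(ℝ, ℝ) IU (fun r => ret (γ r)) 0 := hret.comp 0 hγ0
  have hk : MDifferentiableAt IU 𝓘(ℝ, E) (G.velCoord (G.ν (γ 0))) (ret (γ 0)) := by
    rw [hret0]
    exact ((G.contMDiffOn_velCoord _).contMDiffAt ((G.isOpen_preimage_source _).mem_nhds
      (mem_extChartAt_source (G.ν (γ 0))))).mdifferentiableAt (by simp)
  have d := hasDerivAt_comp_curve (k := G.velCoord (G.ν (γ 0))) (γ := fun r => ret (γ r)) hk hretγ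
  have e : (mfderiv 𝓘(ℝ, ℝ) IU (fun r => ret (γ r)) 0 (1 : ℝ) : EU) =
      mfderiv 𝓘(ℝ, ℝ) IU γ 0 (1 : ℝ) :=
    (congrArg (fun A => (A (1 : ℝ) : EU)) (mfderiv_comp (I' := IU) (0 : ℝ) hret hγ0)).trans hv
  rw [e, hret0] at d
  have d' := p.hasFDerivAt.comp_hasDerivAt (0 : ℝ) d
  -- The retracted curve stays in the fibre, where the pairing has its maximum at time 0; the
  -- conclusion is Fermat's criterion.
  have hmax : IsLocalMax (p ∘ fun r => G.velCoord (G.ν (γ 0)) (ret (γ r))) 0 := by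
    refine Filter.Eventually.of_forall fun r => ?_
    have hr : ∀ y, G.ν (ret y) = G.ν (γ 0) := fun y => (h1 _ hz _).1
    change p (G.velCoord _ (ret (γ r))) ≤ p (G.velCoord _ (ret (γ 0)))
    rw [velCoord_of_eq (hr _), velCoord_of_eq (hr _), hret0]
    exact hp _ (hr _)
  exact hmax.hasDerivAt_eq_zero d'

end Components

section FramedPaths

/-! ### Subdivisions -/

theorem eq_of_subdivision {A : Type*} {f : ℝ → A} {s : ℕ → ℝ} {n : ℕ}
    (hs : ∀ i < n, s i < s (i + 1))
    (hf : ∀ i < n, ∀ t ∈ Icc (s i) (s (i + 1)), f t = f (s (i + 1))) :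
    ∀ t ∈ Icc (s 0) (s n), f t = f (s n) := by
  induction n with
  | zero => intro t ht; rw [le_antisymm ht.2 ht.1]
  | succ n ih =>
    intro t ht
    rcases le_or_gt t (s n) with h | h
    · rw [ih (fun i hi => hs i (by omega)) (fun i hi => hf i (by omega)) t ⟨ht.1, h⟩]
      exact hf n n.lt_succ_self _ ⟨le_rfl, (hs n n.lt_succ_self).le⟩
    · exact hf n n.lt_succ_self t ⟨h.le, ht.2⟩

theorem continuousOn_of_subdivision {A : Type*} [TopologicalSpace A] {f : ℝ → A} {s : ℕ → ℝ}
    {n : ℕ} (hs : ∀ i < n, s i < s (i + 1))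
    (hf : ∀ i < n, ContinuousOn f (Icc (s i) (s (i + 1)))) :
    ContinuousOn f (Icc (s 0) (s n)) := by
  induction n with
  | zero => rw [Icc_self]; exact continuousOn_singleton f _
  | succ n ih =>
    have h1 := ih (fun i hi => hs i (by omega)) (fun i hi => hf i (by omega))
    rw [← Icc_union_Icc_eq_Icc (subdivision_le (fun i hi => hs i (by omega)) (Nat.zero_le n))
      (hs n n.lt_succ_self).le]
    exact h1.union_of_isClosed (hf n n.lt_succ_self) isClosed_Icc isClosed_Icc

theorem exists_mem_subdivision {s : ℕ → ℝ} {n : ℕ} {t : ℝ} (ht : t ∈ Ioc (s 0) (s n)) :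
    ∃ i < n, t ∈ Ioc (s i) (s (i + 1)) := by
  induction n with
  | zero => exact absurd ht (by simp)
  | succ n ih =>
    rcases le_or_gt t (s n) with h | h
    · obtain ⟨i, hi, hti⟩ := ih ⟨ht.1, h⟩
      exact ⟨i, by omega, hti⟩
    · exact ⟨n, n.lt_succ_self, h, ht.2⟩

/-! ### Framed paths and the transport that they define. -/

/-- A frame along the base curve of a piecewise admissible curve which is parallel on its pieces. -/
def IsFramedPath (u : ℝ → U) (ψ : ∀ t, G.JetFibre (u t)) (P : ℝ → E ≃L[ℝ] E) (n : ℕ)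
    (s : ℕ → ℝ) : Prop :=
  0 < n ∧ ∀ i < n, ∃ (φ : ℝ → G.Jet) (P' : ℝ → E ≃L[ℝ] E),
    IsFramedPiece u ψ P (s i) (s (i + 1)) φ P' ∧ (i = 0 → (⟨u (s 0), ψ (s 0)⟩ : G.Jet) = φ (s 0))

/-- The differential of `τ`. -/
def timeForm (G : GeometricControlStructure I M IU U IQ Q IF F) (m : M) : E →L[ℝ] ℝ :=
  diff I G.τ m

theorem timeForm_vel (z : U) : G.timeForm (G.ν z) (G.vel z) = 1 := (G.ρ z).2

theorem contMDiff_τ : ContMDiff I 𝓘(ℝ, ℝ) ∞ G.τ := G.bundle_τ.smooth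

/-- The vertical component of the control lift at the jet `j`. -/
def jetRate (j : G.Jet) (v : E) : E := G.velDeriv j.1 (j.lin v)

section Piece

variable {u : ℝ → U} {ψ : ∀ t, G.JetFibre (u t)} {P P' : ℝ → E ≃L[ℝ] E} {α β : ℝ} {φ : ℝ → G.Jet}

theorem IsFramedPiece.control_eq (h : IsFramedPiece u ψ P α β φ P') {t : ℝ} (ht : t ∈ Ioc α β) :
    u t = (φ t).1 :=
  congrArg (fun j : G.Jet => j.1) (h.jet_eq t ht)

variable [I.Boundaryless] [IU.Boundaryless]

omit [I.Boundaryless] [IU.Boundaryless] in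
-- Small left neighbourhoods of a point of ]α, β] remain in the piece, where base curve and frame
-- coincide with smooth ones. Left derivatives are therefore inherited, including at the right end
-- point, where the next piece may differ.
theorem IsFramedPiece.variational (h : IsFramedPiece u ψ P α β φ P') {t : ℝ} (ht : t ∈ Ioc α β)
    (v : E) :
    ContinuousWithinAt (fun r => G.ν (u r)) (Iic t) t ∧
      HasDerivWithinAt (fun r => extChartAt I (G.ν (u t)) (G.ν (u r))) (G.vel (u t) : E)
        (Iic t) t ∧
      HasDerivWithinAt (fun r => chartDiff I (G.ν (u t)) (G.ν (u r)) (P r v))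
        (jetRate (⟨u t, ψ t⟩ : G.Jet) (P t v)) (Iic t) t := by
  have htI := Ioc_subset_Icc_self ht
  have hev : ∀ᶠ r in 𝓝[Iic t] t, r ∈ Icc α β := by
    filter_upwards [Ioc_mem_nhdsLE ht.1] with r hr using ⟨hr.1.le, hr.2.trans ht.2⟩
  have hb := h.base_eq t htI
  have hv : (G.vel (u t) : E) = G.vel (φ t).1 := by rw [h.control_eq ht]
  have hd : jetRate (⟨u t, ψ t⟩ : G.Jet) (P t v) = jetRate (φ t) (P t v) := by rw [h.jet_eq t ht]
  have hm := mem_extChartAt_source (I := I) (G.base φ t)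
  refine ⟨?_, ?_, ?_⟩
  · refine ((h.frame.contMDiffAt_base htI).continuousAt.continuousWithinAt).congr_of_eventuallyEq
      ?_ hb
    filter_upwards [hev] with r hr using h.base_eq r hr
  · rw [hv, hb]
    have e := (h.admissible.hasDerivAt_base htI hm).hasDerivWithinAt (s := Iic t)
    have e2 : chartDiff I (G.base φ t) (G.base φ t) (G.vel (φ t).1) = (G.vel (φ t).1 : E) :=
      chartDiff_self _ _
    rw [e2] at e
    refine e.congr_of_eventuallyEq ?_ (by rw [hb])
    filter_upwards [hev] with r hr
    rw [h.base_eq r hr]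
  · rw [hd, hb, h.frame_eq t htI]
    have e := ((h.frame.2 t htI).clm_apply (hasDerivAt_const t v)).hasDerivWithinAt (s := Iic t)
    rw [map_zero, add_zero] at e
    refine e.congr_of_eventuallyEq ?_ (by rw [hb, h.frame_eq t htI]; rfl)
    filter_upwards [hev] with r hr
    rw [h.base_eq r hr, h.frame_eq r hr]
    rfl

omit [I.Boundaryless] in
theorem IsFramedPiece.transport (h : IsFramedPiece u ψ P α β φ P') {t : ℝ} (ht : t ∈ Ioc α β)
    (v : E) :
    MDifferentiableWithinAt 𝓘(ℝ, ℝ) I.tangent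
        (fun r => (⟨G.ν (u r), P r v⟩ : TangentBundle I M)) (Iic t) t ∧
      tangentMapWithin 𝓘(ℝ, ℝ) I.tangent
        (fun r => (⟨G.ν (u r), P r v⟩ : TangentBundle I M)) (Iic t) ⟨t, (1 : ℝ)⟩ =
        G.controlLift ⟨u t, ψ t⟩ (P t v : E) :=
  (transport_iff u ψ (fun r => P r v) t).2 (h.variational ht v)

omit [I.Boundaryless] [IU.Boundaryless] in
theorem IsFramedPiece.continuousOn (h : IsFramedPiece u ψ P α β φ P') (v : E) :
    ContinuousOn (fun r => (⟨G.ν (u r), P r v⟩ : TangentBundle I M)) (Icc α β) := by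
  have h1 : ContinuousOn (fun r => (⟨G.base φ r, P' r v⟩ : TangentBundle I M)) (Icc α β) := by
    intro t ht
    rw [continuousWithinAt_tangent_iff]
    refine ⟨(h.frame.contMDiffAt_base ht).continuousAt.continuousWithinAt, ?_⟩
    exact (((h.frame.2 t ht).clm_apply (hasDerivAt_const t v)).continuousAt).continuousWithinAt
  refine h1.congr fun t ht => ?_
  rw [h.base_eq t ht, h.frame_eq t ht]

/-- Parallel transport preserves `dτ`. -/
theorem IsFramedPiece.timeForm_eq (h : IsFramedPiece u ψ P α β φ P') (v : E) {t : ℝ}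
    (ht : t ∈ Icc α β) :
    G.timeForm (G.ν (u t)) (P t v) = G.timeForm (G.ν (u β)) (P β v) := by
  have hd : ∀ t ∈ Icc α β, HasDerivAt (fun r => G.timeForm (G.base φ r) (P' r v)) 0 t := by
    intro t ht
    have hm := mem_extChartAt_source (I := I) (G.base φ t)
    have e := ((h.frame.2 t ht).clm_apply (hasDerivAt_const t v))
    rw [map_zero, add_zero] at e
    have h1 := hasDerivWithinAt_diff_of_chart (J := IU) (s := univ) (c := G.base φ)
      (X := fun r => P' r v) (ν := G.ν) (f := G.vel) (x := (φ t).1) (w := G.jetLin φ t (P' t v))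
      (m₀ := G.base φ t) rfl (G.contMDiff_velocity _) (G.projDeriv_jetLin φ t (P' t v))
      Filter.univ_mem G.contMDiff_τ.contMDiffOn hm
      (h.frame.contMDiffAt_base ht).continuousAt.continuousWithinAt
      (h.admissible.hasDerivAt_base ht hm).hasDerivWithinAt e.hasDerivWithinAt
    rw [hasDerivWithinAt_univ] at h1
    refine h1.congr_deriv ?_
    -- The derivative of ⟨dτ, P v⟩ is that of dτ(𝐓 ∘ ρ) in some direction of U, and this function is
    -- constant because the velocities are jets of sections of τ.
    have e1 : (fun z => diff I G.τ (G.ν z) (G.vel z)) = fun _ => (1 : ℝ) :=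
      funext fun z => timeForm_vel z
    rw [e1, diff, mfderiv_const]
    rfl
  have hconst := constant_of_has_deriv_right_zero
    (fun r hr => (hd r hr).continuousAt.continuousWithinAt)
    (fun r hr => (hd r ⟨hr.1, hr.2.le⟩).hasDerivWithinAt)
  have hβ : β ∈ Icc α β := ⟨h.lt.le, le_rfl⟩
  rw [h.base_eq t ht, h.frame_eq t ht, h.base_eq β hβ, h.frame_eq β hβ]
  exact (hconst t ht).trans (hconst β hβ).symm

end Piece

section Path

variable {u : ℝ → U} {ψ : ∀ t, G.JetFibre (u t)} {P : ℝ → E ≃L[ℝ] E} {n : ℕ} {s : ℕ → ℝ}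

theorem IsFramedPath.lt (h : IsFramedPath u ψ P n s) : ∀ i < n, s i < s (i + 1) := by
  intro i hi
  obtain ⟨φ, P', hp, -⟩ := h.2 i hi
  exact hp.lt

variable [I.Boundaryless] [IU.Boundaryless]

omit [I.Boundaryless] [IU.Boundaryless] in
theorem IsFramedPath.continuousOn (h : IsFramedPath u ψ P n s) (v : E) :
    ContinuousOn (fun r => (⟨G.ν (u r), P r v⟩ : TangentBundle I M)) (Icc (s 0) (s n)) := by
  refine continuousOn_of_subdivision h.lt fun i hi => ?_
  obtain ⟨φ, P', hp, -⟩ := h.2 i hi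
  exact hp.continuousOn v

theorem IsFramedPath.timeForm_eq (h : IsFramedPath u ψ P n s) (v : E) {t : ℝ}
    (ht : t ∈ Icc (s 0) (s n)) :
    G.timeForm (G.ν (u t)) (P t v) = G.timeForm (G.ν (u (s n))) (P (s n) v) :=
  eq_of_subdivision (f := fun t => G.timeForm (G.ν (u t)) (P t v)) h.lt (fun i hi t ht => by
    obtain ⟨φ, P', hp, -⟩ := h.2 i hi
    exact hp.timeForm_eq v ht) t ht

/-- Existence of the transport. -/
theorem IsFramedPath.isTransport (h : IsFramedPath u ψ P n s) {t : ℝ} (ht : t ∈ Icc (s 0) (s n))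
    (v : G.Vert (G.ν (u t))) (w : G.Vert (G.ν (u (s n))))
    (hw : (w.1 : E) = P (s n) ((P t).symm v.1)) : G.IsTransport u ψ t (s n) v w := by
  classical
  -- Frames carry vertical vectors to vertical vectors, since the pairing with dτ is constant along
  -- the path.
  have hmem : ∀ r ∈ Icc t (s n), (P r ((P t).symm v.1) : E) ∈ G.Vert (G.ν (u r)) := by
    intro r hr
    have h1 := h.timeForm_eq ((P t).symm v.1) (t := r) ⟨ht.1.trans hr.1, hr.2⟩
    have h2 := h.timeForm_eq ((P t).symm v.1) ht
    have e : P t ((P t).symm (v.1 : E)) = v.1 := (P t).apply_symm_apply _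
    have h3 : G.timeForm (G.ν (u t)) v.1 = 0 := v.2
    exact h1.trans (h2.symm.trans ((congrArg (G.timeForm (G.ν (u t))) e).trans h3))
  -- The value 0 occurs only outside [t, s n], where verticality is not known. A left derivative at
  -- r > t does not see these times.
  let X : ∀ r, G.Vert (G.ν (u r)) := fun r =>
    if hr : (P r ((P t).symm v.1) : E) ∈ G.Vert (G.ν (u r)) then ⟨_, hr⟩ else 0
  have hX : ∀ r ∈ Icc t (s n), ((X r).1 : E) = P r ((P t).symm v.1) := by
    intro r hr
    simp only [X, dif_pos (hmem r hr)]
    rfl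
  have hX' : ∀ r ∈ Icc t (s n), (⟨G.ν (u r), (X r).1⟩ : TangentBundle I M) =
      ⟨G.ν (u r), P r ((P t).symm v.1)⟩ := by
    intro r hr
    exact congrArg (fun y : E => (⟨G.ν (u r), y⟩ : TangentBundle I M)) (hX r hr)
  refine ⟨X, ?_, ?_, ?_, ?_⟩
  · refine ((h.continuousOn ((P t).symm v.1)).mono (Icc_subset_Icc_left ht.1)).congr hX'
  · refine Subtype.ext ((hX t ⟨le_rfl, ht.2⟩).trans ?_)
    exact (P t).apply_symm_apply v.1
  · exact Subtype.ext ((hX _ ⟨ht.2, le_rfl⟩).trans hw.symm)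
  · intro r hr
    obtain ⟨i, hi, hri⟩ := exists_mem_subdivision (⟨ht.1.trans_lt hr.1, hr.2⟩ : r ∈ Ioc (s 0) (s n))
    obtain ⟨φ, P', hp, -⟩ := h.2 i hi
    obtain ⟨h1, h2⟩ := hp.transport hri ((P t).symm v.1)
    have hev : (fun r => (⟨G.ν (u r), (X r).1⟩ : TangentBundle I M)) =ᶠ[𝓝[Iic r] r]
        fun r => ⟨G.ν (u r), P r ((P t).symm v.1)⟩ := by
      filter_upwards [Ioc_mem_nhdsLE hr.1] with r' hr'
      exact hX' r' ⟨hr'.1.le, hr'.2.trans hr.2⟩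
    have hr' := hX' r (Ioc_subset_Icc_self hr)
    refine ⟨h1.congr_of_eventuallyEq hev hr', ?_⟩
    have e1 : tangentMapWithin 𝓘(ℝ, ℝ) I.tangent
        (fun r => (⟨G.ν (u r), (X r).1⟩ : TangentBundle I M)) (Iic r) ⟨r, (1 : ℝ)⟩ =
        tangentMapWithin 𝓘(ℝ, ℝ) I.tangent
        (fun r => (⟨G.ν (u r), P r ((P t).symm v.1)⟩ : TangentBundle I M)) (Iic r) ⟨r, (1 : ℝ)⟩ := by
      refine Bundle.TotalSpace.ext hr' (heq_of_eq ?_)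
      exact congrArg (fun A : ℝ →L[ℝ] E × E => A 1) (hev.mfderivWithin_eq hr')
    rw [e1, h2]
    exact congrArg (fun y : E => G.controlLift ⟨u r, ψ r⟩ y) (hX r (Ioc_subset_Icc_self hr)).symm

end Path

end FramedPaths

section ParallelCovectors

/-! ### Parallel covectors -/

/-- Inversion is smooth on the invertible operators, so the inverse frames, and with them the
transported covectors, are as smooth as the frames. -/
theorem _root_.FrameSmoothAt.contMDiffAt_coframe {c : ℝ → M} {P : ℝ → E ≃L[ℝ] E} {t : ℝ}
    [CompleteSpace E] (h : FrameSmoothAt I c P t) (hc : ContMDiffAt 𝓘(ℝ, ℝ) I ∞ c t)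
    (γ : E →L[ℝ] ℝ) :
    ContMDiffAt 𝓘(ℝ, ℝ) (I.prod 𝓘(ℝ, E →L[ℝ] ℝ)) ∞
      (fun r => CotangentBundle.mk I (c r) (γ.comp ((P r).symm : E →L[ℝ] E))) t := by
  refine contMDiffAt_cotangent_iff.2 ⟨hc, ?_⟩
  rw [contMDiffAt_iff_contDiffAt]
  have hm := mem_extChartAt_source (I := I) (c t)
  obtain ⟨x, hx⟩ := isUnit_chartDiff_comp hm (P t)
  have h1 : ContDiffAt ℝ ∞ Ring.inverse ((chartDiff I (c t) (c t)).comp (P t : E →L[ℝ] E)) :=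
    hx ▸ contDiffAt_ringInverse ℝ x
  refine (contDiffAt_const (c := γ)).clm_comp (h1.comp t h) |>.congr_of_eventuallyEq ?_
  filter_upwards [hc.continuousAt.eventually ((isOpen_extChartAt_source (I := I) _).mem_nhds hm)]
    with r hr
  rw [Function.comp_apply, ringInverse_chartDiff_comp hr]
  rfl

section Piece

variable {u : ℝ → U} {ψ : ∀ t, G.JetFibre (u t)} {P P' : ℝ → E ≃L[ℝ] E} {α β : ℝ} {φ : ℝ → G.Jet}

theorem IsParallelFrame.continuousOn_section (h : G.IsParallelFrame φ P' α β) {σ : M → U}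
    {W : Set M} (hW : IsOpen W) (hσ : ContMDiffOn I IU ∞ σ W) (hν : ∀ m ∈ W, G.ν (σ m) = m)
    {t : ℝ} (ht : t ∈ Icc α β) (hm : G.base φ t ∈ W) :
    ContinuousAt (fun r => (⟨G.base φ r, G.vel (σ (G.base φ r))⟩ : TangentBundle I M)) t := by
  have hb := (h.contMDiffAt_base ht).continuousAt
  have h1 : ContinuousAt (fun r => G.velocity (σ (G.base φ r))) t :=
    ContinuousAt.comp (g := G.velocity) G.smooth_ρ.continuous.continuousAt
      (ContinuousAt.comp (f := G.base φ) ((hσ.contMDiffAt (hW.mem_nhds hm)).continuousAt) hb)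
  refine h1.congr ?_
  filter_upwards [hb.eventually (hW.mem_nhds hm)] with r hr
  have e := hν _ hr
  change (⟨G.ν (σ (G.base φ r)), G.vel (σ (G.base φ r))⟩ : TangentBundle I M) = _
  exact Bundle.TotalSpace.ext e HEq.rfl

/-- The maximum condition extends to the closed interval. -/
theorem IsFramedPiece.max_of_forall_Ioc [CompleteSpace E] (h : IsFramedPiece u ψ P α β φ P')
    (γ : E →L[ℝ] ℝ)
    (hmax : ∀ t ∈ Ioc α β, ∀ z, G.ν z = G.ν (u t) →
      γ ((P t).symm (G.vel z : E)) ≤ γ ((P t).symm (G.vel (u t) : E)))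
    {t : ℝ} (ht : t ∈ Icc α β) (z : U) (hz : G.ν z = G.base φ t) :
    γ ((P' t).symm (G.vel z : E)) ≤ γ ((P' t).symm (G.vel (φ t).1 : E)) := by
  have hIoc : ∀ t ∈ Ioc α β, ∀ z, G.ν z = G.base φ t →
      γ ((P' t).symm (G.vel z : E)) ≤ γ ((P' t).symm (G.vel (φ t).1 : E)) := by
    intro t ht z hz
    have e := hmax t ht z (hz.trans (h.base_eq t (Ioc_subset_Icc_self ht)).symm)
    have e2 : (G.vel (u t) : E) = G.vel (φ t).1 := by rw [h.control_eq ht]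
    rwa [e2, h.frame_eq t (Ioc_subset_Icc_self ht)] at e
  rcases eq_or_lt_of_le ht.1 with h0 | h0
  swap
  · exact hIoc t ⟨h0, ht.2⟩ z hz
  subst h0
  -- At the left end the inequality is the limit from the right of the inequalities along a section
  -- through `z`. The limit on the other side is the velocity of φ, which may differ there from that
  -- of u.
  obtain ⟨W, σ, hW, hzW, hσ, hν, hσz⟩ := G.exists_localSection z
  rw [hz] at hzW hσz
  have hcov := ((h.frame.frameSmoothAt ht).contMDiffAt_coframe (h.frame.contMDiffAt_base ht)
    γ).continuousAt
  have hv := h.frame.continuousOn_section hW hσ hν ht hzW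
  obtain ⟨⟨O, hO, hsub, hs, -⟩, -⟩ := h.frame
  have hv' : ContinuousAt (fun r => (⟨G.base φ r, G.vel (φ r).1⟩ : TangentBundle I M)) α :=
    ContinuousAt.comp (f := fun r => (φ r).1) G.smooth_ρ.continuous.continuousAt
      (hs.continuousOn.continuousAt (hO.mem_nhds (hsub ht)))
  have l1 := (continuousWithinAt_pairing hcov.continuousWithinAt
    (hv.continuousWithinAt (s := Ioi α)))
  have l2 := (continuousWithinAt_pairing hcov.continuousWithinAt
    (hv'.continuousWithinAt (s := Ioi α)))
  have hfin := le_of_tendsto_of_tendsto l1.tendsto l2.tendsto (by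
    have hb := (h.frame.contMDiffAt_base ht).continuousAt
    filter_upwards [Ioc_mem_nhdsGT h.lt, (hb.eventually (hW.mem_nhds hzW)).filter_mono
      nhdsWithin_le_nhds] with r hr hr'
    exact hIoc r hr _ (hν _ hr'))
  have e : (G.vel (σ (G.base φ α)) : E) = G.vel z := by rw [hσz]
  rw [e] at hfin
  exact hfin

/-- The adjoint equation. -/
theorem IsFramedPiece.hasDerivAt_coframe [CompleteSpace E] (h : IsFramedPiece u ψ P α β φ P')
    (γ : E →L[ℝ] ℝ) {t : ℝ} (ht : t ∈ Icc α β) :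
    HasDerivAt (fun r => (γ.comp ((P' r).symm : E →L[ℝ] E)).comp
        (chartDiffInv I (G.base φ t) (G.base φ r)))
      (-((γ.comp ((P' t).symm : E →L[ℝ] E)).comp
        ((G.velDeriv (φ t).1).comp (G.jetLin φ t)))) t := by
  have hm := mem_extChartAt_source (I := I) (G.base φ t)
  have h1 := hasDerivAt_ringInverse_comp (h.frame.2 t ht) (isUnit_chartDiff_comp hm (P' t))
  rw [ringInverse_chartDiff_comp hm] at h1
  have h2 := (hasDerivAt_const t γ).clm_comp h1
  refine (h2.congr_of_eventuallyEq ?_).congr_deriv ?_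
  · filter_upwards [(h.frame.contMDiffAt_base ht).continuousAt.eventually
      ((isOpen_extChartAt_source (I := I) _).mem_nhds hm)] with r hr
    rw [ringInverse_chartDiff_comp hr]
    rfl
  · have e : chartDiffInv I (G.base φ t) (G.base φ t) = ContinuousLinearMap.id ℝ E := by
      ext v; exact chartDiffInv_self _ v
    rw [e]
    ext v
    simp [ContinuousLinearMap.mul_def]

/-- In the presence of the maximum condition the adjoint equation does not involve the jet. -/
theorem coframe_adjoint [I.Boundaryless] [IU.Boundaryless] {t : ℝ} (p : E →L[ℝ] ℝ)
    (hmax : ∀ z, G.ν z = G.base φ t → p (G.vel z : E) ≤ p (G.vel (φ t).1 : E)) (w : EU) :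
    (-(p.comp ((G.velDeriv (φ t).1).comp (G.jetLin φ t)))) (G.projDeriv (φ t).1 w) +
      p (G.velDeriv (φ t).1 w) = 0 := by
  -- The vector w minus the image of Tν w under the jet is vertical for ν, and the maximum condition
  -- kills the derivative on such vectors.
  have h := velDeriv_eq_zero_of_max (φ t).1 p hmax
    (w - G.jetLin φ t (G.projDeriv (φ t).1 w)) (by
      rw [map_sub, projDeriv_jetLin, sub_self])
  rw [map_sub, map_sub] at h
  simp only [neg_apply, ContinuousLinearMap.comp_apply]
  linarith

end Piece

/-- Covectors in the dual of the vertical variational cone satisfy the maximum condition. -/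
theorem IsFramedPath.max_of_mem_dualCone [I.Boundaryless] [IU.Boundaryless] {u : ℝ → U}
    {ψ : ∀ t, G.JetFibre (u t)} {P : ℝ → E ≃L[ℝ] E} {n : ℕ} {s : ℕ → ℝ}
    (h : IsFramedPath u ψ P n s) {θ : G.VertDual (G.ν (u (s n)))} {γ : E →L[ℝ] ℝ}
    (hγ : ∀ v : G.Vert (G.ν (u (s n))), θ v = γ ((P (s n)).symm (v.1 : E)))
    (hθ : θ ∈ dualCone (G.verticalCone (s 0) (s n) u ψ)) {t : ℝ} (ht : t ∈ Ioc (s 0) (s n))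
    (z : U) (hz : G.ν z = G.ν (u t)) :
    γ ((P t).symm (G.vel z : E)) ≤ γ ((P t).symm (G.vel (u t) : E)) := by
  classical
  obtain ⟨W, σ, hW, hzW, hσ, hν, hσz⟩ := G.exists_localSection z
  rw [hz] at hzW hσz
  have htI := Ioc_subset_Icc_self ht
  let x : E := G.vel z
  let y : E := G.vel (u t)
  -- Both velocities have dτ-component 1, so their difference is vertical, as is its transport to
  -- the end point.
  let d : E := x - y
  have hd : G.timeForm (G.ν (u t)) d = 0 := by
    have e : G.timeForm (G.ν (u t)) x = 1 := hz ▸ timeForm_vel z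
    have e' : G.timeForm (G.ν (u t)) y = 1 := timeForm_vel (u t)
    rw [map_sub, e, e', sub_self]
  have hw : G.timeForm (G.ν (u (s n))) (P (s n) ((P t).symm d)) = 0 := by
    rw [← h.timeForm_eq _ htI, ContinuousLinearEquiv.apply_symm_apply, hd]
  let Y : ∀ m : M, TangentSpace I m := fun m =>
    if hm : G.ν (σ m) = m then G.velAt (σ m) hm else 0
  have hY : ∀ m ∈ W, (Y m : E) = G.vel (σ m) := by
    intro m hm
    simp only [Y, dif_pos (hν m hm)]
    exact G.velAt_eq _ _
  have hmem : (⟨P (s n) ((P t).symm d), hw⟩ : G.Vert (G.ν (u (s n)))) ∈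
      G.verticalCone (s 0) (s n) u ψ := by
    -- A single generator with coefficient 1 suffices: the field of the section through `z`, taken
    -- at time t.
    refine ⟨1, fun _ => 1, fun _ => ⟨P (s n) ((P t).symm d), hw⟩, fun _ => zero_le_one,
      fun _ => ⟨t, ht, W, Y, ⟨d, hd⟩, ⟨hW, σ, hσ, fun m hm => ⟨hν m hm, ?_⟩⟩, hzW, ?_, ?_⟩, ?_⟩
    · simp only [Y, dif_pos (hν m hm)]
    · have e := hY _ hzW
      rw [hσz] at e
      exact congrArg (fun x : E => x - y) e.symm
    · exact h.isTransport htI _ _ rfl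
    · simp
  have h1 := hθ _ hmem
  rw [hγ] at h1
  have e : (P (s n)).symm (P (s n) ((P t).symm d)) = (P t).symm d :=
    ContinuousLinearEquiv.symm_apply_apply _ _
  rw [e, map_sub, map_sub] at h1
  exact sub_nonpos.1 h1

end ParallelCovectors

end GeometricControlStructure

/-- The derivative of the pairing of a curve in `T*M` with a curve in `TM`. -/
theorem hasDerivWithinAt_pairing {E : Type*} [NormedAddCommGroup E] [NormedSpace ℝ E] {H : Type*}
    [TopologicalSpace H] {I : ModelWithCorners ℝ E H} {M : Type*} [TopologicalSpace M]
    [ChartedSpace H M] [IsManifold I ∞ M] {c : ℝ → M} {p : ℝ → E →L[ℝ] ℝ} {X : ℝ → E} {s : Set ℝ}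
    {t : ℝ} {β : E →L[ℝ] ℝ} {ξ : E} (hc : ContinuousWithinAt c s t)
    (hp : HasDerivWithinAt (fun r => (p r).comp (chartDiffInv I (c t) (c r))) β s t)
    (hX : HasDerivWithinAt (fun r => chartDiff I (c t) (c r) (X r)) ξ s t) :
    HasDerivWithinAt (fun r => p r (X r)) (β (X t) + p t ξ) s t := by
  have h := eventually_mem_source (I := I) (m₀ := c t) hc (mem_extChartAt_source (c t))
  refine ((hp.clm_apply hX).congr_of_eventuallyEq ?_ ?_).congr_deriv ?_
  · filter_upwards [h] with z hz
    simp only [ContinuousLinearMap.comp_apply, chartDiffInv_chartDiff hz]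
  · simp only [ContinuousLinearMap.comp_apply, chartDiffInv_chartDiff (mem_extChartAt_source (c t))]
  · simp only [ContinuousLinearMap.comp_apply, chartDiffInv_self, chartDiff_self]

/-! ### Charts and differentials on a product with ℝ. -/

section ProductCalculus

variable {E : Type*} [NormedAddCommGroup E] [NormedSpace ℝ E] {H : Type*} [TopologicalSpace H]
  {I : ModelWithCorners ℝ E H} {M : Type*} [TopologicalSpace M] [ChartedSpace H M]
  {V : Type*} [NormedAddCommGroup V] [NormedSpace ℝ V]
  {V' : Type*} [NormedAddCommGroup V'] [NormedSpace ℝ V']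

theorem diff_comp_fst {f : M → V} {m : M} (J : ℝ) (hf : MDifferentiableAt I 𝓘(ℝ, V) f m)
    (x : E × ℝ) :
    diff (I.prod 𝓘(ℝ, ℝ)) (fun z : M × ℝ => f z.1) (m, J) x = diff I f m x.1 := by
  have h := hf.hasMFDerivAt.comp (I := I.prod 𝓘(ℝ, ℝ)) (f := Prod.fst) ((m, J) : M × ℝ)
    (hasMFDerivAt_fst _)
  exact congrArg (fun A => (A x : V)) h.mfderiv

theorem diff_snd (m : M) (J : ℝ) (x : E × ℝ) :
    diff (I.prod 𝓘(ℝ, ℝ)) (fun z : M × ℝ => z.2) (m, J) x = x.2 :=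
  congrArg (fun A => (A x : ℝ)) (hasMFDerivAt_snd (I := I) (I' := 𝓘(ℝ, ℝ)) ((m, J) : M × ℝ)).mfderiv

theorem diff_prodMk {f : M → V} {g : M → V'} {m : M} (hf : MDifferentiableAt I 𝓘(ℝ, V) f m)
    (hg : MDifferentiableAt I 𝓘(ℝ, V') g m) (x : E) :
    diff I (fun z => (f z, g z)) m x = (diff I f m x, diff I g m x) := by
  have h : HasMFDerivAt I 𝓘(ℝ, V × V') (fun z => (f z, g z)) m
      ((diff I f m).prod (diff I g m) : E →L[ℝ] V × V') :=
    ⟨hf.continuousAt.prodMk hg.continuousAt, hf.hasMFDerivAt.2.prodMk hg.hasMFDerivAt.2⟩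
  exact congrArg (fun A : E →L[ℝ] V × V' => A x) h.mfderiv

theorem extChartAt_prod_real (m y : M) (J J' : ℝ) :
    extChartAt (I.prod 𝓘(ℝ, ℝ)) (m, J) (y, J') = (extChartAt I m y, J') := by
  rw [extChartAt_prod]
  rfl

theorem mem_extChartAt_prod_real_source {m y : M} {J J' : ℝ} :
    (y, J') ∈ (extChartAt (I.prod 𝓘(ℝ, ℝ)) (m, J)).source ↔ y ∈ (extChartAt I m).source := by
  rw [extChartAt_prod]
  exact ⟨fun h => h.1, fun h => ⟨h, by
    rw [extChartAt_model_space_eq_id]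
    exact mem_univ _⟩⟩

variable [IsManifold I ∞ M]

/-- The chart of the factor ℝ is the identity, so the cost component is not affected by a change of
chart. -/
theorem chartDiff_prod {m y : M} (hy : y ∈ (extChartAt I m).source) (J J' : ℝ) (x : E × ℝ) :
    chartDiff (I.prod 𝓘(ℝ, ℝ)) (m, J) (y, J') x = (chartDiff I m y x.1, x.2) := by
  have hf : MDifferentiableAt I 𝓘(ℝ, E) (extChartAt I m) y :=
    (contMDiffAt_extChartAt' (n := ∞) (by rwa [extChartAt_source] at hy)).mdifferentiableAt
      (by simp)
  have hf' : MDifferentiableAt (I.prod 𝓘(ℝ, ℝ)) 𝓘(ℝ, E) (fun z : M × ℝ => extChartAt I m z.1)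
      (y, J') := hf.comp (I := I.prod 𝓘(ℝ, ℝ)) (f := Prod.fst) ((y, J') : M × ℝ)
        mdifferentiableAt_fst
  rw [← diff_extChartAt (mem_extChartAt_prod_real_source.2 hy)]
  have e : (extChartAt (I.prod 𝓘(ℝ, ℝ)) (m, J) : M × ℝ → E × ℝ) =
      fun z => (extChartAt I m z.1, z.2) := funext fun z => extChartAt_prod_real m z.1 J z.2
  rw [e, diff_prodMk hf' mdifferentiableAt_snd, diff_comp_fst J' hf, diff_snd, diff_extChartAt hy]

theorem chartDiffInv_prod {m y : M} (hy : y ∈ (extChartAt I m).source) (J J' : ℝ) (x : E × ℝ) :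
    chartDiffInv (I.prod 𝓘(ℝ, ℝ)) (m, J) (y, J') x = (chartDiffInv I m y x.1, x.2) := by
  have h := chartDiff_prod hy J J' (chartDiffInv I m y x.1, x.2)
  rw [chartDiff_chartDiffInv hy] at h
  rw [← chartDiffInv_chartDiff (mem_extChartAt_prod_real_source.2 hy)
    ((chartDiffInv I m y x.1, x.2) : E × ℝ), h]

end ProductCalculus

/-- Time reversal of the criterion with right derivatives. The left version is the one that fits the
transport equation at break points. -/
theorem eq_of_has_deriv_left_zero {f : ℝ → ℝ} {a b : ℝ} (hab : a ≤ b)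
    (hf : ContinuousOn f (Icc a b)) (hd : ∀ t ∈ Ioc a b, HasDerivWithinAt f 0 (Iic t) t) :
    f a = f b := by
  have h := constant_of_has_deriv_right_zero (f := fun r => f (-r)) (a := -b) (b := -a)
    (hf.comp continuous_neg.continuousOn fun r hr => ⟨by linarith [hr.2], by linarith [hr.1]⟩)
    (fun r hr => by
      have h1 := (hd (-r) ⟨by linarith [hr.2], by linarith [hr.1]⟩).scomp (h := fun r => -r) r
        (hasDerivAt_neg r).hasDerivWithinAt (s := Ici r)
        (fun y (hy : r ≤ y) => neg_le_neg hy)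
      rwa [smul_zero] at h1)
    (-a) ⟨by linarith, le_rfl⟩
  simpa only [neg_neg] using h

/-! ### Convex cones -/

section Cones

variable {V : Type*} [AddCommGroup V] [Module ℝ V]

theorem zero_mem_finiteConicCombinations (S : Set V) : 0 ∈ finiteConicCombinations S :=
  ⟨0, 0, 0, fun _ => le_rfl, fun i => i.elim0, by simp⟩

theorem smul_mem_finiteConicCombinations {S : Set V} {v : V} (hv : v ∈ finiteConicCombinations S)
    {r : ℝ} (hr : 0 ≤ r) : r • v ∈ finiteConicCombinations S := by
  obtain ⟨n, δ, w, hδ, hw, rfl⟩ := hv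
  exact ⟨n, fun i => r * δ i, w, fun i => mul_nonneg hr (hδ i), hw, by
    simp only [Finset.smul_sum, mul_smul]⟩

theorem add_mem_finiteConicCombinations {S : Set V} {v v' : V} (hv : v ∈ finiteConicCombinations S)
    (hv' : v' ∈ finiteConicCombinations S) : v + v' ∈ finiteConicCombinations S := by
  obtain ⟨n, δ, w, hδ, hw, rfl⟩ := hv
  obtain ⟨n', δ', w', hδ', hw', rfl⟩ := hv'
  refine ⟨n + n', Fin.append δ δ', Fin.append w w', fun i => ?_, fun i => ?_, ?_⟩
  · induction i using Fin.addCases with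
    | left i => simpa using hδ i
    | right i => simpa using hδ' i
  · induction i using Fin.addCases with
    | left i => simpa using hw i
    | right i => simpa using hw' i
  · simp [Fin.sum_univ_add]

theorem convex_finiteConicCombinations (S : Set V) : Convex ℝ (finiteConicCombinations S) :=
  fun _ hx _ hy _ _ ha hb _ => add_mem_finiteConicCombinations
    (smul_mem_finiteConicCombinations hx ha) (smul_mem_finiteConicCombinations hy hb)

/-- The closure of a cone is determined by its dual. -/
theorem mem_closure_finiteConicCombinations_iff [TopologicalSpace V] [IsTopologicalAddGroup V]
    [ContinuousSMul ℝ V] [LocallyConvexSpace ℝ V] {S : Set V} {v : V} :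
    v ∈ closure (finiteConicCombinations S) ↔
      ∀ α ∈ dualCone (finiteConicCombinations S), α v ≤ 0 := by
  constructor
  · intro hv α hα
    exact closure_minimal (fun w hw => hα w hw) (isClosed_Iic.preimage α.continuous) hv
  · intro h
    by_contra hv
    obtain ⟨f, r, hf, hr⟩ := geometric_hahn_banach_closed_point
      (convex_finiteConicCombinations S).closure isClosed_closure hv
    -- The cone contains 0, so a separating level is positive.
    have h0 : 0 < r := by
      simpa using hf 0 (subset_closure (zero_mem_finiteConicCombinations S))
    refine absurd (h f fun w hw => ?_) (not_le.2 (h0.trans hr))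
    by_contra hw0
    rw [not_le] at hw0
    -- If the functional were positive at `w`, rescaling `w` by r / f(w) would give a point of the
    -- cone exactly on the separating level.
    have h1 := hf _ (subset_closure
      (smul_mem_finiteConicCombinations hw (div_nonneg h0.le hw0.le)))
    rw [map_smul, smul_eq_mul, div_mul_cancel₀ _ hw0.ne'] at h1
    exact lt_irrefl _ h1

end Cones

namespace GeometricOptimalControlStructure

open GeometricControlStructure

variable {E : Type*} [NormedAddCommGroup E] [NormedSpace ℝ E] {H : Type*} [TopologicalSpace H]
  {I : ModelWithCorners ℝ E H} {M : Type*} [TopologicalSpace M] [ChartedSpace H M]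
  [IsManifold I ∞ M]
  {EU : Type*} [NormedAddCommGroup EU] [NormedSpace ℝ EU] {HU : Type*} [TopologicalSpace HU]
  {IU : ModelWithCorners ℝ EU HU} {U : Type*} [TopologicalSpace U] [ChartedSpace HU U]
  [IsManifold IU ∞ U]
  {EQ : Type*} [NormedAddCommGroup EQ] [NormedSpace ℝ EQ] {HQ : Type*} [TopologicalSpace HQ]
  {IQ : ModelWithCorners ℝ EQ HQ} {Q : Type*} [TopologicalSpace Q] [ChartedSpace HQ Q]
  {EF : Type*} [NormedAddCommGroup EF] [NormedSpace ℝ EF] {HF : Type*} [TopologicalSpace HF]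
  {IF : ModelWithCorners ℝ EF HF} {F : Type*} [TopologicalSpace F] [ChartedSpace HF F]
  {G : GeometricOptimalControlStructure I M IU U IQ Q IF F}

section HamiltonianCovectors

/-! ### The curves in `T*M` defined by `H_λ` -/

variable (G) in
-- Covectors with the same vertical restriction differ by a multiple of dτ, and dτ(𝐓(ρ(u))) = 1
-- determines the multiple. The lift H_λ of a restricted covector thus becomes explicit and can be
-- differentiated.
theorem hamCovector_restrictVertical (lam : ℝ) (z : U) (α : TangentSpace I (G.ν z) →L[ℝ] ℝ) :
    G.hamCovector lam z (restrictVertical G.τ α) =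
      α - (α (G.vel z) + lam * G.L z) • G.dτ (G.ν z) := by
  refine ((G.hamCovector_spec lam z _ _).2 ⟨?_, ?_⟩).symm
  · have h : G.dτ (G.ν z) (G.vel z) = 1 := G.dτ_vel z
    change α (G.vel z) - (α (G.vel z) + lam * G.L z) * G.dτ (G.ν z) (G.vel z) + lam * G.L z = 0
    rw [h]
    ring
  · ext v
    have h : G.dτ (G.ν z) v.1 = 0 := v.2
    change α v.1 - (α (G.vel z) + lam * G.L z) * G.dτ (G.ν z) v.1 = α v.1
    rw [h, mul_zero, sub_zero]

theorem contMDiffAt_dτ [I.Boundaryless] {c : ℝ → M} {t : ℝ} (hc : ContMDiffAt 𝓘(ℝ, ℝ) I ∞ c t) :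
    ContMDiffAt 𝓘(ℝ, ℝ) (I.prod 𝓘(ℝ, E →L[ℝ] ℝ)) ∞
      (fun r => CotangentBundle.mk I (c r) (G.dτ (c r))) t := by
  refine contMDiffAt_cotangent_iff.2 ⟨hc, ?_⟩
  rw [contMDiffAt_iff_contDiffAt]
  exact contDiffAt_diff_comp_chartDiffInv Filter.univ_mem contMDiff_τ.contMDiffOn hc

section Boundaryless

variable [I.Boundaryless]

theorem contMDiffAt_hamMap_restrictVertical (lam : ℝ) {g : ℝ → U} {α : ℝ → E →L[ℝ] ℝ} {t : ℝ}
    (hg : ContMDiffAt 𝓘(ℝ, ℝ) IU ∞ g t)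
    (hα : ContMDiffAt 𝓘(ℝ, ℝ) (I.prod 𝓘(ℝ, E →L[ℝ] ℝ)) ∞
      (fun r => CotangentBundle.mk I (G.ν (g r)) (α r)) t) :
    ContMDiffAt 𝓘(ℝ, ℝ) (I.prod 𝓘(ℝ, E →L[ℝ] ℝ)) ∞
      (fun r => G.hamMap lam ⟨g r, restrictVertical G.τ (α r)⟩) t := by
  have hc : ContMDiffAt 𝓘(ℝ, ℝ) I ∞ (fun r => G.ν (g r)) t := (G.contMDiff_ν _).comp t hg
  have hh : ContMDiffAt 𝓘(ℝ, ℝ) 𝓘(ℝ, ℝ) ∞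
      (fun r => α r (G.vel (g r)) + lam * G.L (g r)) t :=
    (contMDiffAt_pairing hα ((G.contMDiff_velocity _).comp t hg)).add
      (contMDiffAt_const.mul ((G.smooth_L _).comp t hg))
  have e : (fun r => G.hamMap lam ⟨g r, restrictVertical G.τ (α r)⟩) =
      fun r => CotangentBundle.mk I (G.ν (g r))
        (α r - (α r (G.vel (g r)) + lam * G.L (g r)) • G.timeForm (G.ν (g r))) := by
    funext r
    exact congrArg (fun q : E →L[ℝ] ℝ => CotangentBundle.mk I (G.ν (g r)) q)
      (G.hamCovector_restrictVertical lam (g r) (α r))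
  rw [e]
  refine contMDiffAt_cotangent_iff.2 ⟨hc, ?_⟩
  have h1 := (contMDiffAt_cotangent_iff.1 hα).2
  have h2 := (contMDiffAt_cotangent_iff.1 (contMDiffAt_dτ (G := G) hc)).2
  exact h1.sub (hh.smul h2)

theorem SmoothVertDualOverUOn.contMDiffAt_hamMap (lam : ℝ) {ζ : ℝ → G.VertDualOverU} {V : Set ℝ}
    (hV : IsOpen V) (hζ : G.SmoothVertDualOverUOn ζ V) {t : ℝ} (ht : t ∈ V) :
    ContMDiffAt 𝓘(ℝ, ℝ) (I.prod 𝓘(ℝ, E →L[ℝ] ℝ)) ∞ (fun r => G.hamMap lam (ζ r)) t := by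
  obtain ⟨h1, α, h2, h3⟩ := hζ
  refine (contMDiffAt_hamMap_restrictVertical (G := G) lam (h1.contMDiffAt (hV.mem_nhds ht))
    (h2.contMDiffAt (hV.mem_nhds ht))).congr_of_eventuallyEq ?_
  filter_upwards [hV.mem_nhds ht] with r hr
  rw [h3 r hr]

/-- The derivative of `⟨p, 𝐓 ∘ ρ⟩ + λ L` along a curve. -/
theorem hasDerivAt_pairing_vel (lam : ℝ) {g : ℝ → U} {p : ℝ → E →L[ℝ] ℝ} {t : ℝ} {β : E →L[ℝ] ℝ}
    (hg : MDifferentiableAt 𝓘(ℝ, ℝ) IU g t)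
    (hp : HasDerivAt (fun r => (p r).comp (chartDiffInv I (G.ν (g t)) (G.ν (g r)))) β t) :
    HasDerivAt (fun r => p r (G.vel (g r)) + lam * G.L (g r))
      (β (G.vel (g t)) + p t (G.velDeriv (g t) (mfderiv 𝓘(ℝ, ℝ) IU g t (1 : ℝ))) +
        lam * diff IU G.L (g t) (mfderiv 𝓘(ℝ, ℝ) IU g t (1 : ℝ))) t := by
  have hk : MDifferentiableAt IU 𝓘(ℝ, E) (G.velCoord (G.ν (g t))) (g t) :=
    ((G.contMDiffOn_velCoord _).contMDiffAt ((G.isOpen_preimage_source _).mem_nhds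
      (mem_extChartAt_source (G.ν (g t))))).mdifferentiableAt (by simp)
  have hX := hasDerivAt_comp_curve hk hg
  have hL := hasDerivAt_comp_curve ((G.smooth_L (g t)).mdifferentiableAt (by simp)) hg
  have hc : ContinuousAt (fun r => G.ν (g r)) t :=
    ContinuousAt.comp G.contMDiff_ν.continuous.continuousAt hg.continuousAt
  have h1 := hasDerivWithinAt_pairing (I := I) (s := univ) (c := fun r => G.ν (g r))
    (X := fun r => G.vel (g r)) hc.continuousWithinAt hp.hasDerivWithinAt hX.hasDerivWithinAt
  rw [hasDerivWithinAt_univ] at h1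
  exact h1.add (hL.const_mul lam)

/-- The differential of `τ` is parallel. -/
theorem dτ_adjoint [IU.Boundaryless] {c : ℝ → M} {t : ℝ} {z : U} (hz : G.ν z = c t)
    (hc : ContMDiffAt 𝓘(ℝ, ℝ) I ∞ c t)
    (hv : HasDerivAt (fun r => extChartAt I (c t) (c r)) (G.vel z) t) {β : E →L[ℝ] ℝ}
    (hβ : HasDerivAt (fun r => (G.dτ (c r)).comp (chartDiffInv I (c t) (c r))) β t) (w : EU) :
    β (G.projDeriv z w) + G.dτ (c t) (G.velDeriv z w) = 0 := by
  have hm := mem_extChartAt_source (I := I) (c t)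
  -- An auxiliary field along `c` with value Tν w at time t and coordinates whose derivative there
  -- is `velDeriv z w`. The derivative of dτ(X) is then computed in two ways.
  let X : ℝ → E := fun r =>
    chartDiffInv I (c t) (c r) (G.projDeriv z w + (r - t) • G.velDeriv z w)
  have hXt : X t = G.projDeriv z w := by
    simp only [X, sub_self, zero_smul, add_zero, chartDiffInv_self]
  have hX : HasDerivAt (fun r => chartDiff I (c t) (c r) (X r)) (G.velDeriv z w) t := by
    have h1 : HasDerivAt (fun r : ℝ => G.projDeriv z w + (r - t) • G.velDeriv z w)
        (G.velDeriv z w) t := by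
      have := (((hasDerivAt_id t).sub_const t).smul_const (G.velDeriv z w)).const_add
        (G.projDeriv z w)
      rwa [one_smul] at this
    refine h1.congr_of_eventuallyEq ?_
    filter_upwards [hc.continuousAt.eventually ((isOpen_extChartAt_source _).mem_nhds hm)]
      with r hr
    exact chartDiff_chartDiffInv hr _
  have h1 := hasDerivWithinAt_pairing (I := I) (s := univ) (c := c)
    hc.continuousAt.continuousWithinAt hβ.hasDerivWithinAt hX.hasDerivWithinAt
  have hv' : HasDerivAt (fun r => extChartAt I (c t) (c r)) (chartDiff I (c t) (c t) (G.vel z)) t :=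
    hv.congr_deriv (chartDiff_self _ _).symm
  have e0 : G.velDeriv z w = diff IU (fun z' => chartDiff I (c t) (G.ν z') (G.vel z')) z w := by
    rw [← hz]
    rfl
  have h2 := hasDerivWithinAt_diff_of_chart (J := IU) (s := univ) (c := c)
    (X := X) (ν := G.ν) (f := G.vel) (x := z) (w := w) (m₀ := c t) hz (G.contMDiff_velocity _)
    hXt.symm Filter.univ_mem (contMDiff_τ (G := G.toGeometricControlStructure)).contMDiffOn hm
    hc.continuousAt.continuousWithinAt hv'.hasDerivWithinAt
    (hX.congr_deriv e0).hasDerivWithinAt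
  rw [hasDerivWithinAt_univ] at h1 h2
  have h3 := h1.unique h2
  have e1 : (fun z => diff I G.τ (G.ν z) (G.vel z)) = fun _ => (1 : ℝ) :=
    funext fun z => timeForm_vel z
  rw [e1, hXt, diff, mfderiv_const] at h3
  exact h3

end Boundaryless

end HamiltonianCovectors

/-! ### The equation i ω_λ = 0 as an adjoint equation. -/

section AdjointEquation

/-- The covector `α` of `H_λ (u, η) = (u, α)`. -/
def hamLift (lam : ℝ) (j : G.VertDualOverU) : E →L[ℝ] ℝ := G.hamCovector lam j.1 j.2

/-- The differential, along the fibres of a chart, of `⟨α, 𝐓 ∘ ρ⟩ + λ L` for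
`H_λ (u, η) = (u, α)`. -/
def hamRate (lam : ℝ) (j : G.VertDualOverU) (w : EU) : ℝ :=
  hamLift lam j (G.velDeriv j.1 w) + lam * diff IU G.L j.1 w

theorem hamLift_vel (lam : ℝ) (j : G.VertDualOverU) :
    hamLift lam j (G.vel j.1) + lam * G.L j.1 = 0 :=
  ((G.hamCovector_spec lam j.1 j.2 _).1 rfl).1

theorem restrictVertical_hamLift (lam : ℝ) (j : G.VertDualOverU) :
    restrictVertical (I := I) (m := G.ν j.1) G.τ (hamLift lam j : E →L[ℝ] ℝ) = j.2 :=
  ((G.hamCovector_spec lam j.1 j.2 _).1 rfl).2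

theorem mfderiv_ν_comp {g : ℝ → U} {t : ℝ} (hg : MDifferentiableAt 𝓘(ℝ, ℝ) IU g t) {v : E}
    (hv : HasDerivAt (fun r => extChartAt I (G.ν (g t)) (G.ν (g r))) v t) :
    G.projDeriv (g t) (mfderiv 𝓘(ℝ, ℝ) IU g t (1 : ℝ)) = v := by
  have hc : ContinuousAt (fun r => G.ν (g r)) t :=
    ContinuousAt.comp G.contMDiff_ν.continuous.continuousAt hg.continuousAt
  have h1 := ((mfderiv_curve_iff (I := I) (Γ := fun r => G.ν (g r)) v).2 ⟨hc, hv⟩).2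
  have h2 := congrArg (fun A => (A (1 : ℝ) : E)) (mfderiv_comp (I' := IU) t
    (G.contMDiff_ν.mdifferentiableAt (by simp) (x := g t)) hg)
  exact h2.symm.trans h1

/-- A curve in `U ×_M V*τ` through a given point whose projection onto `U` has a given velocity. -/
theorem exists_curve_vertDualOverU [IU.Boundaryless] (j : G.VertDualOverU) (w : EU) :
    ∃ ξ : ℝ → G.VertDualOverU,
      (∃ V : Set ℝ, IsOpen V ∧ (0 : ℝ) ∈ V ∧ G.SmoothVertDualOverUOn ξ V) ∧ ξ 0 = j ∧
      (mfderiv 𝓘(ℝ, ℝ) IU (fun r => (ξ r).1) 0 (1 : ℝ) : EU) = w := by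
  -- Any covector that restricts to the vertical one will do; the value 0 of the parameter is an
  -- arbitrary choice.
  have hα := restrictVertical_hamLift 0 j
  set α₀ : E →L[ℝ] ℝ := hamLift 0 j with hα₀
  clear_value α₀
  obtain ⟨z, η⟩ := j
  obtain ⟨γ, rfl, ⟨W, hW, h0, hγ⟩, rfl⟩ := exists_curve_with_velocity (I := IU) z w
  let c : ℝ → M := fun r => G.ν (γ r)
  let α : ℝ → E →L[ℝ] ℝ := fun r => α₀.comp (chartDiff I (c 0) (c r))
  have hc : ContMDiffOn 𝓘(ℝ, ℝ) I ∞ c W := G.contMDiff_ν.comp_contMDiffOn hγ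
  let O : Set ℝ := W ∩ c ⁻¹' (extChartAt I (c 0)).source
  have hO : IsOpen O := hc.continuousOn.isOpen_inter_preimage hW (isOpen_extChartAt_source _)
  refine ⟨fun r => ⟨γ r, restrictVertical (I := I) (m := G.ν (γ r)) G.τ (α r)⟩,
    ⟨O, hO, ⟨h0, mem_extChartAt_source (I := I) (c 0)⟩, hγ.mono inter_subset_left, α, ?_,
      fun t _ => rfl⟩, ?_, rfl⟩
  · intro x hx
    have hcx := hc.contMDiffAt (hW.mem_nhds hx.1)
    refine (contMDiffAt_cotangent_iff.2 ⟨hcx, ?_⟩).contMDiffWithinAt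
    rw [contMDiffAt_iff_contDiffAt]
    refine ((contDiffAt_const (c := α₀)).clm_comp (contDiffAt_tangentCoordChange_comp hcx
      (mem_extChartAt_source (I := I) (c x)) hx.2)).congr_of_eventuallyEq ?_
    filter_upwards [hO.mem_nhds hx, hcx.continuousAt.eventually
      ((isOpen_extChartAt_source (I := I) (c x)).mem_nhds (mem_extChartAt_source (c x)))]
      with r hr hr'
    ext v
    exact congrArg α₀ (tangentCoordChange_comp (I := I) ⟨⟨hr', mem_extChartAt_source _⟩, hr.2⟩)
  · have e : α 0 = α₀ := by
      ext v
      exact congrArg α₀ (chartDiff_self (I := I) (c 0) v)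
    have e2 := congrArg (fun q : E →L[ℝ] ℝ => (⟨γ 0, restrictVertical (I := I) (m := G.ν (γ 0)) G.τ q⟩ :
      G.VertDualOverU)) e
    refine e2.trans ?_
    exact congrArg (fun q => (⟨γ 0, q⟩ : G.VertDualOverU)) hα

variable [I.Boundaryless]

/-- The two-form `ω_λ` on the velocity of a lifted control and an arbitrary vector. -/
theorem canonicalTwoForm_hamMap (lam : ℝ) {ζ ξ : ℝ → G.VertDualOverU} {t : ℝ} {β : E →L[ℝ] ℝ}
    (hc : ContinuousAt (fun r => G.ν (ζ r).1) t)
    (hv : HasDerivAt (fun r => extChartAt I (G.ν (ζ t).1) (G.ν (ζ r).1)) (G.vel (ζ t).1) t)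
    (hβ : HasDerivAt (fun r => (hamLift lam (ζ r)).comp
      (chartDiffInv I (G.ν (ζ t).1) (G.ν (ζ r).1))) β t) (h0 : ξ 0 = ζ t)
    (hξ : MDifferentiableAt 𝓘(ℝ, ℝ) IU (fun r => (ξ r).1) 0)
    (hhξ : MDifferentiableAt 𝓘(ℝ, ℝ) (I.prod 𝓘(ℝ, E →L[ℝ] ℝ)) (fun r => G.hamMap lam (ξ r)) 0) :
    canonicalTwoForm I M
      (tangentMap 𝓘(ℝ, ℝ) (I.prod 𝓘(ℝ, E →L[ℝ] ℝ)) (fun r => G.hamMap lam (ζ r)) ⟨t, (1 : ℝ)⟩)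
      (tangentMap 𝓘(ℝ, ℝ) (I.prod 𝓘(ℝ, E →L[ℝ] ℝ)) (fun r => G.hamMap lam (ξ r)) ⟨0, (1 : ℝ)⟩) =
    β (G.projDeriv (ζ t).1 (mfderiv 𝓘(ℝ, ℝ) IU (fun r => (ξ r).1) 0 (1 : ℝ))) +
      hamRate lam (ζ t) (mfderiv 𝓘(ℝ, ℝ) IU (fun r => (ξ r).1) 0 (1 : ℝ)) := by
  have h1 := ((mfderiv_cotangent_iff (I := I) (c := fun r => G.ν (ζ r).1)
    (p := fun r => hamLift lam (ζ r)) (t := t) (G.vel (ζ t).1) β).2 ⟨hc, hv, hβ⟩).2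
  obtain ⟨⟨v, β'⟩, hvβ⟩ : ∃ vβ : E × (E →L[ℝ] ℝ), (mfderiv 𝓘(ℝ, ℝ) (I.prod 𝓘(ℝ, E →L[ℝ] ℝ))
      (fun r => G.hamMap lam (ξ r)) 0 (1 : ℝ) : E × (E →L[ℝ] ℝ)) = vβ := ⟨_, rfl⟩
  obtain ⟨-, hv', hβ'⟩ := (mfderiv_cotangent_iff (I := I) (c := fun r => G.ν (ξ r).1)
    (p := fun r => hamLift lam (ξ r)) (t := 0) v β').1 ⟨hhξ, hvβ⟩
  have h2 := hasDerivAt_pairing_vel lam hξ hβ'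
  -- Along ξ the lift stays in the zero set of ⟨α, 𝐓 ∘ ρ⟩ + λ L. Differentiating this relation
  -- expresses the unknown term β'(𝐓 ∘ ρ) by `hamRate`.
  have e0 : (fun r => hamLift lam (ξ r) (G.vel (ξ r).1) + lam * G.L (ξ r).1) = fun _ => 0 :=
    funext fun r => hamLift_vel lam (ξ r)
  rw [e0] at h2
  have h3 : β' (G.vel (ξ 0).1) + hamRate lam (ξ 0)
      (mfderiv 𝓘(ℝ, ℝ) IU (fun r => (ξ r).1) 0 (1 : ℝ)) = 0 := by
    have := h2.unique (hasDerivAt_const 0 (0 : ℝ))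
    rw [add_assoc] at this
    exact this
  have h4 := mfderiv_ν_comp hξ hv'
  have e1 : (G.vel (ξ 0).1 : E) = G.vel (ζ t).1 := by rw [h0]
  rw [e1, h0] at h3
  rw [h0] at h4
  have key : ∀ A B : E × (E →L[ℝ] ℝ), A = (G.vel (ζ t).1, β) → B = (v, β') →
      A.2 B.1 - B.2 A.1 = β v - β' (G.vel (ζ t).1) := by
    rintro _ _ rfl rfl
    rfl
  refine (key _ _ h1 hvβ).trans ?_
  rw [← h4]
  linear_combination -h3

theorem SmoothVertDualOverUOn.exists_hasDerivAt (lam : ℝ) {ζ : ℝ → G.VertDualOverU} {V : Set ℝ}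
    (hV : IsOpen V) (hζ : G.SmoothVertDualOverUOn ζ V) {t : ℝ} (ht : t ∈ V) :
    ∃ β : E →L[ℝ] ℝ, HasDerivAt (fun r => (hamLift lam (ζ r)).comp
      (chartDiffInv I (G.ν (ζ t).1) (G.ν (ζ r).1))) β t := by
  obtain ⟨⟨v, β⟩, hvβ⟩ : ∃ vβ : E × (E →L[ℝ] ℝ), (mfderiv 𝓘(ℝ, ℝ) (I.prod 𝓘(ℝ, E →L[ℝ] ℝ))
      (fun r => G.hamMap lam (ζ r)) t (1 : ℝ) : E × (E →L[ℝ] ℝ)) = vβ := ⟨_, rfl⟩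
  exact ⟨β, ((mfderiv_cotangent_iff (I := I) (c := fun r => G.ν (ζ r).1)
    (p := fun r => hamLift lam (ζ r)) (t := t) v β).1
      ⟨(hζ.contMDiffAt_hamMap lam hV ht).mdifferentiableAt (by simp), hvβ⟩).2.2⟩

omit [I.Boundaryless] in
theorem SmoothVertDualOverUOn.continuousAt_base {ζ : ℝ → G.VertDualOverU} {V : Set ℝ}
    (hV : IsOpen V) (hζ : G.SmoothVertDualOverUOn ζ V) {t : ℝ} (ht : t ∈ V) :
    ContinuousAt (fun r => G.ν (ζ r).1) t :=
  ContinuousAt.comp G.contMDiff_ν.continuous.continuousAt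
    (hζ.1.continuousOn.continuousAt (hV.mem_nhds ht))

/-- The equation `i_{ζ̇} ω_λ = 0` in coordinates. -/
theorem contractionVanishes_iff [IU.Boundaryless] (lam : ℝ) {ζ : ℝ → G.VertDualOverU} {V : Set ℝ}
    (hV : IsOpen V) (hζ : G.SmoothVertDualOverUOn ζ V) {t : ℝ} (ht : t ∈ V)
    (hv : HasDerivAt (fun r => extChartAt I (G.ν (ζ t).1) (G.ν (ζ r).1)) (G.vel (ζ t).1) t)
    {β : E →L[ℝ] ℝ} (hβ : HasDerivAt (fun r => (hamLift lam (ζ r)).comp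
      (chartDiffInv I (G.ν (ζ t).1) (G.ν (ζ r).1))) β t) :
    G.ContractionVanishes lam ζ t ↔
      ∀ w, β (G.projDeriv (ζ t).1 w) + hamRate lam (ζ t) w = 0 := by
  have hc := hζ.continuousAt_base hV ht
  constructor
  · intro h w
    -- The two-form sees only the velocity of ξ in U, and every such velocity occurs. Variations of
    -- the covector alone impose no condition.
    obtain ⟨ξ, ⟨W, hW, h0, hξ⟩, hξ0, rfl⟩ := exists_curve_vertDualOverU (ζ t) w
    have h1 := h ξ ⟨W, hW, h0, hξ⟩ hξ0
    rwa [canonicalTwoForm_hamMap lam hc hv hβ hξ0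
      ((hξ.1.contMDiffAt (hW.mem_nhds h0)).mdifferentiableAt (by simp))
      ((hξ.contMDiffAt_hamMap lam hW h0).mdifferentiableAt (by simp))] at h1
  · rintro h ξ ⟨W, hW, h0, hξ⟩ hξ0
    rw [canonicalTwoForm_hamMap lam hc hv hβ hξ0
      ((hξ.1.contMDiffAt (hW.mem_nhds h0)).mdifferentiableAt (by simp))
      ((hξ.contMDiffAt_hamMap lam hW h0).mdifferentiableAt (by simp))]
    exact h _

/-- A smooth control `g` with a curve `p` in `T*M` that satisfies the adjoint equation. -/
structure IsAdjointPiece (lam α β : ℝ) (g : ℝ → U) (p : ℝ → E →L[ℝ] ℝ) : Prop where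
  smooth : ∃ W : Set ℝ, IsOpen W ∧ Icc α β ⊆ W ∧ ContMDiffOn 𝓘(ℝ, ℝ) IU ∞ g W ∧
    ContMDiffOn 𝓘(ℝ, ℝ) (I.prod 𝓘(ℝ, E →L[ℝ] ℝ)) ∞
      (fun r => CotangentBundle.mk I (G.ν (g r)) (p r)) W
  velocity : ∀ t ∈ Icc α β,
    HasDerivAt (fun r => extChartAt I (G.ν (g t)) (G.ν (g r))) (G.vel (g t)) t
  adjoint : ∀ t ∈ Icc α β, ∃ β : E →L[ℝ] ℝ,
    HasDerivAt (fun r => (p r).comp (chartDiffInv I (G.ν (g t)) (G.ν (g r)))) β t ∧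
    ∀ w, β (G.projDeriv (g t) w) + p t (G.velDeriv (g t) w) + lam * diff IU G.L (g t) w = 0

/-- The lift of the restriction of p is p - h dτ with h = ⟨p, 𝐓 ∘ ρ⟩ + λ L. The adjoint equation
tested on the velocity of the control gives ḣ = 0, and dτ satisfies the adjoint equation without
cost term by `dτ_adjoint`; so p - h dτ satisfies that of p. -/
theorem IsAdjointPiece.isCharacteristicCurve [IU.Boundaryless] {lam α β : ℝ} {g : ℝ → U}
    {p : ℝ → E →L[ℝ] ℝ} (h : IsAdjointPiece (G := G) lam α β g p) :
    G.IsCharacteristicCurve lam α β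
      (fun t => ⟨g t, restrictVertical (I := I) (m := G.ν (g t)) G.τ (p t)⟩) := by
  obtain ⟨W, hW, hsub, hg, hp⟩ := h.smooth
  have hζ : G.SmoothVertDualOverUOn
      (fun t => ⟨g t, restrictVertical (I := I) (m := G.ν (g t)) G.τ (p t)⟩) W :=
    ⟨hg, p, hp, fun _ _ => rfl⟩
  refine ⟨⟨W, hW, hsub, hζ⟩, fun t ht => ?_⟩
  have hgt := hg.contMDiffAt (hW.mem_nhds (hsub ht))
  have hgt' : MDifferentiableAt 𝓘(ℝ, ℝ) IU g t := hgt.mdifferentiableAt (by simp)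
  have hc : ContMDiffAt 𝓘(ℝ, ℝ) I ∞ (fun r => G.ν (g r)) t := (G.contMDiff_ν _).comp t hgt
  obtain ⟨β₁, hβ₁, hadj⟩ := h.adjoint t ht
  have hdτ := (contMDiffAt_cotangent_iff.1 (contMDiffAt_dτ (G := G) hc)).2
  rw [contMDiffAt_iff_contDiffAt] at hdτ
  obtain ⟨β₂, hβ₂⟩ : ∃ β₂ : E →L[ℝ] ℝ, HasDerivAt (fun r => (G.timeForm (G.ν (g r))).comp
      (chartDiffInv I (G.ν (g t)) (G.ν (g r)))) β₂ t :=
    ⟨_, (hdτ.differentiableAt (by simp)).hasDerivAt⟩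
  have hh := hasDerivAt_pairing_vel lam hgt' hβ₁
  have e := mfderiv_ν_comp hgt' (h.velocity t ht)
  have hh0 := hadj (mfderiv 𝓘(ℝ, ℝ) IU g t (1 : ℝ))
  rw [e] at hh0
  have hβ := hβ₁.sub ((hh.congr_deriv hh0).smul hβ₂)
  have heq : ∀ r, (hamLift lam (⟨g r, restrictVertical (I := I) (m := G.ν (g r)) G.τ (p r)⟩ :
      G.VertDualOverU)) =
      p r - (p r (G.vel (g r)) + lam * G.L (g r)) • G.timeForm (G.ν (g r)) :=
    fun r => G.hamCovector_restrictVertical lam (g r) (p r)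
  refine (contractionVanishes_iff lam hW hζ (hsub ht) (h.velocity t ht)
    (hβ.congr_of_eventuallyEq (Filter.Eventually.of_forall fun r => ?_))).2 fun w => ?_
  · simp only [heq r]
    rfl
  · have h5 : β₂ (G.projDeriv (g t) w) + G.timeForm (G.ν (g t)) (G.velDeriv (g t) w) = 0 :=
      dτ_adjoint (G := G) (z := g t) rfl hc (h.velocity t ht) hβ₂ w
    have h6 := hadj w
    unfold hamRate
    simp only [heq t]
    simp only [zero_smul, add_zero, sub_apply, smul_apply, smul_eq_mul]
    linear_combination h6 - (p t (G.vel (g t)) + lam * G.L (g t)) * h5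

end AdjointEquation

section Extended

/-! ### The extended structure in components -/

theorem extended_projDeriv (z : U) (J : ℝ) (w : EU × ℝ) :
    (G.extended.projDeriv (z, J) w : E × ℝ) = (G.projDeriv z w.1, w.2) := by
  have h := ((G.contMDiff_ν.mdifferentiableAt (by simp) (x := z)).hasMFDerivAt).prodMap
    (p := (z, J)) (hasMFDerivAt_id (I := 𝓘(ℝ, ℝ)) J)
  have h' : (mfderiv (IU.prod 𝓘(ℝ, ℝ)) (I.prod 𝓘(ℝ, ℝ)) (Prod.map G.ν id) (z, J) w :
      E × ℝ) = _ :=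
    congrArg (fun A => (A w : E × ℝ)) h.mfderiv
  refine Eq.trans (b := (mfderiv (IU.prod 𝓘(ℝ, ℝ)) (I.prod 𝓘(ℝ, ℝ)) (Prod.map G.ν id) (z, J) w :
    E × ℝ)) rfl (h'.trans (Prod.ext rfl ?_))
  exact congrArg (fun A => (A w.2 : ℝ)) (mfderiv_id (I := 𝓘(ℝ, ℝ)) (x := J))

theorem extended_timeForm (m : M) (J : ℝ) (v : E × ℝ) :
    G.extended.timeForm (m, J) v = G.timeForm m v.1 :=
  G.mfderiv_τ_fst m J v

/-- The extended velocity does not depend on J, so only the U-component of the vector matters, and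
dL appears as the cost component. -/
theorem extended_velDeriv [I.Boundaryless] (z : U) (J : ℝ) (w : EU × ℝ) :
    (G.extended.velDeriv (z, J) w : E × ℝ) = (G.velDeriv z w.1, diff IU G.L z w.1) := by
  have hf : MDifferentiableAt IU 𝓘(ℝ, E) (G.velCoord (G.ν z)) z :=
    ((G.contMDiffOn_velCoord _).contMDiffAt ((G.isOpen_preimage_source _).mem_nhds
      (mem_extChartAt_source (G.ν z)))).mdifferentiableAt (by simp)
  have hL : MDifferentiableAt IU 𝓘(ℝ, ℝ) G.L z := (G.smooth_L z).mdifferentiableAt (by simp)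
  have e : G.extended.velCoord (G.ν z, J) =ᶠ[𝓝 (z, J)]
      fun y => (G.velCoord (G.ν z) y.1, G.L y.1) := by
    filter_upwards [((G.isOpen_preimage_source (G.ν z)).preimage continuous_fst).mem_nhds
      (mem_extChartAt_source (G.ν z))] with y hy
    exact chartDiff_prod (I := I) hy J y.2 ((G.vel y.1, G.L y.1) : E × ℝ)
  have e1 : G.extended.velDeriv (z, J) =
      diff (IU.prod 𝓘(ℝ, ℝ)) (fun y : U × ℝ => (G.velCoord (G.ν z) y.1, G.L y.1)) (z, J) :=
    e.mfderiv_eq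
  rw [e1, diff_prodMk (f := fun y : U × ℝ => G.velCoord (G.ν z) y.1)
    (g := fun y : U × ℝ => G.L y.1)
    (hf.comp (I := IU.prod 𝓘(ℝ, ℝ)) (f := Prod.fst) ((z, J) : U × ℝ) mdifferentiableAt_fst)
    (hL.comp (I := IU.prod 𝓘(ℝ, ℝ)) (f := Prod.fst) ((z, J) : U × ℝ) mdifferentiableAt_fst),
    diff_comp_fst J hf, diff_comp_fst J hL]
  rfl

end Extended

/-! ### Adjoint curves from coframes of the extended structure. -/

section ExtendedPaths

section Piece

variable {ubar : ℝ → U × ℝ} {ψ : ∀ t, G.extended.JetFibre (ubar t)} {P P' : ℝ → (E × ℝ) ≃L[ℝ] (E × ℝ)}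
  {α β : ℝ} {φ : ℝ → G.extended.Jet} [I.Boundaryless] [IU.Boundaryless] [CompleteSpace E]

/-- The component of a parallel covector in the direction of the cost is constant. -/
theorem coframe_cost_eq (h : IsFramedPiece ubar ψ P α β φ P') (γ : E × ℝ →L[ℝ] ℝ)
    (hmax : ∀ t ∈ Icc α β, ∀ z, G.extended.ν z = G.extended.base φ t →
      γ ((P' t).symm (G.extended.vel z : E × ℝ)) ≤
        γ ((P' t).symm (G.extended.vel (φ t).1 : E × ℝ)))
    {t : ℝ} (ht : t ∈ Icc α β) :
    γ ((P' t).symm (0, 1)) = γ ((P' β).symm (0, 1)) := by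
  have hd : ∀ t ∈ Icc α β, HasDerivAt (fun r => γ ((P' r).symm (0, 1))) 0 t := by
    intro t ht
    have h1 := (h.hasDerivAt_coframe γ ht).clm_apply (hasDerivAt_const t ((0, 1) : E × ℝ))
    rw [map_zero, add_zero] at h1
    -- Tested on ∂/∂J, which projects to ∂/∂J and annihilates the extended velocity, the adjoint
    -- equation says that the cost component has derivative zero.
    have h2 := coframe_adjoint (φ := φ) (t := t)
      (γ.comp ((P' t).symm : E × ℝ →L[ℝ] E × ℝ)) (hmax t ht) ((0, 1) : EU × ℝ)
    have e1 : G.extended.projDeriv (φ t).1 ((0, 1) : EU × ℝ) = ((0, 1) : E × ℝ) := by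
      refine (G.extended_projDeriv (φ t).1.1 (φ t).1.2 _).trans ?_
      rw [map_zero]
    have e2 : G.extended.velDeriv (φ t).1 ((0, 1) : EU × ℝ) = (0 : E × ℝ) := by
      refine (extended_velDeriv (φ t).1.1 (φ t).1.2 _).trans ?_
      rw [map_zero, map_zero]
      rfl
    rw [e1, e2, map_zero, add_zero] at h2
    refine (h1.congr_of_eventuallyEq ?_).congr_deriv h2
    have hc : ContinuousAt (fun r => (G.extended.base φ r).1) t :=
      continuous_fst.continuousAt.comp (h.frame.contMDiffAt_base ht).continuousAt
    filter_upwards [hc.eventually ((isOpen_extChartAt_source (I := I) _).mem_nhds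
      (mem_extChartAt_source _))] with r hr
    have e3 := chartDiffInv_prod (I := I) hr (G.extended.base φ t).2 (G.extended.base φ r).2
      ((0, 1) : E × ℝ)
    rw [map_zero] at e3
    exact (congrArg (fun y => γ ((P' r).symm y)) e3).symm
  have hconst := constant_of_has_deriv_right_zero
    (fun r hr => (hd r hr).continuousAt.continuousWithinAt)
    (fun r hr => (hd r ⟨hr.1, hr.2.le⟩).hasDerivWithinAt)
  exact (hconst t ht).trans (hconst β ⟨h.lt.le, le_rfl⟩).symm

omit [CompleteSpace E] in
theorem coframe_apply (γ : E × ℝ →L[ℝ] ℝ) (A : (E × ℝ) ≃L[ℝ] (E × ℝ)) (v : E × ℝ) :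
    γ (A.symm v) = ((γ.comp (A.symm : E × ℝ →L[ℝ] E × ℝ)).comp (ContinuousLinearMap.inl ℝ E ℝ)) v.1 +
      γ (A.symm (0, 1)) * v.2 := by
  have e : v = (v.1, 0) + v.2 • ((0, 1) : E × ℝ) := by
    ext <;> simp
  conv_lhs => rw [e, map_add, map_smul, map_add, map_smul]
  simp [mul_comm]

/-- A parallel covector with the maximum condition satisfies the adjoint equation. -/
theorem isAdjointPiece_coframe (h : IsFramedPiece ubar ψ P α β φ P') (γ : E × ℝ →L[ℝ] ℝ)
    (hmax : ∀ t ∈ Icc α β, ∀ z, G.extended.ν z = G.extended.base φ t →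
      γ ((P' t).symm (G.extended.vel z : E × ℝ)) ≤
        γ ((P' t).symm (G.extended.vel (φ t).1 : E × ℝ))) :
    IsAdjointPiece (G := G) (γ ((P' β).symm (0, 1))) α β (fun t => (φ t).1.1)
      (fun t => (γ.comp ((P' t).symm : E × ℝ →L[ℝ] E × ℝ)).comp (ContinuousLinearMap.inl ℝ E ℝ)) := by
  -- Restricting a covector of M × ℝ to TM commutes with passing to coordinates, because the product
  -- chart does not mix the factors.
  have hinl : ∀ {t : ℝ}, ContinuousAt (G.extended.base φ) t → ∀ᶠ r in 𝓝 t,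
      ((γ.comp ((P' r).symm : E × ℝ →L[ℝ] E × ℝ)).comp (ContinuousLinearMap.inl ℝ E ℝ)).comp
        (chartDiffInv I (G.ν (φ t).1.1) (G.ν (φ r).1.1)) =
      ((γ.comp ((P' r).symm : E × ℝ →L[ℝ] E × ℝ)).comp
        (chartDiffInv (I.prod 𝓘(ℝ, ℝ)) (G.extended.base φ t) (G.extended.base φ r))).comp
        (ContinuousLinearMap.inl ℝ E ℝ) := by
    intro t hb
    have hc : ContinuousAt (fun r => (G.extended.base φ r).1) t :=
      continuous_fst.continuousAt.comp hb
    filter_upwards [hc.eventually ((isOpen_extChartAt_source (I := I) _).mem_nhds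
      (mem_extChartAt_source _))] with r hr
    ext v
    have e3 := chartDiffInv_prod (I := I) hr (G.extended.base φ t).2 (G.extended.base φ r).2
      ((v, 0) : E × ℝ)
    exact (congrArg (fun y => γ ((P' r).symm y)) e3).symm
  obtain ⟨W, hW, hsub, hs, hf⟩ := h.frame.1
  have hbase : ContMDiffOn 𝓘(ℝ, ℝ) (I.prod 𝓘(ℝ, ℝ)) ∞ (G.extended.base φ) W :=
    G.extended.contMDiff_ν.comp_contMDiffOn hs
  refine ⟨⟨W, hW, hsub, contMDiff_fst.comp_contMDiffOn hs, fun t ht => ?_⟩, fun t ht => ?_,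
    fun t ht => ?_⟩
  · have hbt := hbase.contMDiffAt (hW.mem_nhds ht)
    have h1 := contMDiffAt_cotangent_iff.1 ((hf t ht).contMDiffAt_coframe hbt γ)
    refine (contMDiffAt_cotangent_iff.2 ⟨contMDiff_fst.contMDiffAt.comp t hbt, ?_⟩).contMDiffWithinAt
    have h2 := contMDiffAt_iff_contDiffAt.1 h1.2
    rw [contMDiffAt_iff_contDiffAt]
    exact (h2.clm_comp (contDiffAt_const (c := ContinuousLinearMap.inl ℝ E ℝ))).congr_of_eventuallyEq
      (hinl hbt.continuousAt)
  · have h1 := h.admissible.hasDerivAt_base ht (mem_extChartAt_source _)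
    have h2 := (ContinuousLinearMap.fst ℝ E ℝ).hasFDerivAt.comp_hasDerivAt t h1
    refine (h2.congr_of_eventuallyEq (Filter.Eventually.of_forall fun r => ?_)).congr_deriv ?_
    · exact (congrArg Prod.fst (extChartAt_prod_real (I := I) (G.ν (φ t).1.1) (G.ν (φ r).1.1)
        (φ t).1.2 (φ r).1.2)).symm
    · exact congrArg Prod.fst (chartDiff_self (I := I.prod 𝓘(ℝ, ℝ)) (G.extended.base φ t)
        (G.extended.vel (φ t).1))
  · have hbt := h.frame.contMDiffAt_base ht
    have h1 := (h.hasDerivAt_coframe γ ht).clm_comp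
      (hasDerivAt_const t (ContinuousLinearMap.inl ℝ E ℝ))
    rw [ContinuousLinearMap.comp_zero, add_zero] at h1
    refine ⟨_, h1.congr_of_eventuallyEq (hinl hbt.continuousAt), fun w => ?_⟩
    -- Tested on (w, 0), the extended equation splits into its part on TM and the cost component
    -- times dL(w).
    have h2 := coframe_adjoint (φ := φ) (t := t)
      (γ.comp ((P' t).symm : E × ℝ →L[ℝ] E × ℝ)) (hmax t ht) ((w, 0) : EU × ℝ)
    have e1 : G.extended.projDeriv (φ t).1 ((w, 0) : EU × ℝ) =
        ((G.projDeriv (φ t).1.1 w, 0) : E × ℝ) :=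
      G.extended_projDeriv (φ t).1.1 (φ t).1.2 _
    have e2 : G.extended.velDeriv (φ t).1 ((w, 0) : EU × ℝ) =
        ((G.velDeriv (φ t).1.1 w, diff IU G.L (φ t).1.1 w) : E × ℝ) :=
      extended_velDeriv (φ t).1.1 (φ t).1.2 _
    rw [e1, e2] at h2
    have e3 := coframe_apply γ (P' t) (G.velDeriv (φ t).1.1 w, diff IU G.L (φ t).1.1 w)
    rw [coframe_cost_eq h γ hmax ht] at e3
    rw [add_assoc, ← e3]
    exact h2

end Piece

/-! ### The extended control -/

/-- The cost may jump at break points, but on each half-open piece it equals a function continuous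
on the closed piece. -/
theorem _root_.GeometricControlStructure.IsControl.intervalIntegrable {a b : ℝ} {u : ℝ → U}
    (hu : G.IsControl a b u) :
    IntervalIntegrable (fun t => G.L (u t)) MeasureTheory.volume a b := by
  obtain ⟨⟨n, s, hn, rfl, rfl, hs⟩, -⟩ := hu
  refine IntervalIntegrable.trans_iterate fun i hi => ?_
  obtain ⟨hlt, g, ⟨⟨V, hV, hsub, hg⟩, -, -⟩, heq, -⟩ := hs i hi
  have h1 : ContinuousOn (fun t => G.L (g t)) (uIcc (s i) (s (i + 1))) := by
    rw [uIcc_of_le hlt.le]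
    exact G.smooth_L.continuous.comp_continuousOn (hg.continuousOn.mono hsub)
  refine (h1.intervalIntegrable).congr fun t ht => ?_
  rw [uIoc_of_le hlt.le] at ht
  rw [heq ht]

theorem _root_.GeometricControlStructure.IsControl.le {a b : ℝ} {u : ℝ → U}
    (hu : G.IsControl a b u) : a ≤ b := by
  obtain ⟨⟨n, s, hn, rfl, rfl, hs⟩, -⟩ := hu
  exact subdivision_le (fun i hi => (hs i hi).1) (Nat.zero_le n)

theorem _root_.GeometricControlStructure.IsControl.continuousOn_extended {a b : ℝ} {u : ℝ → U}
    (hu : G.IsControl a b u) (J₀ : ℝ) :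
    ContinuousOn (fun t => G.extended.ν (G.extendedControl u a J₀ t)) (Icc a b) := by
  refine ContinuousOn.prodMk hu.2 (continuousOn_const.add ?_)
  have h := intervalIntegral.continuousOn_primitive_interval' hu.intervalIntegrable left_mem_uIcc
  rwa [uIcc_of_le hu.le] at h

end ExtendedPaths

/-! ### From the dual cone to multipliers. -/

section FromCoframes

variable [I.Boundaryless] [IU.Boundaryless] [CompleteSpace E]

omit [I.Boundaryless] [IU.Boundaryless] [CompleteSpace E] in
-- Velocities in one fibre share the dτ-component 1, so the correction by a multiple of dτ cancels
-- in differences. The maximum condition is thus insensitive to the choice of lift.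
theorem hamLift_restrictVertical_sub (lam : ℝ) (z z' : U) (h : G.ν z' = G.ν z) (α : E →L[ℝ] ℝ) :
    G.hamCovector lam z (restrictVertical (I := I) (m := G.ν z) G.τ α) (G.velAt z' h) -
      G.hamCovector lam z (restrictVertical (I := I) (m := G.ν z) G.τ α) (G.vel z) =
      α (G.vel z') - α (G.vel z) := by
  rw [G.hamCovector_restrictVertical lam z α]
  have e := velAt_eq z' h
  have e1 : G.timeForm (G.ν z) (G.vel z' : E) = 1 := h ▸ timeForm_vel z'
  have e2 : G.timeForm (G.ν z) (G.vel z : E) = 1 := timeForm_vel z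
  change (α (G.velAt z' h : E) - (α (G.vel z) + lam * G.L z) * G.timeForm (G.ν z) (G.velAt z' h : E))
    - (α (G.vel z : E) - (α (G.vel z) + lam * G.L z) * G.timeForm (G.ν z) (G.vel z : E)) = _
  rw [e, e1, e2]
  ring

omit [I.Boundaryless] [IU.Boundaryless] [CompleteSpace E] in
theorem mk_restrictVertical_congr {z z' : U} {q q' : E →L[ℝ] ℝ} (hz : z = z') (hq : q = q') :
    (⟨z, restrictVertical (I := I) (m := G.ν z) G.τ q⟩ : G.VertDualOverU) =
      ⟨z', restrictVertical (I := I) (m := G.ν z') G.τ q'⟩ := by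
  subst hz hq
  rfl

/-- Covectors in the dual of the vertical variational cone of the extended control come from
multipliers. -/
theorem exists_isMultiplier {ubar : ℝ → U × ℝ} {ψ : ∀ t, G.extended.JetFibre (ubar t)}
    {P : ℝ → (E × ℝ) ≃L[ℝ] (E × ℝ)} {n : ℕ} {s : ℕ → ℝ} (h : IsFramedPath ubar ψ P n s)
    (η₀ : G.VertDual (G.ν (ubar (s n)).1)) (lam : ℝ) (hne : (η₀, lam) ≠ (0, 0))
    (hmem : G.extendedCovector (G.extended.ν (ubar (s n))) (η₀, lam) ∈
      dualCone (G.extended.verticalCone (s 0) (s n) ubar ψ)) :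
    ∃ η : ∀ t, G.VertDual (G.ν (ubar t).1), η (s n) = η₀ ∧
      G.IsMultiplier (s 0) (s n) (fun t => (ubar t).1) η lam := by
  have hle : s 0 ≤ s n := subdivision_le h.lt (Nat.zero_le n)
  -- Frames act on full tangent vectors, so the given vertical covector is first extended to the
  -- whole tangent space, here by H_λ.
  let αb : E × ℝ →L[ℝ] ℝ := (hamLift lam (⟨(ubar (s n)).1, η₀⟩ : G.VertDualOverU)).coprod
    (lam • ContinuousLinearMap.id ℝ ℝ)
  have hαb : ∀ v : E × ℝ, αb v =
      hamLift lam (⟨(ubar (s n)).1, η₀⟩ : G.VertDualOverU) v.1 + lam * v.2 := fun v => rfl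
  have hrestr : ∀ v : G.Vert (G.ν (ubar (s n)).1),
      hamLift lam (⟨(ubar (s n)).1, η₀⟩ : G.VertDualOverU) v.1 = η₀ v := fun v =>
    DFunLike.congr_fun (restrictVertical_hamLift lam (⟨(ubar (s n)).1, η₀⟩ : G.VertDualOverU)) v
  let γ : E × ℝ →L[ℝ] ℝ := αb.comp (P (s n) : E × ℝ →L[ℝ] E × ℝ)
  have hγb : ∀ v, γ ((P (s n)).symm v) = αb v := fun v =>
    congrArg αb ((P (s n)).apply_symm_apply v)
  have hmax := fun t ht => h.max_of_mem_dualCone (γ := γ) (fun v =>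
    ((hγb v.1).trans (congrArg (· + lam * (v.1 : E × ℝ).2) (hrestr (G.vertFst _ v)))).symm) hmem (t := t) ht
  have hpiece : ∀ i < n, ∃ (φ : ℝ → G.extended.Jet) (P' : ℝ → (E × ℝ) ≃L[ℝ] (E × ℝ)),
      IsFramedPiece ubar ψ P (s i) (s (i + 1)) φ P' ∧
      (i = 0 → (⟨ubar (s 0), ψ (s 0)⟩ : G.extended.Jet) = φ (s 0)) ∧
      ∀ t ∈ Icc (s i) (s (i + 1)), ∀ z, G.extended.ν z = G.extended.base φ t →
      γ ((P' t).symm (G.extended.vel z : E × ℝ)) ≤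
        γ ((P' t).symm (G.extended.vel (φ t).1 : E × ℝ)) := by
    intro i hi
    obtain ⟨φ, P', hp, h0⟩ := h.2 i hi
    refine ⟨φ, P', hp, h0, fun t ht z hz => hp.max_of_forall_Ioc γ (fun t ht => hmax t ⟨?_, ?_⟩) ht z hz⟩
    · exact (subdivision_le (fun j hj => h.lt j (hj.trans hi)) (Nat.zero_le i)).trans_lt ht.1
    · exact ht.2.trans (subdivision_le h.lt hi)
  -- The cost component is constant on each piece, the frame is single-valued at the break points,
  -- and at the end the value is λ.
  have hlam : ∀ t ∈ Icc (s 0) (s n), γ ((P t).symm (0, 1)) = lam := by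
    intro t ht
    refine (eq_of_subdivision (f := fun t => γ ((P t).symm (0, 1))) h.lt (fun i hi t ht => ?_)
      t ht).trans ?_
    · obtain ⟨φ, P', hp, -, hm⟩ := hpiece i hi
      have e := coframe_cost_eq hp γ hm ht
      rwa [← hp.frame_eq t ht, ← hp.frame_eq _ ⟨hp.lt.le, le_rfl⟩] at e
    · rw [hγb, hαb, map_zero, zero_add, mul_one]
  let α : ℝ → E →L[ℝ] ℝ := fun t =>
    (γ.comp ((P t).symm : E × ℝ →L[ℝ] E × ℝ)).comp (ContinuousLinearMap.inl ℝ E ℝ)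
  have hα : ∀ t ∈ Icc (s 0) (s n), ∀ v : E × ℝ, γ ((P t).symm v) = α t v.1 + lam * v.2 := by
    intro t ht v
    rw [coframe_apply γ (P t) v, hlam t ht]
  let η : ∀ t, G.VertDual (G.ν (ubar t).1) := fun t =>
    restrictVertical (I := I) (m := G.ν (ubar t).1) G.τ (α t)
  have hadj : ∀ i < n, ∃ (φ : ℝ → G.extended.Jet) (p : ℝ → E →L[ℝ] ℝ),
      IsAdjointPiece (G := G) lam (s i) (s (i + 1)) (fun t => (φ t).1.1) p ∧
      (∀ t ∈ Icc (s i) (s (i + 1)), α t = p t) ∧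
      (∀ t ∈ Icc (s i) (s (i + 1)), G.ν (ubar t).1 = G.ν (φ t).1.1) ∧
      (∀ t ∈ Ioc (s i) (s (i + 1)), (ubar t).1 = (φ t).1.1) ∧
      (i = 0 → (ubar (s 0)).1 = (φ (s 0)).1.1) := by
    intro i hi
    obtain ⟨φ, P', hp, h0, hm⟩ := hpiece i hi
    have e : γ ((P' (s (i + 1))).symm (0, 1)) = lam := by
      rw [← hp.frame_eq _ ⟨hp.lt.le, le_rfl⟩]
      exact hlam _ ⟨(subdivision_le (fun j hj => h.lt j (hj.trans_le hi)) (Nat.zero_le (i + 1))),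
        subdivision_le h.lt hi⟩
    have ha := isAdjointPiece_coframe hp γ hm
    rw [e] at ha
    refine ⟨φ, _, ha, fun t ht => ?_, fun t ht => congrArg Prod.fst (hp.base_eq t ht),
      fun t ht => congrArg Prod.fst (hp.control_eq ht), fun hi0 => ?_⟩
    · simp only [α, hp.frame_eq t ht]
    · rw [← h0 hi0]
  refine ⟨η, ?_, ?_, ⟨n, s, h.1, rfl, rfl, fun i hi => ⟨h.lt i hi, ?_⟩⟩, ?_, ?_⟩
  · ext v
    have e := hα (s n) ⟨hle, le_rfl⟩ (v.1, 0)
    rw [hγb, hαb, mul_zero, add_zero, add_zero] at e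
    exact e.symm.trans (hrestr v)
  · refine ⟨α, continuousOn_of_subdivision h.lt fun i hi => ?_, fun t _ => rfl⟩
    obtain ⟨φ, p, ha, hp, hν, -⟩ := hadj i hi
    obtain ⟨W, hW, hsub, hg, hs⟩ := ha.smooth
    refine (hs.continuousOn.mono hsub).congr fun t ht => ?_
    have key : ∀ (x x' : M) (q q' : E →L[ℝ] ℝ), x = x' → q = q' →
        CotangentBundle.mk I x q = CotangentBundle.mk I x' q' := by
      rintro x _ q _ rfl rfl
      rfl
    exact key _ _ _ _ (hν t ht) (hp t ht)
  · obtain ⟨φ, p, ha, hp, hν, hu, h0⟩ := hadj i hi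
    refine ⟨_, ha.isCharacteristicCurve, fun t ht => ?_, fun hi0 => ?_⟩
    · exact mk_restrictVertical_congr (hu t ht) (hp t (Ioc_subset_Icc_self ht))
    · subst hi0
      exact mk_restrictVertical_congr (h0 rfl) (hp _ ⟨le_rfl, (h.lt 0 hi).le⟩)
  · intro t ht z hz
    have e := hamLift_restrictVertical_sub lam (ubar t).1 z hz (α t)
    suffices hs : γ ((P t).symm ((G.vel z, G.L z) : E × ℝ)) ≤
        γ ((P t).symm ((G.vel (ubar t).1, G.L (ubar t).1) : E × ℝ)) by
      rw [hα t ht, hα t ht] at hs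
      dsimp only [η]
      linarith
    -- The generators of the cone have times in ]a, b] only. At the initial time the condition comes
    -- from the limit on the first piece, whose jet there is that of the curve itself.
    rcases eq_or_lt_of_le ht.1 with h0 | h0
    · subst h0
      obtain ⟨φ, P', hp, hφ, hm⟩ := hpiece 0 h.1
      have hmem0 : s 0 ∈ Icc (s 0) (s (0 + 1)) := ⟨le_rfl, hp.lt.le⟩
      have e0 : ∀ z, G.ν z = G.ν (ubar (s 0)).1 →
          G.extended.ν (z, (ubar (s 0)).2) = G.extended.ν (ubar (s 0)) :=
        fun z hz => Prod.ext hz rfl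
      have e1 := hm _ hmem0 (z, (ubar (s 0)).2) ((e0 z hz).trans (hp.base_eq _ hmem0))
      have e2 : (G.extended.vel (φ (s 0)).1 : E × ℝ) = G.extended.vel (ubar (s 0)) := by
        rw [← hφ rfl]
      rw [e2, ← hp.frame_eq _ hmem0] at e1
      exact e1
    · exact hmax t ⟨h0, ht.2⟩ (z, (ubar t).2) (Prod.ext hz rfl)
  · intro t ht h0
    obtain ⟨h1, rfl⟩ := Prod.ext_iff.1 h0
    refine hne (Prod.ext ?_ rfl)
    ext v
    -- A vertical vector at the end is carried back to a vertical vector at time t. Since pairings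
    -- are preserved, vanishing at time t would force vanishing at the end.
    obtain ⟨y, hy⟩ : ∃ y : E × ℝ, y = P t ((P (s n)).symm ((v.1, 0) : E × ℝ)) := ⟨_, rfl⟩
    have hyv : G.timeForm (G.ν (ubar t).1) y.1 = 0 := by
      have e := h.timeForm_eq ((P (s n)).symm ((v.1, 0) : E × ℝ)) ht
      rw [ContinuousLinearEquiv.apply_symm_apply, ← hy] at e
      exact (G.extended_timeForm _ _ y).symm.trans (e.trans ((G.extended_timeForm _ _ _).trans v.2))
    have e1 := hα t ht y
    rw [hy, ContinuousLinearEquiv.symm_apply_apply, hγb, hαb, ← hy] at e1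
    have e2 : α t y.1 = 0 := DFunLike.congr_fun h1 (⟨y.1, hyv⟩ : G.Vert (G.ν (ubar t).1))
    have e3 := hrestr v
    rw [zero_mul, zero_mul, add_zero, add_zero] at e1
    exact e3.symm.trans (e1.trans e2)

end FromCoframes

/-! ### From multipliers to the dual cone. -/

section Transported

theorem extended_vert_fst (z : U × ℝ) (v : G.extended.Vert (G.extended.ν z)) :
    G.timeForm (G.ν z.1) (v.1 : E × ℝ).1 = 0 :=
  (G.extended_timeForm _ _ (v.1 : E × ℝ)).symm.trans v.2

/-- On vertical vectors the covector of `H_λ` is the given vertical covector. -/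
theorem hamLift_apply_eq (lam : ℝ) (j : G.VertDualOverU) (α : E →L[ℝ] ℝ)
    (hα : restrictVertical (I := I) (m := G.ν j.1) G.τ α = j.2) (v : E)
    (hv : G.timeForm (G.ν j.1) v = 0) : hamLift lam j v = α v :=
  DFunLike.congr_fun ((restrictVertical_hamLift lam j).trans hα.symm) (⟨v, hv⟩ : G.Vert (G.ν j.1))

theorem extendedCovector_apply (lam : ℝ) (z : U × ℝ) (θ : G.VertDual (G.ν z.1))
    (v : G.extended.Vert (G.extended.ν z)) :
    G.extendedCovector (G.extended.ν z) (θ, lam) v =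
      hamLift lam (⟨z.1, θ⟩ : G.VertDualOverU) (v.1 : E × ℝ).1 + lam * (v.1 : E × ℝ).2 := by
  have h := DFunLike.congr_fun (restrictVertical_hamLift lam (⟨z.1, θ⟩ : G.VertDualOverU))
    (⟨(v.1 : E × ℝ).1, extended_vert_fst z v⟩ : G.Vert (G.ν z.1))
  exact congrArg (· + lam * (v.1 : E × ℝ).2) h.symm

section Transport

variable {ubar : ℝ → U × ℝ} {a b t₀ : ℝ} {η : ∀ t, G.VertDual (G.ν (ubar t).1)} {lam : ℝ}
  {X : ∀ t, G.extended.Vert (G.extended.ν (ubar t))}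

/-- The covector of H_λ may jump with u at break points. On vertical vectors, however, it agrees
with any other lift of η, in particular with a continuous one. -/
theorem IsMultiplier.continuousOn_pairing
    (hm : G.IsMultiplier a b (fun t => (ubar t).1) η lam) (ht₀ : a ≤ t₀)
    (hX : ContinuousOn (fun t => (⟨G.extended.ν (ubar t), (X t).1⟩ :
      TangentBundle (I.prod 𝓘(ℝ, ℝ)) (M × ℝ))) (Icc t₀ b)) :
    ContinuousOn (fun r => hamLift lam (⟨(ubar r).1, η r⟩ : G.VertDualOverU) ((X r).1 : E × ℝ).1 +
      lam * ((X r).1 : E × ℝ).2) (Icc t₀ b) := by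
  obtain ⟨α, hα, hαη⟩ := hm.continuous
  intro t ht
  have hα' := (hα.mono (Icc_subset_Icc_left ht₀)) t ht
  have hc : ContinuousWithinAt (fun t => G.ν (ubar t).1) (Icc t₀ b) t :=
    (continuousWithinAt_cotangent_iff.1 hα').1
  have h1 := (continuousWithinAt_tangent_iff.1 (hX t ht)).2
  have h2 : ContinuousWithinAt (fun r => ((chartDiff I (G.ν (ubar t).1) (G.ν (ubar r).1)
      ((X r).1 : E × ℝ).1, ((X r).1 : E × ℝ).2) : E × ℝ)) (Icc t₀ b) t := by
    have hs := eventually_mem_source (I := I) (m₀ := G.ν (ubar t).1) hc (mem_extChartAt_source _)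
    refine h1.congr_of_eventuallyEq ?_ ?_
    · filter_upwards [hs] with r hr
      exact (chartDiff_prod (I := I) hr (ubar t).2 (ubar r).2 (X r).1).symm
    · exact (chartDiff_prod (I := I) (mem_extChartAt_source _) (ubar t).2 (ubar t).2 (X t).1).symm
  have h3 := continuousWithinAt_pairing hα' (continuousWithinAt_tangent_iff.2 ⟨hc, h2.fst⟩)
  refine (h3.add (h2.snd.const_mul lam)).congr (fun r hr => ?_) ?_
  · rw [hamLift_apply_eq lam (⟨(ubar r).1, η r⟩ : G.VertDualOverU) (α r)
      (hαη r ⟨ht₀.trans hr.1, hr.2⟩) _ (extended_vert_fst _ (X r))]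
    rfl
  · rw [hamLift_apply_eq lam (⟨(ubar t).1, η t⟩ : G.VertDualOverU) (α t)
      (hαη t ⟨ht₀.trans ht.1, ht.2⟩) _ (extended_vert_fst _ (X t))]
    rfl

variable [I.Boundaryless] [IU.Boundaryless] {ψ : ∀ t, G.extended.JetFibre (ubar t)}

/-- Let w be the image of the transported vector under the jet, so that Tν w is its M-component. The
transport equation contributes `hamRate` of w, and the contraction equation tested on w says that
the derivative of the covector cancels it. -/
theorem IsMultiplier.hasDerivWithinAt_pairing
    (hm : G.IsMultiplier a b (fun t => (ubar t).1) η lam) {t : ℝ} (ht : t ∈ Ioc a b)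
    (hX : MDifferentiableWithinAt 𝓘(ℝ, ℝ) (I.prod 𝓘(ℝ, ℝ)).tangent
        (fun r => (⟨G.extended.ν (ubar r), (X r).1⟩ :
          TangentBundle (I.prod 𝓘(ℝ, ℝ)) (M × ℝ))) (Iic t) t ∧
      tangentMapWithin 𝓘(ℝ, ℝ) (I.prod 𝓘(ℝ, ℝ)).tangent
        (fun r => (⟨G.extended.ν (ubar r), (X r).1⟩ :
          TangentBundle (I.prod 𝓘(ℝ, ℝ)) (M × ℝ))) (Iic t) ⟨t, (1 : ℝ)⟩ =
        G.extended.controlLift ⟨ubar t, ψ t⟩ (X t).1) :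
    HasDerivWithinAt (fun r => hamLift lam (⟨(ubar r).1, η r⟩ : G.VertDualOverU) ((X r).1 : E × ℝ).1 +
      lam * ((X r).1 : E × ℝ).2) 0 (Iic t) t := by
  obtain ⟨n, s, hn, h0, hb, hs⟩ := hm.contraction
  rw [← h0, ← hb] at ht
  obtain ⟨i, hi, hti⟩ := exists_mem_subdivision ht
  obtain ⟨-, ζ, ⟨⟨V, hV, hsub, hζ⟩, hcon⟩, heq, -⟩ := hs i hi
  have htV := hsub (Ioc_subset_Icc_self hti)
  have hev : ∀ᶠ r in 𝓝[Iic t] t, (⟨(ubar r).1, η r⟩ : G.VertDualOverU) = ζ r := by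
    filter_upwards [Ioc_mem_nhdsLE hti.1] with r hr
    exact heq ⟨hr.1, hr.2.trans hti.2⟩
  have hevt : (⟨(ubar t).1, η t⟩ : G.VertDualOverU) = ζ t := heq hti
  obtain ⟨hcb, hvb, hξb⟩ := (transport_iff ubar ψ (fun r => (X r).1) t).1 hX
  have hc : ContinuousWithinAt (fun r => G.ν (ubar r).1) (Iic t) t := hcb.fst
  have hsrc := eventually_mem_source (I := I) (m₀ := G.ν (ubar t).1) hc (mem_extChartAt_source _)
  -- the velocity of the base curve
  have hv : HasDerivWithinAt (fun r => extChartAt I (G.ν (ubar t).1) (G.ν (ubar r).1))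
      (G.vel (ubar t).1 : E) (Iic t) t := by
    have h1 := (ContinuousLinearMap.fst ℝ E ℝ).hasFDerivAt.comp_hasDerivWithinAt t hvb
    refine h1.congr (fun r _ => ?_) ?_
    · exact (congrArg Prod.fst (extChartAt_prod_real (I := I) (G.ν (ubar t).1) (G.ν (ubar r).1)
        (ubar t).2 (ubar r).2)).symm
    · exact (congrArg Prod.fst (extChartAt_prod_real (I := I) (G.ν (ubar t).1) (G.ν (ubar t).1)
        (ubar t).2 (ubar t).2)).symm
  -- the transported vector
  obtain ⟨w, hw⟩ : ∃ w : EU × ℝ, w = (ψ t).1 (X t).1 := ⟨_, rfl⟩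
  have hξ : HasDerivWithinAt (fun r => ((chartDiff I (G.ν (ubar t).1) (G.ν (ubar r).1)
      ((X r).1 : E × ℝ).1, ((X r).1 : E × ℝ).2) : E × ℝ))
      (G.velDeriv (ubar t).1 w.1, diff IU G.L (ubar t).1 w.1) (Iic t) t := by
    rw [← hw] at hξb
    refine (hξb.congr_of_eventuallyEq ?_ ?_).congr_deriv
      (extended_velDeriv (ubar t).1 (ubar t).2 w)
    · filter_upwards [hsrc] with r hr
      exact (chartDiff_prod (I := I) hr (ubar t).2 (ubar r).2 (X r).1).symm
    · exact (chartDiff_prod (I := I) (mem_extChartAt_source _) (ubar t).2 (ubar t).2 (X t).1).symm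
  have hpw : G.projDeriv (ubar t).1 w.1 = ((X t).1 : E × ℝ).1 := by
    have e : (G.extended.projDeriv (ubar t) w : E × ℝ) = (X t).1 := by
      rw [hw]
      exact congrArg (fun A => (A (X t).1 : E × ℝ)) (ψ t).2
    rw [← e]
    exact (congrArg Prod.fst (G.extended_projDeriv (ubar t).1 (ubar t).2 w)).symm
  -- the adjoint equation
  obtain ⟨β, hβ⟩ := hζ.exists_hasDerivAt lam hV htV
  have hvζ : HasDerivAt (fun r => extChartAt I (G.ν (ζ t).1) (G.ν (ζ r).1))
      (G.vel (ζ t).1 : E) t := by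
    have hζt : MDifferentiableAt 𝓘(ℝ, ℝ) I (fun r => G.ν (ζ r).1) t :=
      ((G.contMDiff_ν.comp_contMDiffOn hζ.1).contMDiffAt (hV.mem_nhds htV)).mdifferentiableAt
        (by simp)
    obtain ⟨-, h2⟩ := (mfderiv_curve_iff (I := I) _).1 ⟨hζt, rfl⟩
    -- The smooth curve ζ has a two-sided derivative, and the value is determined by the left
    -- derivative, where ζ coincides with the given control.
    refine h2.congr_deriv ((uniqueDiffOn_Iic t t self_mem_Iic).eq_deriv _ h2.hasDerivWithinAt ?_)
    rw [← hevt]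
    refine hv.congr_of_eventuallyEq ?_ (by rw [← hevt])
    filter_upwards [hev] with r hr
    rw [← hr]
  have hadj := (contractionVanishes_iff lam hV hζ htV hvζ hβ).1
    (hcon t (Ioc_subset_Icc_self hti)) w.1
  rw [← hevt] at hadj hβ
  have hp : HasDerivWithinAt (fun r => (hamLift lam (⟨(ubar r).1, η r⟩ : G.VertDualOverU)).comp
      (chartDiffInv I (G.ν (ubar t).1) (G.ν (ubar r).1))) β (Iic t) t := by
    refine hβ.hasDerivWithinAt.congr_of_eventuallyEq ?_ ?_
    · filter_upwards [hev] with r hr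
      rw [← hr]
    · rw [← hevt]
  have h5 := _root_.hasDerivWithinAt_pairing (I := I) (c := fun r => G.ν (ubar r).1) hc hp hξ.fst
  have h6 := h5.add
    (((ContinuousLinearMap.snd ℝ E ℝ).hasFDerivAt.comp_hasDerivWithinAt t hξ).const_mul lam)
  refine h6.congr_deriv ?_
  rw [← hpw, add_assoc]
  exact hadj

omit [I.Boundaryless] [IU.Boundaryless] in
theorem IsMultiplier.pairing_nonpos (hm : G.IsMultiplier a b (fun t => (ubar t).1) η lam) {t : ℝ}
    (ht : t ∈ Icc a b) {z : U} (hz : G.ν z = G.ν (ubar t).1) {v : E × ℝ}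
    (hv : v = ((G.vel z, G.L z) : E × ℝ) - ((G.vel (ubar t).1, G.L (ubar t).1) : E × ℝ)) :
    hamLift lam (⟨(ubar t).1, η t⟩ : G.VertDualOverU) v.1 + lam * v.2 ≤ 0 := by
  have h1 := hm.maximum t ht z hz
  obtain ⟨p, hp⟩ : ∃ p : E →L[ℝ] ℝ, p = hamLift lam (⟨(ubar t).1, η t⟩ : G.VertDualOverU) :=
    ⟨_, rfl⟩
  have h2 : p (G.velAt z hz : E) + lam * G.L z ≤
      p (G.vel (ubar t).1 : E) + lam * G.L (ubar t).1 := by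
    rw [hp]
    exact h1
  rw [velAt_eq z hz] at h2
  have h3 : p v.1 = p (G.vel z : E) - p (G.vel (ubar t).1 : E) := by
    rw [hv]
    exact map_sub p (G.vel z : E) (G.vel (ubar t).1 : E)
  have h4 : v.2 = G.L z - G.L (ubar t).1 := by rw [hv]; rfl
  rw [← hp, h3, h4]
  linarith

theorem IsMultiplier.pairing_eq (hm : G.IsMultiplier a b (fun t => (ubar t).1) η lam) {t : ℝ}
    (ht : t ∈ Ioc a b) {v : G.extended.Vert (G.extended.ν (ubar t))}
    {w : G.extended.Vert (G.extended.ν (ubar b))} (h : G.extended.IsTransport ubar ψ t b v w) :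
    hamLift lam (⟨(ubar b).1, η b⟩ : G.VertDualOverU) (w.1 : E × ℝ).1 + lam * (w.1 : E × ℝ).2 =
      hamLift lam (⟨(ubar t).1, η t⟩ : G.VertDualOverU) (v.1 : E × ℝ).1 +
        lam * (v.1 : E × ℝ).2 := by
  obtain ⟨X, hXc, rfl, rfl, hX⟩ := h
  exact (eq_of_has_deriv_left_zero ht.2 (hm.continuousOn_pairing ht.1.le hXc)
    fun r hr => hm.hasDerivWithinAt_pairing ⟨ht.1.trans hr.1, hr.2⟩ (hX r hr)).symm

/-- Multipliers define covectors in the dual of the vertical variational cone of the extended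
control. -/
theorem IsMultiplier.mem_dualCone (hm : G.IsMultiplier a b (fun t => (ubar t).1) η lam) :
    G.extendedCovector (G.extended.ν (ubar b)) (η b, lam) ∈
      dualCone (G.extended.verticalCone a b ubar ψ) := by
  rintro _ ⟨k, δ, w, hδ, hw, rfl⟩
  rw [map_sum]
  refine Finset.sum_nonpos fun i _ => ?_
  rw [map_smul]
  refine mul_nonpos_of_nonneg_of_nonpos (hδ i) ?_
  obtain ⟨t, ht, W, Y, v, ⟨hW, σ, -, hσ⟩, hmem, hv, hX⟩ := hw i
  rw [extendedCovector_apply, hm.pairing_eq ht hX]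
  obtain ⟨h, hY⟩ := hσ _ hmem
  refine hm.pairing_nonpos (Ioc_subset_Icc_self ht) (z := (σ (G.extended.ν (ubar t))).1)
    (congrArg Prod.fst h) ?_
  obtain ⟨x, hx⟩ : ∃ x : E × ℝ, x = G.extended.vel (ubar t) := ⟨_, rfl⟩
  obtain ⟨y, hy⟩ : ∃ y : E × ℝ, y = Y (G.extended.ν (ubar t)) := ⟨_, rfl⟩
  have e : y = G.extended.vel (σ (G.extended.ν (ubar t))) := hy.trans (hY.trans (velAt_eq _ h))
  have hv' : (v.1 : E × ℝ) = y - x := by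
    rw [hx, hy]
    exact hv
  rw [hv', e, hx]
  rfl

end Transport

end Transported

section Cone

/-! ### The dual and the closure of the vertical variational cone -/

/-- The inclusion `V_mτ → V_{(m, J)}τ̄`. -/
def vertInl (x : M × ℝ) : G.Vert x.1 →L[ℝ] G.extended.Vert x :=
  ((ContinuousLinearMap.inl ℝ E ℝ).comp (G.Vert x.1).subtypeL).codRestrict (G.extended.Vert x)
    (fun v => (G.mfderiv_τ_fst x.1 x.2 (v.1, 0)).trans v.2)

/-- The vector `∂/∂J` of `V_{(m, J)}τ̄`. -/
def vertInr (G : GeometricOptimalControlStructure I M IU U IQ Q IF F) (x : M × ℝ) :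
    G.extended.Vert x :=
  ⟨((0, 1) : E × ℝ), (G.mfderiv_τ_fst x.1 x.2 (0, 1)).trans (map_zero _)⟩

theorem vertInl_add_vertInr (x : M × ℝ) (v : G.extended.Vert x) :
    vertInl x (G.vertFst x v) + G.vertSnd x v • vertInr G x = v := by
  refine Subtype.ext ?_
  have h : ∀ y : E × ℝ, (y.1, 0) + y.2 • ((0, 1) : E × ℝ) = y := fun y => by ext <;> simp
  exact h v.1

/-- The separation argument ranges over all continuous functionals on the extended vertical space;
this brings them to the form for which multipliers are available. -/
theorem exists_eq_extendedCovector (x : M × ℝ) (α : G.extended.VertDual x) :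
    ∃ p, α = G.extendedCovector x p := by
  refine ⟨(α.comp (vertInl x), α (vertInr G x)), ?_⟩
  ext v
  conv_lhs => rw [← vertInl_add_vertInr x v, map_add, map_smul, smul_eq_mul, mul_comm]
  rfl

theorem exists_vertSplit_eq (x : M × ℝ) (y : G.Vert x.1 × ℝ) : ∃ v, G.vertSplit x v = y := by
  refine ⟨vertInl x y.1 + y.2 • vertInr G x, Prod.ext (Subtype.ext ?_) ?_⟩
  · have h : ∀ (e : E) (r : ℝ), (((e, 0) : E × ℝ) + r • ((0, 1) : E × ℝ)).1 = e := fun e r => by simp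
    exact h _ _
  · have h : ∀ (e : E) (r : ℝ), (((e, 0) : E × ℝ) + r • ((0, 1) : E × ℝ)).2 = r := fun e r => by simp
    exact h _ _

theorem locallyConvexSpace_vert (G : GeometricControlStructure I M IU U IQ Q IF F) (x : M) :
    LocallyConvexSpace ℝ (G.Vert x) :=
  inferInstanceAs (LocallyConvexSpace ℝ (LinearMap.ker (G.timeForm x).toLinearMap))

theorem mem_closure_verticalCone_iff {G : GeometricControlStructure I M IU U IQ Q IF F} {a b : ℝ}
    {u : ℝ → U} {ψ : ∀ t, G.JetFibre (u t)} {v : G.Vert (G.ν (u b))} :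
    v ∈ closure (G.verticalCone a b u ψ) ↔ ∀ α ∈ dualCone (G.verticalCone a b u ψ), α v ≤ 0 := by
  have := locallyConvexSpace_vert G (G.ν (u b))
  exact mem_closure_finiteConicCombinations_iff

variable [I.Boundaryless] [IU.Boundaryless] [CompleteSpace E] [T2Space M] {a b : ℝ} {u : ℝ → U}

/-- The covectors in the dual of the vertical variational cone of the extended control are the end
values of the multipliers. -/
theorem mem_dualCone_extendedCone_iff (hu : G.IsControl a b u) {J₀ : ℝ}
    {ψ : ∀ t, G.extended.JetFibre (G.extendedControl u a J₀ t)}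
    (hψ : G.extended.IsPiecewiseAdmissible a b (G.extendedControl u a J₀) ψ)
    (η₀ : G.VertDual (G.ν (u b))) (lam : ℝ) (hne : (η₀, lam) ≠ (0, 0)) :
    G.extendedCovector (G.ν (u b), J₀ + ∫ s in a..b, G.L (u s)) (η₀, lam) ∈
        dualCone (G.extendedCone a b u J₀ ψ) ↔
      ∃ η : ∀ t, G.VertDual (G.ν (u t)), η b = η₀ ∧ G.IsMultiplier a b u η lam := by
  constructor
  · intro h
    obtain ⟨P, n, s, hn, h0, hb, hs⟩ := hψ.exists_frame (hu.continuousOn_extended J₀)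
    subst h0 hb
    exact exists_isMultiplier (ubar := G.extendedControl u (s 0) J₀) (ψ := ψ) (P := P)
      ⟨hn, hs⟩ η₀ lam hne h
  · rintro ⟨η, rfl, hm⟩
    exact IsMultiplier.mem_dualCone (ubar := G.extendedControl u a J₀) (ψ := ψ) hm

/-- Nonzero covectors are characterised by multipliers of u, a condition in which neither J₀ nor ψ
occurs; the zero covector lies in every dual cone. -/
theorem dualCone_extendedCone_eq (hu : G.IsControl a b u) {J₁ J₂ : ℝ}
    {ψ₁ : ∀ t, G.extended.JetFibre (G.extendedControl u a J₁ t)}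
    {ψ₂ : ∀ t, G.extended.JetFibre (G.extendedControl u a J₂ t)}
    (h₁ : G.extended.IsPiecewiseAdmissible a b (G.extendedControl u a J₁) ψ₁)
    (h₂ : G.extended.IsPiecewiseAdmissible a b (G.extendedControl u a J₂) ψ₂) :
    G.extendedCovector (G.ν (u b), J₁ + ∫ s in a..b, G.L (u s)) ⁻¹'
        dualCone (G.extendedCone a b u J₁ ψ₁) =
      G.extendedCovector (G.ν (u b), J₂ + ∫ s in a..b, G.L (u s)) ⁻¹'
        dualCone (G.extendedCone a b u J₂ ψ₂) := by
  ext ⟨η, lam⟩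
  by_cases hne : (η, lam) = (0, 0)
  · have h0 : ∀ (x : M × ℝ) (v : G.extended.Vert x),
        G.extendedCovector x ((0 : G.VertDual x.1), (0 : ℝ)) v = 0 := fun x v => by
      simp [extendedCovector]
    rw [hne]
    exact ⟨fun _ v _ => (h0 _ v).le, fun _ v _ => (h0 _ v).le⟩
  · exact (mem_dualCone_extendedCone_iff hu h₁ η lam hne).trans
      (mem_dualCone_extendedCone_iff hu h₂ η lam hne).symm

theorem vertSplit_image_closure_subset (hu : G.IsControl a b u) {J₁ J₂ : ℝ}
    {ψ₁ : ∀ t, G.extended.JetFibre (G.extendedControl u a J₁ t)}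
    {ψ₂ : ∀ t, G.extended.JetFibre (G.extendedControl u a J₂ t)}
    (h₁ : G.extended.IsPiecewiseAdmissible a b (G.extendedControl u a J₁) ψ₁)
    (h₂ : G.extended.IsPiecewiseAdmissible a b (G.extendedControl u a J₂) ψ₂) :
    G.vertSplit (G.ν (u b), J₁ + ∫ s in a..b, G.L (u s)) ''
        closure (G.extendedCone a b u J₁ ψ₁) ⊆
      G.vertSplit (G.ν (u b), J₂ + ∫ s in a..b, G.L (u s)) ''
        closure (G.extendedCone a b u J₂ ψ₂) := by
  rintro _ ⟨v, hv, rfl⟩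
  obtain ⟨w, hw⟩ := exists_vertSplit_eq (G := G) (G.ν (u b), J₂ + ∫ s in a..b, G.L (u s))
    (G.vertSplit (G.ν (u b), J₁ + ∫ s in a..b, G.L (u s)) v)
  refine ⟨w, (mem_closure_verticalCone_iff (G := G.extended) (u := G.extendedControl u a J₂)
    (ψ := ψ₂)).2 fun α hα => ?_, hw⟩
  -- The same pair `p` defines a covector at both end points. Equality of the dual cones transfers
  -- the inequality from `v` to `w`, which have equal components.
  obtain ⟨p, rfl⟩ := exists_eq_extendedCovector _ α
  have hp : p ∈ G.extendedCovector (G.ν (u b), J₁ + ∫ s in a..b, G.L (u s)) ⁻¹'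
      dualCone (G.extendedCone a b u J₁ ψ₁) := by
    rw [dualCone_extendedCone_eq hu h₁ h₂]
    exact hα
  have h3 := (mem_closure_verticalCone_iff (G := G.extended) (u := G.extendedControl u a J₁)
    (ψ := ψ₁)).1 hv _ hp
  obtain ⟨hw1, hw2⟩ := Prod.ext_iff.1 hw
  change p.1 (G.vertFst _ w) + p.2 * G.vertSnd _ w ≤ 0
  have e1 : G.vertFst (G.ν (u b), J₂ + ∫ s in a..b, G.L (u s)) w =
    G.vertFst (G.ν (u b), J₁ + ∫ s in a..b, G.L (u s)) v := hw1
  have e2 : G.vertSnd (G.ν (u b), J₂ + ∫ s in a..b, G.L (u s)) w =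
    G.vertSnd (G.ν (u b), J₁ + ∫ s in a..b, G.L (u s)) v := hw2
  rw [e2]
  exact (congrArg (fun y => p.1 y + _) e1).trans_le h3

end Cone

end GeometricOptimalControlStructure

end

theorem theorem7p2
    {E : Type*} [NormedAddCommGroup E] [NormedSpace ℝ E] [FiniteDimensional ℝ E]
    {M : Type*} [TopologicalSpace M] [T2Space M] [SecondCountableTopology M] [ChartedSpace E M]
    [IsManifold 𝓘(ℝ, E) ∞ M]
    {EU : Type*} [NormedAddCommGroup EU] [NormedSpace ℝ EU] [FiniteDimensional ℝ EU]
    {U : Type*} [TopologicalSpace U] [T2Space U] [SecondCountableTopology U] [ChartedSpace EU U]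
    [IsManifold 𝓘(ℝ, EU) ∞ U]
    {EQ : Type*} [NormedAddCommGroup EQ] [NormedSpace ℝ EQ] [FiniteDimensional ℝ EQ]
    {Q : Type*} [TopologicalSpace Q] [T2Space Q] [SecondCountableTopology Q] [ChartedSpace EQ Q]
    [IsManifold 𝓘(ℝ, EQ) ∞ Q]
    {EF : Type*} [NormedAddCommGroup EF] [NormedSpace ℝ EF] [FiniteDimensional ℝ EF]
    {F : Type*} [TopologicalSpace F] [T2Space F] [SecondCountableTopology F] [ChartedSpace EF F]
    [IsManifold 𝓘(ℝ, EF) ∞ F]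
    (G : GeometricOptimalControlStructure 𝓘(ℝ, E) M 𝓘(ℝ, EU) U 𝓘(ℝ, EQ) Q 𝓘(ℝ, EF) F)
    (a b : ℝ) (u : ℝ → U) (hu : G.IsControl a b u) :
    (∀ (J₀ : ℝ) (ψ : ∀ t, G.extended.JetFibre (G.extendedControl u a J₀ t)),
      G.extended.IsPiecewiseAdmissible a b (G.extendedControl u a J₀) ψ →
      ∀ (η₀ : G.VertDual (G.ν (u b))) (lam₀ : ℝ), (η₀, lam₀) ≠ (0, 0) →
        (G.extendedCovector (G.ν (u b), J₀ + ∫ s in a..b, G.L (u s)) (η₀, lam₀) ∈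
            dualCone (G.extendedCone a b u J₀ ψ) ↔
          ∃ η : ∀ t, G.VertDual (G.ν (u t)), η b = η₀ ∧ G.IsMultiplier a b u η lam₀)) ∧
    (∀ (J₁ J₂ : ℝ) (ψ₁ : ∀ t, G.extended.JetFibre (G.extendedControl u a J₁ t))
      (ψ₂ : ∀ t, G.extended.JetFibre (G.extendedControl u a J₂ t)),
      G.extended.IsPiecewiseAdmissible a b (G.extendedControl u a J₁) ψ₁ →
      G.extended.IsPiecewiseAdmissible a b (G.extendedControl u a J₂) ψ₂ →
      G.extendedCovector (G.ν (u b), J₁ + ∫ s in a..b, G.L (u s)) ⁻¹'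
          dualCone (G.extendedCone a b u J₁ ψ₁) =
        G.extendedCovector (G.ν (u b), J₂ + ∫ s in a..b, G.L (u s)) ⁻¹'
          dualCone (G.extendedCone a b u J₂ ψ₂) ∧
      G.vertSplit (G.ν (u b), J₁ + ∫ s in a..b, G.L (u s)) ''
          closure (G.extendedCone a b u J₁ ψ₁) =
        G.vertSplit (G.ν (u b), J₂ + ∫ s in a..b, G.L (u s)) ''
          closure (G.extendedCone a b u J₂ ψ₂)) := by
  have : CompleteSpace E := FiniteDimensional.complete ℝ E
  refine ⟨fun J₀ ψ hψ η₀ lam₀ hne =>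
    GeometricOptimalControlStructure.mem_dualCone_extendedCone_iff hu hψ η₀ lam₀ hne,
    fun J₁ J₂ ψ₁ ψ₂ h₁ h₂ => ⟨?_, ?_⟩⟩
  · exact GeometricOptimalControlStructure.dualCone_extendedCone_eq hu h₁ h₂
  · exact Subset.antisymm
      (GeometricOptimalControlStructure.vertSplit_image_closure_subset hu h₁ h₂)
      (GeometricOptimalControlStructure.vertSplit_image_closure_subset hu h₂ h₁)
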